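/- Let $\mathfrak X$ be a countably infinite alphabet containing pairwise distinct letters $x,y_i,z_i,t_i,z_i',t_i'$ ($i\ge 1$), and let $\mathfrak X^*$ be the free monoid of words over $\mathfrak X$, with the empty word $1$ as identity. A letter is simple in a word if it occurs in it exactly once; $\mathbf w_a$ denotes the word obtained from $\mathbf w$ by deleting all occurrences of the letter $a$. A monoid variety is the class of all monoids satisfying some set of identities $\mathbf u\approx\mathbf v$ with $\mathbf u,\mathbf v\in\mathfrak X^*$. For a variety $\mathbf V$, let $\mathrm{FIC}(\mathbf V)$ be the congruence $\{(\mathbf u,\mathbf v)\mid \mathbf V\text{ satisfies }\mathbf u\approx\mathbf v\}$ on $\mathfrak X^*$, and let $\mathfrak L(\mathbf V)$ be the lattice of subvarieties of $\mathbf V$ ordered by inclusion. For a congruence $\alpha$ on $\mathfrak X^*$ and a set $\mathtt W$ of $\alpha$-classes, let $M_\alpha(\mathtt W)$ be the Rees quotient of $\mathfrak X^*/\alpha$ over the ideal of all elements that are not factors in $\mathfrak X^*/\alpha$ of elements of $\mathtt W$ ($\mathtt v$ is a factor of $\mathtt u$ if $\mathtt u=\mathtt p\mathtt v\mathtt s$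 for some $\mathtt p,\mathtt s\in\mathfrak X^*/\alpha$), and let $\mathbf M_\alpha(\mathtt W)$ be the variety generated by $M_\alpha(\mathtt W)$; the subscript $\alpha$ is omitted when $\alpha$ is the equality relation. Write $\mathbf u\mathrel{\gamma}\mathbf v$ if $\mathbf u$ and $\mathbf v$ have the same simple letters and $\mathbf u=a_1^{e_1}\cdots a_r^{e_r}$, $\mathbf v=a_1^{f_1}\cdots a_r^{f_r}$ for some letters $a_i$ with $a_i\ne a_{i+1}$ and some exponents $e_i,f_i\ge1$. Put $\gamma'=\gamma\cap\mathrm{FIC}(\mathbf M(\{xy_1x\}))$, and let $[\mathbf w]^{\gamma'}$ be the $\gamma'$-class of the word $\mathbf w$. For integers $n,m\ge0$ with $n+m\ge 1$, an $(n,m)$-permutation is a permutation $\rho$ of $\{1,\dots,n+m\}$, written on the right of its argument, such that for each $i=1,\dots,n+m-1$ exactly one of $i\rho$, $(i+1)\rho$ is at most $n$ (so $|n-m|\le1$). Define \[ \mathbf z_i^{(1)}=\begin{cases} z_i & i\le n,\\ z_iy_i^2z_i' & i>n,\end{cases}\quad \mathbf z_i^{(2)}=\begin{cases} z_iy_i^2z_i'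 & i\le n,\\ z_i & i>n,\end{cases}\quad \mathbf z_i^{(3)}=\begin{cases} z_iy_i^2 & i\le n,\\ z_i & i>n,\end{cases}\quad \mathbf z_i^{(4)}=\begin{cases} z_i & i\le n,\\ z_iy_i^2 & i>n,\end{cases} \] and \begin{align*} \mathbf a_{n,m}^{(1)}[\rho]&=\Bigl(\prod_{i=1}^n z_it_i\Bigr)x\Bigl(\prod_{i=1}^{n+m}\mathbf z_{i\rho}^{(1)}\Bigr)x\Bigl(\prod_{i=n+1}^{n+m}t_iz_it_i'z_i'\Bigr),\\ \mathbf a_{n,m}^{(2)}[\rho]&=\Bigl(\prod_{i=1}^n z_it_iz_i't_i'\Bigr)x\Bigl(\prod_{i=1}^{n+m}\mathbf z_{i\rho}^{(2)}\Bigr)x\Bigl(\prod_{i=n+1}^{n+m}t_iz_i\Bigr),\\ \mathbf a_{n,m}^{(p)}[\rho]&=\Bigl(\prod_{i=1}^n z_it_i\Bigr)x\Bigl(\prod_{i=1}^{n+m-1}\mathbf z_{i\rho}^{(p)}\Bigr)\bigl(\mathbf z_{(n+m)\rho}^{(p)}\bigr)_{y_{(n+m)\rho}}x\Bigl(\prod_{i=n+1}^{n+m}t_iz_i\Bigr)\qquad(p=3,4).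 \end{align*} **Proposition.** Let $k,k'\ge0$ be integers with $|k-k'|\le1$, let $\pi$ be a $(k,k')$-permutation and let $p\in\{1,2,3,4\}$. Suppose that either $k+k'\ge2$, or $p=1$ and $(k,k')=(0,1)$, or $p=2$ and $(k,k')=(1,0)$; equivalently, the factor of $\mathbf a^{(p)}_{k,k'}[\pi]$ between the two occurrences of $x$ has more than one letter. Then the lattice $\mathfrak L\bigl(\mathbf M_{\gamma'}(\{[\mathbf a^{(p)}_{k,k'}[\pi]]^{\gamma'}\})\bigr)$ is not distributive. -/

import Mathlib

namespace MonVar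

/-! ## Words -/

/-- A countably infinite alphabet, containing the letters `x`, `y_i`, `z_i`, `t_i`, `z_i'`, `t_i'`
(`i` a natural number), all of them distinct. -/
inductive Letter where
  | x : Letter
  | y : ℕ → Letter
  | z : ℕ → Letter
  | t : ℕ → Letter
  | z' : ℕ → Letter
  | t' : ℕ → Letter
  deriving DecidableEq

instance : Infinite Letter :=
  Infinite.of_injective Letter.y (fun _ _ h => Letter.y.inj h)

instance : Countable Letter := by
  let f : Letter → ℕ × ℕ := fun a => match a with
    | .x => (0, 0)
    | .y i => (1, i)
    | .z i => (2, i)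
    | .t i => (3, i)
    | .z' i => (4, i)
    | .t' i => (5, i)
  have hf : Function.Injective f := by
    intro a b h
    cases a <;> cases b <;> simp_all [f]
  exact hf.countable

/-- Words: elements of the free monoid over the alphabet. -/
abbrev Word : Type := FreeMonoid Letter

/-- The one-letter word `a`. -/
abbrev ltr (a : Letter) : Word := FreeMonoid.of a

/-- The number of occurrences of the letter `a` in the word `w`. -/
def occ (a : Letter) (w : Word) : ℕ := (FreeMonoid.toList w).count a

/-- The set of letters that are simple in `w`, i.e. occur in `w` exactly once. -/
def simpleLetters (w : Word) : Set Letter := {a | occ a w = 1}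

/-- The word obtained from `w` by deleting all occurrences of the letter `a`. -/
def deleteLetter (a : Letter) (w : Word) : Word :=
  FreeMonoid.ofList ((FreeMonoid.toList w).filter (fun b => b ≠ a))

/-- The list of the letters that form the consecutive islands (maximal powers of a letter) of `w`:
`islands (a₁ ^ e₁ ⋯ a_r ^ e_r) = [a₁, …, a_r]` when all `e_i ≥ 1` and `a_i ≠ a_(i+1)`. -/
def islands (w : Word) : List Letter := (FreeMonoid.toList w).destutter (fun a b => a ≠ b)

/-! ## Identities and varieties of monoids -/

/-- The monoid `M` satisfies the identity `u ≈ v`. -/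
def Satisfies (M : Type) [Monoid M] (u v : Word) : Prop :=
  ∀ φ : Letter → M, FreeMonoid.lift φ u = FreeMonoid.lift φ v

/-- The class of all monoids that satisfy a given set of identities. -/
def models (E : Set (Word × Word)) : Set MonCat.{0} :=
  {M | ∀ e ∈ E, Satisfies M e.1 e.2}

/-- The set of all identities that hold in every monoid of a given class. -/
def identities (K : Set MonCat.{0}) : Set (Word × Word) :=
  {e | ∀ M ∈ K, Satisfies M e.1 e.2}

/-- A variety of monoids: a class of monoids given by a set of identities. -/
@[ext]
structure Variety where
  carrier : Set MonCat.{0}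
  equational : ∃ E : Set (Word × Word), carrier = models E

namespace Variety

/-- `var E`, the variety given by the set `E` of identities. -/
def var (E : Set (Word × Word)) : Variety := ⟨models E, E, rfl⟩

/-- Varieties are ordered by inclusion. -/
instance : PartialOrder Variety :=
  PartialOrder.lift Variety.carrier (fun _ _ h => Variety.ext h)

theorem le_def {V W : Variety} : V ≤ W ↔ V.carrier ⊆ W.carrier := Iff.rfl

theorem models_identities (V : Variety) : models (identities V.carrier) = V.carrier := by
  obtain ⟨E, hE⟩ := V.equational
  apply Set.Subset.antisymm
  · intro M hM
    rw [hE]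
    intro e he
    refine hM e ?_
    intro N hN
    rw [hE] at hN
    exact hN e he
  · intro M hM e he
    exact he M hM

/-- The lattice of all varieties: the meet is the intersection, the join is the least variety
containing both. -/
instance : Lattice Variety where
  inf V W := ⟨V.carrier ∩ W.carrier, by
    obtain ⟨E, hE⟩ := V.equational
    obtain ⟨F, hF⟩ := W.equational
    refine ⟨E ∪ F, ?_⟩
    ext M
    simp only [hE, hF, models, Set.mem_inter_iff, Set.mem_ofPred_eq, Set.mem_union]
    constructor
    · rintro ⟨h1, h2⟩ e (he | he)
      · exact h1 e he
      · exact h2 e he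
    · intro h
      exact ⟨fun e he => h e (Or.inl he), fun e he => h e (Or.inr he)⟩⟩
  inf_le_left _ _ := le_def.2 Set.inter_subset_left
  inf_le_right _ _ := le_def.2 Set.inter_subset_right
  le_inf _ _ _ h1 h2 := le_def.2 (Set.subset_inter (le_def.1 h1) (le_def.1 h2))
  sup V W := var (identities (V.carrier ∪ W.carrier))
  le_sup_left V W := le_def.2 fun M hM _ he => he M (Or.inl hM)
  le_sup_right V W := le_def.2 fun M hM _ he => he M (Or.inr hM)
  sup_le V W U h1 h2 := le_def.2 fun M hM => by
    rw [← models_identities U]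
    intro e he
    refine hM e ?_
    rintro N (hN | hN)
    · exact he N (le_def.1 h1 hN)
    · exact he N (le_def.1 h2 hN)

/-- The variety generated by the monoid `M`. -/
def generatedBy (M : Type) [Monoid M] : Variety := var (identities {MonCat.of M})

/-- `generatedBy M` is the least variety that contains `M`. -/
theorem generatedBy_le_iff (M : Type) [Monoid M] (V : Variety) :
    generatedBy M ≤ V ↔ MonCat.of M ∈ V.carrier := by
  constructor
  · intro h
    exact le_def.1 h (fun e he => he _ rfl)
  · intro h
    refine le_def.2 fun N hN => ?_
    rw [← models_identities V]
    intro e he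
    refine hN e ?_
    intro P hP
    rw [Set.mem_singleton_iff] at hP
    subst hP
    exact he _ h

/-- `FIC V`: the fully invariant congruence on the free monoid corresponding to the variety `V`,
i.e. the relation `V satisfies u ≈ v`. -/
def FIC (V : Variety) : Con Word where
  r u v := ∀ M ∈ V.carrier, Satisfies M u v
  iseqv :=
    { refl := fun _ _ _ _ => rfl
      symm := fun h M hM φ => (h M hM φ).symm
      trans := fun h1 h2 M hM φ => (h1 M hM φ).trans (h2 M hM φ) }
  mul' := by
    intro a b c d h1 h2 M hM φ
    rw [map_mul, map_mul, h1 M hM φ, h2 M hM φ]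

/-- A variety is distributive if the lattice of its subvarieties is distributive. -/
def IsDistributive (V : Variety) : Prop :=
  ∀ X Y Z : Set.Iic V, (X ⊔ Y) ⊓ Z = (X ⊓ Z) ⊔ (Y ⊓ Z)

end Variety

/-! ## Rees quotients -/

section Rees

variable {N : Type} [Monoid N]

/-- The set of all factors of elements of `W`. -/
def factors (W : Set N) : Set N := {v | ∃ u ∈ W, ∃ p s : N, u = p * v * s}

/-- The Rees congruence of the ideal consisting of the elements that are not factors of elements
of `W`: it identifies all elements of this ideal and nothing else. -/
def reesCon (W : Set N) : Con N where
  r a b := a = b ∨ (a ∉ factors W ∧ b ∉ factors W)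
  iseqv :=
    { refl := fun _ => Or.inl rfl
      symm := by
        rintro a b (h | ⟨h1, h2⟩)
        · exact Or.inl h.symm
        · exact Or.inr ⟨h2, h1⟩
      trans := by
        rintro a b c (rfl | ⟨h1, h2⟩) (rfl | ⟨h3, h4⟩)
        · exact Or.inl rfl
        · exact Or.inr ⟨h3, h4⟩
        · exact Or.inr ⟨h1, h2⟩
        · exact Or.inr ⟨h1, h4⟩ }
  mul' := by
    have hl : ∀ a b : N, a ∉ factors W → a * b ∉ factors W := by
      rintro a b ha ⟨u, hu, p, s, rfl⟩
      exact ha ⟨_, hu, p, b * s, by simp only [mul_assoc]⟩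
    have hr : ∀ a b : N, b ∉ factors W → a * b ∉ factors W := by
      rintro a b hb ⟨u, hu, p, s, rfl⟩
      exact hb ⟨_, hu, p * a, s, by simp only [mul_assoc]⟩
    rintro a b c d (rfl | ⟨h1, h2⟩) (rfl | ⟨h3, h4⟩)
    · exact Or.inl rfl
    · exact Or.inr ⟨hr _ _ h3, hr _ _ h4⟩
    · exact Or.inr ⟨hl _ _ h1, hl _ _ h2⟩
    · exact Or.inr ⟨hl _ _ h1, hl _ _ h2⟩

/-- The Rees quotient of `N` over the ideal of the elements that are not factors of elements
of `W`. -/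
abbrev ReesQuotient (W : Set N) : Type := (reesCon W).Quotient

end Rees

/-- `M(W)` for a set `W` of words. -/
abbrev MWord (W : Set Word) : Type := ReesQuotient W

/-- `M_α(W)` for a congruence `α` on the free monoid and a set `W` of `α`-classes. -/
abbrev MCon (α : Con Word) (W : Set α.Quotient) : Type := ReesQuotient W

/-! ## The congruences `γ` and `γ'` -/

section Islands

theorem head_destutter' (a : Letter) (l : List Letter) :
    (l.destutter' (fun a b => a ≠ b) a).head? = some a := by
  induction l with
  | nil => rfl
  | cons b l ih =>
    by_cases h : a = b
    · subst h
      rw [List.destutter'_cons_neg _ (by simp)]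
      exact ih
    · rw [List.destutter'_cons_pos _ h]
      rfl

theorem destutter_cons_eq (a : Letter) (l : List Letter) :
    (a :: l).destutter (fun a b => a ≠ b) =
      if (l.destutter (fun a b => a ≠ b)).head? = some a
      then l.destutter (fun a b => a ≠ b) else a :: l.destutter (fun a b => a ≠ b) := by
  cases l with
  | nil => simp
  | cons b l =>
    rw [List.destutter_cons', List.destutter_cons', head_destutter']
    by_cases h : a = b
    · subst h
      rw [List.destutter'_cons_neg _ (by simp)]
      simp
    · rw [List.destutter'_cons_pos _ h, if_neg]
      intro h'
      exact h (Option.some.inj h').symm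

theorem destutter_append_left (w u v : List Letter)
    (h : u.destutter (fun a b => a ≠ b) = v.destutter (fun a b => a ≠ b)) :
    (w ++ u).destutter (fun a b => a ≠ b) = (w ++ v).destutter (fun a b => a ≠ b) := by
  induction w with
  | nil => exact h
  | cons a w ih => rw [List.cons_append, List.cons_append, destutter_cons_eq, destutter_cons_eq, ih]

theorem destutter_append_destutter (u w : List Letter) :
    (u.destutter (fun a b => a ≠ b) ++ w).destutter (fun a b => a ≠ b) =
      (u ++ w).destutter (fun a b => a ≠ b) := by
  induction u with
  | nil => rfl
  | cons a u ih =>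
    rw [List.cons_append, destutter_cons_eq a (u ++ w), ← ih, destutter_cons_eq a u]
    split_ifs with h1 h2 h2
    · rfl
    · exfalso
      apply h2
      obtain ⟨l, hl⟩ : ∃ l, u.destutter (fun a b => a ≠ b) = a :: l := by
        cases hd : u.destutter (fun a b => a ≠ b) with
        | nil => rw [hd] at h1; simp at h1
        | cons b l =>
          rw [hd] at h1
          simp only [List.head?_cons, Option.some.injEq] at h1
          exact ⟨l, by rw [h1]⟩
      rw [hl, List.cons_append, List.destutter_cons', head_destutter']
    · rw [List.cons_append, destutter_cons_eq, if_pos h2]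
    · rw [List.cons_append, destutter_cons_eq, if_neg h2]

theorem islands_mul {a b c d : Word} (h1 : islands a = islands b) (h2 : islands c = islands d) :
    islands (a * c) = islands (b * d) := by
  unfold islands at *
  rw [FreeMonoid.toList_mul, FreeMonoid.toList_mul, destutter_append_left _ _ _ h2,
    ← destutter_append_destutter, h1, destutter_append_destutter]

theorem mem_islands (a : Letter) (w : Word) : a ∈ islands w ↔ 0 < occ a w := by
  unfold islands occ
  rw [List.count_pos_iff]
  generalize FreeMonoid.toList w = l
  induction l with
  | nil => simp
  | cons b l ih =>
    rw [destutter_cons_eq]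
    split_ifs with h
    · rw [ih, List.mem_cons]
      constructor
      · exact Or.inr
      · rintro (rfl | h')
        · exact ih.1 (List.mem_of_mem_head? h)
        · exact h'
    · rw [List.mem_cons, List.mem_cons, ih]

end Islands

/-- `u γ v` if and only if the same letters are simple in `u` and in `v`, and `u` can be obtained
from `v` by changing the individual exponents of letters, i.e. the consecutive islands of `u` and
of `v` are powers of the same letters. -/
def gammaCon : Con Word where
  r u v := simpleLetters u = simpleLetters v ∧ islands u = islands v
  iseqv :=
    { refl := fun _ => ⟨rfl, rfl⟩
      symm := fun h => ⟨h.1.symm, h.2.symm⟩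
      trans := fun h1 h2 => ⟨h1.1.trans h2.1, h1.2.trans h2.2⟩ }
  mul' := by
    rintro a b c d ⟨h1, h2⟩ ⟨h3, h4⟩
    refine ⟨?_, islands_mul h2 h4⟩
    ext e
    have k1 : occ e a = 1 ↔ occ e b = 1 := Set.ext_iff.1 h1 e
    have k2 : occ e c = 1 ↔ occ e d = 1 := Set.ext_iff.1 h3 e
    have k3 : 0 < occ e a ↔ 0 < occ e b := by rw [← mem_islands, h2, mem_islands]
    have k4 : 0 < occ e c ↔ 0 < occ e d := by rw [← mem_islands, h4, mem_islands]
    have hm : ∀ u v : Word, occ e (u * v) = occ e u + occ e v := by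
      intro u v
      unfold occ
      rw [FreeMonoid.toList_mul, List.count_append]
    change occ e (a * c) = 1 ↔ occ e (b * d) = 1
    rw [hm, hm]
    omega

/-- The word `xyx`. -/
def xyx : Word := ltr .x * ltr (.y 0) * ltr .x

/-- `γ' = γ ∧ FIC(𝐌(xyx))`, where `𝐌(xyx)` is the variety generated by `M(xyx)`. -/
def gammaPrime : Con Word :=
  gammaCon ⊓ (Variety.generatedBy (MWord {xyx})).FIC

/-- For a word `w`, the variety generated by the monoid `M_{γ'}([w]^{γ'})`. -/
def varietyMGammaPrime (w : Word) : Variety :=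
  Variety.generatedBy (MCon gammaPrime {(w : gammaPrime.Quotient)})

/-! ## The words `a^{(p)}_{n,m}[ρ]`

A permutation `ρ` of `{1, …, n + m}` is encoded as a permutation of `Fin (n + m) = {0, …, n+m-1}`:
the image of `i + 1` is `(ρ i : ℕ) + 1`. The letters carry the indices `1, …, n + m`. -/

/-- `ρ` is an `(n,m)`-permutation: of the images of any two consecutive numbers, exactly one is
at most `n`. -/
def IsNMPerm (n m : ℕ) (ρ : Equiv.Perm (Fin (n + m))) : Prop :=
  ∀ i j : Fin (n + m), (j : ℕ) = (i : ℕ) + 1 →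
    ((ρ i : ℕ) < n ∧ n ≤ (ρ j : ℕ)) ∨ ((ρ j : ℕ) < n ∧ n ≤ (ρ i : ℕ))

/-- The product `f (a) f (a+1) ⋯ f (a + len - 1)` of words. -/
def prodFrom (a len : ℕ) (f : ℕ → Word) : Word := ((List.range' a len).map f).prod

/-- The word `z_i^{(1)}`. -/
def zw1 (n i : ℕ) : Word :=
  if i ≤ n then ltr (.z i) else ltr (.z i) * ltr (.y i) ^ 2 * ltr (.z' i)

/-- The word `z_i^{(2)}`. -/
def zw2 (n i : ℕ) : Word :=
  if i ≤ n then ltr (.z i) * ltr (.y i) ^ 2 * ltr (.z' i) else ltr (.z i)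

/-- The word `z_i^{(3)}`. -/
def zw3 (n i : ℕ) : Word :=
  if i ≤ n then ltr (.z i) * ltr (.y i) ^ 2 else ltr (.z i)

/-- The word `z_i^{(4)}`. -/
def zw4 (n i : ℕ) : Word :=
  if i ≤ n then ltr (.z i) else ltr (.z i) * ltr (.y i) ^ 2

/-- The product of the words `f (1ρ), f (2ρ), …, f (Nρ)`. -/
def permProd {N : ℕ} (ρ : Equiv.Perm (Fin N)) (f : ℕ → Word) : Word :=
  ((List.finRange N).map fun (i : Fin N) => f ((ρ i : ℕ) + 1)).prod

/-- The product of the words `f (1ρ), f (2ρ), …, f ((N-1)ρ), g`, where `g` is obtained from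
`f (Nρ)` by deleting the letter `y_{Nρ}`. -/
def permProdDel {N : ℕ} (ρ : Equiv.Perm (Fin N)) (f : ℕ → Word) : Word :=
  ((List.finRange N).map fun (i : Fin N) =>
    if i.val + 1 = N then deleteLetter (.y ((ρ i : ℕ) + 1)) (f ((ρ i : ℕ) + 1))
    else f ((ρ i : ℕ) + 1)).prod

/-- The word `a^{(1)}_{n,m}[ρ]`. -/
def a1 (n m : ℕ) (ρ : Equiv.Perm (Fin (n + m))) : Word :=
  prodFrom 1 n (fun i => ltr (.z i) * ltr (.t i)) *
    ltr .x * permProd ρ (zw1 n) * ltr .x *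
    prodFrom (n + 1) m (fun i => ltr (.t i) * ltr (.z i) * ltr (.t' i) * ltr (.z' i))

/-- The word `a^{(2)}_{n,m}[ρ]`. -/
def a2 (n m : ℕ) (ρ : Equiv.Perm (Fin (n + m))) : Word :=
  prodFrom 1 n (fun i => ltr (.z i) * ltr (.t i) * ltr (.z' i) * ltr (.t' i)) *
    ltr .x * permProd ρ (zw2 n) * ltr .x *
    prodFrom (n + 1) m (fun i => ltr (.t i) * ltr (.z i))

/-- The word `a^{(3)}_{n,m}[ρ]`. -/
def a3 (n m : ℕ) (ρ : Equiv.Perm (Fin (n + m))) : Word :=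
  prodFrom 1 n (fun i => ltr (.z i) * ltr (.t i)) *
    ltr .x * permProdDel ρ (zw3 n) * ltr .x *
    prodFrom (n + 1) m (fun i => ltr (.t i) * ltr (.z i))

/-- The word `a^{(4)}_{n,m}[ρ]`. -/
def a4 (n m : ℕ) (ρ : Equiv.Perm (Fin (n + m))) : Word :=
  prodFrom 1 n (fun i => ltr (.z i) * ltr (.t i)) *
    ltr .x * permProdDel ρ (zw4 n) * ltr .x *
    prodFrom (n + 1) m (fun i => ltr (.t i) * ltr (.z i))

/-- The word `a^{(p)}_{n,m}[ρ]` for `p = 1, 2, 3, 4` (other values of `p` are not used). -/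
def aWord (p n m : ℕ) (ρ : Equiv.Perm (Fin (n + m))) : Word :=
  match p with
  | 1 => a1 n m ρ
  | 2 => a2 n m ρ
  | 3 => a3 n m ρ
  | _ => a4 n m ρ

end MonVar

/-! Let `A` be the γ'-class of the given word. The word has the form `oS S · x · block · x · oF F`.
Each letter `z` (or `z'`) occurs once in an outer part, next to its own simple letter `tau z`, and
once in the block; each `y` in the block is squared. The identities of `M(xyx)` see every pattern `z
⋯ tau z ⋯ z`, so within `A` only the exponents of the two powers of `x` and of the powers of the
`y`'s are free (`Good.expl`, `Good.sys`). Hence `x` may be repeated at an end of the block but never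
in its interior.

Four words refute distributivity (`not_isDistributive_of_closed`). They contain copies 0, 1, 2, 3 of
the pattern over disjoint alphabets with a common `x`, written `none`. The outer parts stand side by
side; in the middle come the first letter `f` of block 0, its inner letters, the letter `f` of block
3, the whole blocks 2 and 1, the last letter `l` of block 0, and the rest of block 3. From this word
`W0` the words `Wi`, `Wj`, `Wij` arise by inserting `x` after the first letter of the middle, before
its last letter, and at both places. The first insertion spoils copy 0 only, the second one copy 3
only. Let X be given by `W0 ≈ Wi`, `Wj ≈ Wij`, let Y be given by `W0 ≈ Wj` and Z by `Wi ≈ Wij`, all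
inside the given variety. Then `W0 ≈ Wj` holds in X ∧ Z and in Y ∧ Z, but it fails in (X ∨ Y) ∧ Z.
The witness is the syntactic monoid of `CX ∩ CY`, where `CX` requires the projections to the copies
1, 2, 3 to lie in `A`, and `CY` those to the copies 0, 1, 2. Both languages also require the word to
behave like `W0` in all tests in which no letter is replaced by a power of `x` (`Evt`); these tests
record the order of letters of different copies.

The main work is to show that the languages are closed under these identities for every substitution
`φ`. An inserted `φ none` can do harm only if it becomes a power of `x` in some copy and cuts the
block of that copy, which then lies in the image of the surrounded factor (`Sys.mid_of_crossing`).
Since the blocks alternate, the blocks of the other relevant copies lie there too (`Sys.overlap`).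
Each letter `(d, k)` with `k` in `F` then has a preimage of the same kind, and taking preimages
preserves the order of the outer parts (`Ctx.exists_preimage`, `Ctx.before`). So many letters would
be mapped injectively into a smaller set. Reading words backwards exchanges `S` with `F`, the copy
`c` with the copy `3 - c`, and `CX` with `CY`; half of the cases follow by this duality. -/

namespace MonVar

/-! ## Lists without consecutive repetitions -/

/-- `l` with every island replaced by a single letter. -/
abbrev dst (l : List Letter) : List Letter := l.destutter (fun a b => a ≠ b)

theorem dst_append_congr {a b c d : List Letter} (h1 : dst a = dst b) (h2 : dst c = dst d) :
    dst (a ++ c) = dst (b ++ d) :=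
  islands_mul (a := FreeMonoid.ofList a) (b := FreeMonoid.ofList b)
    (c := FreeMonoid.ofList c) (d := FreeMonoid.ofList d) h1 h2

theorem mem_dst {a : Letter} {l : List Letter} : a ∈ dst l ↔ a ∈ l := by
  have := mem_islands a (FreeMonoid.ofList l)
  simpa [islands, occ, List.count_pos_iff] using this

theorem dst_of_isChain {l : List Letter} (h : l.IsChain (fun a b => a ≠ b)) : dst l = l := by
  induction l with
  | nil => rfl
  | cons a l ih =>
    rw [dst, destutter_cons_eq]
    have := ih h.of_cons
    rw [dst] at this
    rw [this, if_neg]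
    intro h'
    cases l with
    | nil => simp at h'
    | cons b l =>
      simp only [List.head?_cons, Option.some.injEq] at h'
      rw [List.isChain_cons_cons] at h
      exact h.1 h'.symm

theorem dst_of_nodup {l : List Letter} (h : l.Nodup) : dst l = l :=
  dst_of_isChain (List.Pairwise.isChain h)

/-- Neighbouring letters of an alternating subsequence come from different islands, so the
subsequence survives the collapse. Forbidden patterns such as `x e x e' x` are thereby excluded by
counting islands. -/
theorem sublist_dst {l v : List Letter} (h : l.Sublist v) (hl : l.IsChain (fun a b => a ≠ b)) :
    l.Sublist (dst v) := by
  induction h with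
  | slnil => simp
  | @cons l v b h ih =>
    have := ih hl
    rw [dst, destutter_cons_eq]
    split_ifs
    · exact this
    · exact this.cons _
  | @cons_cons l v b h ih =>
    have h1 := ih hl.of_cons
    rw [dst, destutter_cons_eq]
    split_ifs with hb
    · obtain ⟨D, hD⟩ : ∃ D, dst v = b :: D := by
        cases hd : dst v with
        | nil => rw [dst] at hd; rw [hd] at hb; simp at hb
        | cons c D =>
          rw [dst] at hd
          rw [hd] at hb
          simp only [List.head?_cons, Option.some.injEq] at hb
          exact ⟨D, by rw [hb]⟩
      rw [dst] at hD h1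
      rw [hD] at h1 ⊢
      refine List.Sublist.cons_cons _ ?_
      cases l with
      | nil => simp
      | cons c l =>
        rw [List.isChain_cons_cons] at hl
        rcases List.cons_sublist_cons'.1 h1 with h | h
        · exact h
        · exact absurd h.1.symm hl.1
    · exact h1.cons_cons _

/-- A cut of the island sequence falls between two islands, so it lifts to a cut of the word that
breaks no island. -/
theorem exists_append_of_dst {v l1 l2 : List Letter} (h : dst v = l1 ++ l2) :
    ∃ v1 v2, v = v1 ++ v2 ∧ dst v1 = l1 ∧ dst v2 = l2 := by
  induction v generalizing l1 with
  | nil =>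
    have : l1 = [] ∧ l2 = [] := by simpa [dst, eq_comm] using h
    exact ⟨[], [], by simp [this.1, this.2]⟩
  | cons b v ih =>
    cases l1 with
    | nil => exact ⟨[], b :: v, rfl, by simp, h⟩
    | cons a l1 =>
      rw [dst, destutter_cons_eq] at h
      split_ifs at h with hb
      · obtain ⟨v1, v2, e, h1, h2⟩ := ih h
        refine ⟨b :: v1, v2, by rw [e]; rfl, ?_, h2⟩
        rw [dst] at h1
        rw [dst, destutter_cons_eq, h1, if_pos]
        rw [h] at hb
        exact hb
      · rw [List.cons_append, List.cons.injEq] at h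
        obtain ⟨v1, v2, e, h1, h2⟩ := ih h.2
        refine ⟨b :: v1, v2, by rw [e]; rfl, ?_, h2⟩
        rw [dst] at h1
        rw [dst, destutter_cons_eq, h1, if_neg, h.1]
        intro h'
        apply hb
        rw [h.2]
        cases l1 with
        | nil => simp at h'
        | cons c l1 => exact h'

theorem eq_replicate_of_dst {v : List Letter} {c : Letter} (h : dst v = [c]) :
    ∃ k, v = List.replicate (k + 1) c := by
  have h1 : ∀ b ∈ v, b = c := by
    intro b hb
    rw [← mem_dst, h] at hb
    simpa using hb
  rw [← List.eq_replicate_length] at h1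
  cases hk : v.length with
  | zero =>
    rw [List.length_eq_zero_iff.1 hk] at h
    simp [dst] at h
  | succ k => exact ⟨k, by rw [h1, hk]⟩

theorem dst_replicate_succ (k : ℕ) (c : Letter) : dst (List.replicate (k + 1) c) = [c] := by
  induction k with
  | zero => simp [dst]
  | succ k ih =>
    rw [List.replicate_succ, dst, destutter_cons_eq]
    rw [dst] at ih
    rw [ih]
    simp


theorem isChain_dst (l : List Letter) : (dst l).IsChain (fun a b => a ≠ b) :=
  List.isChain_destutter _ _

theorem isChain_ne_reverse {l : List Letter} (h : l.IsChain (fun a b => a ≠ b)) :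
    l.reverse.IsChain (fun a b => a ≠ b) := by
  rw [List.isChain_reverse]
  exact h.imp fun _ _ h => h.symm

theorem dst_reverse (l : List Letter) : dst l.reverse = (dst l).reverse := by
  induction l with
  | nil => rfl
  | cons a l ih =>
    have h1 : dst (l.reverse ++ [a]) = dst ((dst l).reverse ++ [a]) :=
      dst_append_congr (by rw [ih, dst_of_isChain (isChain_ne_reverse (isChain_dst l))]) rfl
    have h2 := isChain_ne_reverse (isChain_dst (a :: l))
    rw [List.reverse_cons, h1]
    rw [dst, destutter_cons_eq] at h2
    conv_rhs => rw [dst, destutter_cons_eq]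
    split_ifs at h2 ⊢ with hb
    · obtain ⟨D, hD⟩ : ∃ D, dst l = a :: D := by
        cases hd : dst l with
        | nil => rw [dst] at hd; rw [hd] at hb; simp at hb
        | cons c D =>
          rw [dst] at hd
          rw [hd] at hb
          simp only [List.head?_cons, Option.some.injEq] at hb
          exact ⟨D, by rw [hb]⟩
      change (dst l).reverse.IsChain _ at h2
      change dst ((dst l).reverse ++ [a]) = (dst l).reverse
      rw [hD, List.reverse_cons] at h2 ⊢
      rw [List.append_assoc]
      rw [dst_append_congr (a := D.reverse) (b := D.reverse) (c := [a] ++ [a]) (d := [a]) rfl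
        (by simp [dst])]
      exact dst_of_isChain h2
    · rw [List.reverse_cons] at h2 ⊢
      exact dst_of_isChain h2

/-! ## Letters and patterns -/

/-- The simple letter that accompanies a letter `z_i` or `z_i'`. -/
def tau : Letter → Letter
  | .z i => .t i
  | .z' i => .t' i
  | a => a

/-- The letters `z_i` and `z_i'`. -/
def IsZ : Letter → Prop
  | .z _ => True
  | .z' _ => True
  | _ => False

/-- The letters `y_i`. -/
def IsY : Letter → Prop
  | .y _ => True
  | _ => False

instance : DecidablePred IsY := fun a => by cases a <;> unfold IsY <;> infer_instance

theorem tau_inj {a b : Letter} (ha : IsZ a) (hb : IsZ b) (h : tau a = tau b) : a = b := by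
  cases a <;> cases b <;> simp_all [tau, IsZ]

theorem not_isZ_tau {a : Letter} (ha : IsZ a) : ¬ IsZ (tau a) := by
  cases a <;> simp_all [tau, IsZ]

theorem not_isY_tau {a : Letter} (ha : IsZ a) : ¬ IsY (tau a) := by
  cases a <;> simp_all [tau, IsZ, IsY]

theorem tau_ne_x {a : Letter} (ha : IsZ a) : tau a ≠ .x := by
  cases a <;> simp_all [tau, IsZ]

theorem not_isY_of_isZ {a : Letter} (ha : IsZ a) : ¬ IsY a := by
  cases a <;> simp_all [IsY, IsZ]

theorem ne_x_of_isZ {a : Letter} (ha : IsZ a) : a ≠ .x := by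
  cases a <;> simp_all [IsZ]

theorem ne_x_of_isY {a : Letter} (ha : IsY a) : a ≠ .x := by
  cases a <;> simp_all [IsY]

theorem tau_ne {a b : Letter} (ha : IsZ a) (hb : IsZ b) : tau a ≠ b := fun h =>
  not_isZ_tau ha (h ▸ hb)

/-- `s₁ τ(s₁) s₂ τ(s₂) ⋯`. -/
def oS (S : List Letter) : List Letter := S.flatMap fun s => [s, tau s]

/-- `τ(f₁) f₁ τ(f₂) f₂ ⋯`. -/
def oF (F : List Letter) : List Letter := F.flatMap fun s => [tau s, s]

/-- A letter `y` is squared, every other letter is kept. -/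
def sq (h : Letter) : List Letter := if IsY h then [h, h] else [h]

/-- The word with all letters `y` squared. -/
def bl (b : List Letter) : List Letter := b.flatMap sq

theorem sq_reverse (h : Letter) : (sq h).reverse = sq h := by
  unfold sq; split_ifs <;> rfl

theorem oS_reverse (S : List Letter) : (oS S).reverse = oF S.reverse := by
  rw [oS, List.reverse_flatMap, oF]
  congr 1

theorem oF_reverse (S : List Letter) : (oF S).reverse = oS S.reverse := by
  rw [oF, List.reverse_flatMap, oS]
  congr 1

theorem bl_reverse (b : List Letter) : (bl b).reverse = bl b.reverse := by
  rw [bl, List.reverse_flatMap, bl]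
  congr 1
  funext h
  exact sq_reverse h

theorem oS_append (S T : List Letter) : oS (S ++ T) = oS S ++ oS T := List.flatMap_append

theorem oF_append (S T : List Letter) : oF (S ++ T) = oF S ++ oF T := List.flatMap_append

theorem bl_append (S T : List Letter) : bl (S ++ T) = bl S ++ bl T := List.flatMap_append

theorem oS_cons (s : Letter) (T : List Letter) : oS (s :: T) = s :: tau s :: oS T := rfl

theorem oF_cons (s : Letter) (T : List Letter) : oF (s :: T) = tau s :: s :: oF T := rfl

theorem bl_cons (s : Letter) (T : List Letter) : bl (s :: T) = sq s ++ bl T := rfl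

theorem mem_oS {S : List Letter} {a : Letter} : a ∈ oS S ↔ a ∈ S ∨ ∃ s ∈ S, a = tau s := by
  simp only [oS, List.mem_flatMap, List.mem_cons, List.not_mem_nil, or_false]
  constructor
  · rintro ⟨s, hs, rfl | rfl⟩
    · exact Or.inl hs
    · exact Or.inr ⟨s, hs, rfl⟩
  · rintro (h | ⟨s, hs, rfl⟩)
    · exact ⟨a, h, Or.inl rfl⟩
    · exact ⟨s, hs, Or.inr rfl⟩

theorem mem_oF {S : List Letter} {a : Letter} : a ∈ oF S ↔ a ∈ S ∨ ∃ s ∈ S, a = tau s := by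
  rw [← List.mem_reverse, oF_reverse, mem_oS]
  simp

theorem mem_sq {a h : Letter} : a ∈ sq h ↔ a = h := by
  unfold sq; split_ifs <;> simp

theorem mem_bl {b : List Letter} {a : Letter} : a ∈ bl b ↔ a ∈ b := by
  simp [bl, mem_sq]

theorem dst_bl (b : List Letter) : dst (bl b) = dst b := by
  induction b with
  | nil => rfl
  | cons h b ih =>
    refine dst_append_congr (a := sq h) (b := [h]) ?_ ih
    unfold sq
    split_ifs <;> simp [dst]

theorem count_bl {b : List Letter} {a : Letter} (ha : ¬ IsY a) : (bl b).count a = b.count a := by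
  induction b with
  | nil => rfl
  | cons h b ih =>
    rw [bl_cons, List.count_append, ih, List.count_cons]
    unfold sq
    by_cases hh : h = a
    · subst hh
      simp [ha, add_comm]
    · have : (if IsY h then [h, h] else [h]).count a = 0 := by
        rw [List.count_eq_zero]
        split_ifs <;> simp [Ne.symm hh]
      simp [hh, this]

theorem two_le_count_bl {b : List Letter} {a : Letter} (ha : IsY a) (h : a ∈ b) :
    2 ≤ (bl b).count a := by
  obtain ⟨b1, b2, rfl⟩ := List.append_of_mem h
  rw [bl_append, bl_cons, List.count_append, List.count_append]
  simp only [sq, ha, if_true, List.count_cons_self]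
  omega

/-- The data of a word of the shape `oS S · x · f mid l · x · oF F`. -/
structure Pat where
  S : List Letter
  F : List Letter
  f : Letter
  mid : List Letter
  l : Letter

namespace Pat

variable (P : Pat)

/-- The block between the two occurrences of `x`. -/
def blk : List Letter := P.f :: (P.mid ++ [P.l])

/-- The word with outer parts `oS S` and `oF F`, inner part `b` and two powers of `x`. -/
def frame (i : ℕ) (b : List Letter) (j : ℕ) : List Letter :=
  oS P.S ++ (List.replicate i .x ++ (b ++ (List.replicate j .x ++ oF P.F)))

/-- The word of the pattern. -/
def word : List Letter := P.frame 1 (bl P.blk) 1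

/-- The pattern read from right to left. -/
def rev : Pat := ⟨P.F.reverse, P.S.reverse, P.l, P.mid.reverse, P.f⟩

theorem rev_blk : P.rev.blk = P.blk.reverse := by simp [rev, blk]

theorem frame_reverse (i j : ℕ) (b : List Letter) :
    (P.frame i b j).reverse = P.rev.frame j b.reverse i := by
  simp [frame, rev, oS_reverse, oF_reverse]

theorem word_reverse : P.word.reverse = P.rev.word := by
  rw [word, frame_reverse, word, rev_blk, bl_reverse]

/-- The conditions on a pattern: the letters of `S` and `F` are different letters of the form
`z_i`, `z_i'`, the block consists of these letters and of some letters `y_i`, each once, and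
the two letters at either end of the block are of different kinds. -/
structure Good : Prop where
  nodup : (P.S ++ P.F).Nodup
  isZ : ∀ h ∈ P.S ++ P.F, IsZ h
  blk_nodup : P.blk.Nodup
  blk_mem : ∀ h ∈ P.blk, h ∈ P.S ++ P.F ∨ IsY h
  mem_blk : ∀ h ∈ P.S ++ P.F, h ∈ P.blk
  f_mem : P.f ∈ P.S ++ P.F
  l_mem : P.l ∈ P.S ++ P.F
  f_kind : ∀ g r, P.mid ++ [P.l] = g :: r → ¬ (P.f ∈ P.S ∧ g ∈ P.S) ∧ ¬ (P.f ∈ P.F ∧ g ∈ P.F)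
  l_kind : ∀ g r, P.f :: P.mid = r ++ [g] → ¬ (P.l ∈ P.S ∧ g ∈ P.S) ∧ ¬ (P.l ∈ P.F ∧ g ∈ P.F)

/-- The inner parts of the words equivalent to the word of a pattern. -/
structure Blk (b : List Letter) : Prop where
  dst_eq : dst b = P.blk
  count_z : ∀ h ∈ P.S ++ P.F, b.count h = 1
  count_y : ∀ h ∈ P.blk, IsY h → 2 ≤ b.count h

/-- The properties of the `γ'`-class of the word of a pattern that are used. -/
structure Sys (A : List Letter → Prop) : Prop where
  good : P.Good
  base : A P.word
  expl : ∀ v, A v → ∃ i j b, v = P.frame (i + 1) b (j + 1) ∧ P.Blk b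
  ins : ∀ c l1 l2 i j, (c = .x ∨ IsY c) →
    2 ≤ (l1 ++ (List.replicate (i + 1) c ++ l2)).count c →
    2 ≤ (l1 ++ (List.replicate (j + 1) c ++ l2)).count c →
    A (l1 ++ (List.replicate (i + 1) c ++ l2)) → A (l1 ++ (List.replicate (j + 1) c ++ l2))

variable {P}

theorem mem_rev {h : Letter} : h ∈ P.rev.S ++ P.rev.F ↔ h ∈ P.S ++ P.F := by
  simp [rev, or_comm]

theorem Good.rev (hP : P.Good) : P.rev.Good where
  nodup := by
    have := List.nodup_reverse.2 hP.nodup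
    simpa [Pat.rev] using this
  isZ h hh := hP.isZ h (mem_rev.1 hh)
  blk_nodup := by rw [rev_blk]; exact List.nodup_reverse.2 hP.blk_nodup
  blk_mem h hh := by
    rw [rev_blk, List.mem_reverse] at hh
    rw [mem_rev]
    exact hP.blk_mem h hh
  mem_blk h hh := by
    rw [rev_blk, List.mem_reverse]
    exact hP.mem_blk h (mem_rev.1 hh)
  f_mem := mem_rev.2 hP.l_mem
  l_mem := mem_rev.2 hP.f_mem
  f_kind g r h := by
    have := congrArg List.reverse h
    have := hP.l_kind g r.reverse (by simpa [Pat.rev] using this)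
    simp only [Pat.rev, List.mem_reverse]
    exact this.symm
  l_kind g r h := by
    have := congrArg List.reverse h
    have := hP.f_kind g r.reverse (by simpa [Pat.rev] using this)
    simp only [Pat.rev, List.mem_reverse]
    exact this.symm

theorem Blk.rev {b : List Letter} (h : P.Blk b) : P.rev.Blk b.reverse where
  dst_eq := by rw [dst_reverse, h.dst_eq, rev_blk]
  count_z a ha := by rw [List.count_reverse]; exact h.count_z a (mem_rev.1 ha)
  count_y a ha hy := by
    rw [rev_blk, List.mem_reverse] at ha
    rw [List.count_reverse]
    exact h.count_y a ha hy

theorem Sys.rev {A : List Letter → Prop} (h : P.Sys A) : P.rev.Sys (fun v => A v.reverse) where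
  good := h.good.rev
  base := by
    rw [← word_reverse, List.reverse_reverse]
    exact h.base
  expl v hv := by
    obtain ⟨i, j, b, e, hb⟩ := h.expl _ hv
    refine ⟨j, i, b.reverse, ?_, hb.rev⟩
    rw [← frame_reverse, ← e, List.reverse_reverse]
  ins c l1 l2 i j hc h1 h2 hA := by
    have := h.ins c l2.reverse l1.reverse i j hc (by simpa [add_comm, add_left_comm] using h1)
      (by simpa [add_comm, add_left_comm] using h2) (by simpa using hA)
    simpa using this

theorem rev_rev : P.rev.rev = P := by simp [rev]

end Pat


/-! ### Occurrences and islands in the words of the class -/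

theorem oS_nodup {S : List Letter} (h : S.Nodup) (hz : ∀ s ∈ S, IsZ s) : (oS S).Nodup := by
  induction S with
  | nil => simp [oS]
  | cons s S ih =>
    rw [List.nodup_cons] at h
    have hs := hz s List.mem_cons_self
    have hS : ∀ a ∈ S, IsZ a := fun a ha => hz a (List.mem_cons_of_mem _ ha)
    rw [oS_cons, List.nodup_cons, List.nodup_cons]
    refine ⟨?_, ?_, ih h.2 hS⟩
    · rw [List.mem_cons, mem_oS]
      rintro (h1 | h1 | ⟨a, ha, h1⟩)
      · exact tau_ne hs hs h1.symm
      · exact h.1 h1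
      · exact tau_ne (hS a ha) hs h1.symm
    · rw [mem_oS]
      rintro (h1 | ⟨a, ha, h1⟩)
      · exact tau_ne hs (hS _ h1) rfl
      · rw [tau_inj hs (hS a ha) h1] at h
        exact h.1 ha

theorem x_notMem_oS {S : List Letter} (hz : ∀ s ∈ S, IsZ s) : Letter.x ∉ oS S := by
  rw [mem_oS]
  rintro (h | ⟨a, ha, h⟩)
  · exact ne_x_of_isZ (hz _ h) rfl
  · exact tau_ne_x (hz a ha) h.symm

theorem oF_nodup {S : List Letter} (h : S.Nodup) (hz : ∀ s ∈ S, IsZ s) : (oF S).Nodup := by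
  rw [← List.nodup_reverse, oF_reverse]
  exact oS_nodup (List.nodup_reverse.2 h) (fun s hs => hz s (List.mem_reverse.1 hs))

theorem x_notMem_oF {S : List Letter} (hz : ∀ s ∈ S, IsZ s) : Letter.x ∉ oF S := by
  rw [← List.mem_reverse, oF_reverse]
  exact x_notMem_oS (fun s hs => hz s (List.mem_reverse.1 hs))

namespace Pat

variable {P : Pat}

/-- The sequence of islands of the words equivalent to the word of the pattern. -/
def isl (P : Pat) : List Letter := oS P.S ++ (.x :: (P.blk ++ (.x :: oF P.F)))

namespace Good

variable (hP : P.Good)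
include hP

theorem S_isZ : ∀ h ∈ P.S, IsZ h := fun h hh => hP.isZ h (List.mem_append_left _ hh)

theorem F_isZ : ∀ h ∈ P.F, IsZ h := fun h hh => hP.isZ h (List.mem_append_right _ hh)

theorem S_nodup : P.S.Nodup := (List.nodup_append.1 hP.nodup).1

theorem F_nodup : P.F.Nodup := (List.nodup_append.1 hP.nodup).2.1

theorem disjoint {h : Letter} (h1 : h ∈ P.S) (h2 : h ∈ P.F) : False :=
  (List.nodup_append.1 hP.nodup).2.2 h h1 h h2 rfl

theorem x_blk : Letter.x ∉ P.blk := fun h => by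
  rcases hP.blk_mem _ h with h | h
  · exact ne_x_of_isZ (hP.isZ _ h) rfl
  · exact h

theorem tau_blk {h : Letter} (hh : h ∈ P.S ++ P.F) : tau h ∉ P.blk := fun h' => by
  rcases hP.blk_mem _ h' with h1 | h1
  · exact tau_ne (hP.isZ _ hh) (hP.isZ _ h1) rfl
  · exact not_isY_tau (hP.isZ _ hh) h1

theorem isChain_isl : P.isl.IsChain (fun a b => a ≠ b) := by
  unfold isl
  rw [List.isChain_append, List.isChain_cons, List.isChain_append, List.isChain_cons]
  refine ⟨(oS_nodup hP.S_nodup hP.S_isZ).isChain, ⟨?_, hP.blk_nodup.isChain, ⟨?_,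
    (oF_nodup hP.F_nodup hP.F_isZ).isChain⟩, ?_⟩, ?_⟩
  · intro y hy h
    have : y = P.f := by simpa [blk, eq_comm] using hy
    exact ne_x_of_isZ (hP.isZ _ hP.f_mem) (this.symm.trans h.symm)
  · intro y hy h
    rw [← h] at hy
    exact x_notMem_oF hP.F_isZ (List.mem_of_mem_head? hy)
  · intro a ha y hy h
    have : y = Letter.x := by simpa [eq_comm] using hy
    rw [h, this] at ha
    exact hP.x_blk (List.mem_of_getLast? ha)
  · intro a ha y hy h
    have : y = Letter.x := by simpa [eq_comm] using hy
    rw [h, this] at ha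
    exact x_notMem_oS hP.S_isZ (List.mem_of_getLast? ha)

end Good

theorem Blk.mem {b : List Letter} (hb : P.Blk b) {a : Letter} : a ∈ b ↔ a ∈ P.blk := by
  rw [← hb.dst_eq, mem_dst]

theorem blk_bl (hP : P.Good) : P.Blk (bl P.blk) where
  dst_eq := by rw [dst_bl, dst_of_nodup hP.blk_nodup]
  count_z h hh := by
    rw [count_bl (not_isY_of_isZ (hP.isZ h hh))]
    exact List.count_eq_one_of_mem hP.blk_nodup (hP.mem_blk h hh)
  count_y h hh hy := two_le_count_bl hy hh

theorem Good.dst_frame (hP : P.Good) {b : List Letter} (hb : P.Blk b) (i j : ℕ) :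
    dst (P.frame (i + 1) b (j + 1)) = P.isl := by
  rw [← dst_of_isChain hP.isChain_isl]
  refine dst_append_congr rfl (dst_append_congr (b := [.x]) ?_ (dst_append_congr (b := P.blk) ?_
    (dst_append_congr (b := [.x]) ?_ rfl)))
  · rw [dst_replicate_succ]; rfl
  · rw [hb.dst_eq, dst_of_nodup hP.blk_nodup]
  · rw [dst_replicate_succ]; rfl

theorem count_oS_eq_zero {S : List Letter} {a : Letter} (h1 : a ∉ S) (h2 : ∀ s ∈ S, a ≠ tau s) :
    (oS S).count a = 0 := by
  rw [List.count_eq_zero, mem_oS]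
  rintro (h | ⟨s, hs, h⟩)
  · exact h1 h
  · exact h2 s hs h

theorem count_oF_eq_zero {S : List Letter} {a : Letter} (h1 : a ∉ S) (h2 : ∀ s ∈ S, a ≠ tau s) :
    (oF S).count a = 0 := by
  rw [List.count_eq_zero, mem_oF]
  rintro (h | ⟨s, hs, h⟩)
  · exact h1 h
  · exact h2 s hs h

/-- One occurrence of `h` stands immediately before `tau h` in the outer part, the other one in the
block. This pattern `h ⋯ tau h ⋯ h` around a simple letter is what the identities of `M(xyx)`
detect. -/
theorem Good.frame_tri_S (hP : P.Good) {b : List Letter} (hb : P.Blk b) (i j : ℕ) {h : Letter}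
    (hh : h ∈ P.S) : ∃ V1 V2, P.frame i b j = V1 ++ tau h :: V2 ∧ V1.count h = 1 ∧
      V2.count h = 1 ∧ V1.count (tau h) = 0 ∧ V2.count (tau h) = 0 := by
  obtain ⟨S1, S2, e⟩ := List.append_of_mem hh
  have hz := hP.S_isZ h hh
  have hn := hP.S_nodup
  rw [e, List.nodup_middle, List.nodup_cons, List.mem_append, not_or] at hn
  have hmem : h ∈ P.S ++ P.F := List.mem_append_left _ hh
  have hS : ∀ s, s ∈ S1 ∨ s ∈ S2 → s ∈ P.S := by
    rintro s (hs | hs) <;> rw [e] <;> simp [hs]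
  have hF : h ∉ P.F := fun h' => hP.disjoint hh h'
  have t1 := fun s (hs : s ∈ S1) => (tau_ne (hP.S_isZ s (hS s (Or.inl hs))) hz).symm
  have t2 := fun s (hs : s ∈ S2) => (tau_ne (hP.S_isZ s (hS s (Or.inr hs))) hz).symm
  have t3 := fun s (hs : s ∈ P.F) => (tau_ne (hP.F_isZ s hs) hz).symm
  have n1 : tau h ∉ S1 := fun h' => tau_ne hz (hP.S_isZ _ (hS _ (Or.inl h'))) rfl
  have n2 : tau h ∉ S2 := fun h' => tau_ne hz (hP.S_isZ _ (hS _ (Or.inr h'))) rfl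
  have n3 : tau h ∉ P.F := fun h' => tau_ne hz (hP.F_isZ _ h') rfl
  have u1 : ∀ s ∈ S1, tau h ≠ tau s := fun s hs h' => hn.1.1
    (tau_inj hz (hP.S_isZ s (hS s (Or.inl hs))) h' ▸ hs)
  have u2 : ∀ s ∈ S2, tau h ≠ tau s := fun s hs h' => hn.1.2
    (tau_inj hz (hP.S_isZ s (hS s (Or.inr hs))) h' ▸ hs)
  have u3 : ∀ s ∈ P.F, tau h ≠ tau s := fun s hs h' => hF (tau_inj hz (hP.F_isZ s hs) h' ▸ hs)
  refine ⟨oS S1 ++ [h], oS S2 ++ (List.replicate i .x ++ (b ++ (List.replicate j .x ++ oF P.F))),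
    ?_, ?_, ?_, ?_, ?_⟩
  · rw [frame, e, oS_append, oS_cons]
    simp
  · rw [List.count_append, count_oS_eq_zero hn.1.1 t1]
    simp
  · simp only [List.count_append, List.count_replicate, count_oS_eq_zero hn.1.2 t2,
      count_oF_eq_zero hF t3, hb.count_z h hmem]
    simp [(ne_x_of_isZ hz).symm]
  · rw [List.count_append, count_oS_eq_zero n1 u1]
    simp [(tau_ne hz hz).symm]
  · simp only [List.count_append, List.count_replicate, count_oS_eq_zero n2 u2,
      count_oF_eq_zero n3 u3]
    have : b.count (tau h) = 0 := List.count_eq_zero.2 fun h' => hP.tau_blk hmem (hb.mem.1 h')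
    simp [(tau_ne_x hz).symm, this]

theorem Good.frame_tri (hP : P.Good) {b : List Letter} (hb : P.Blk b) (i j : ℕ) {h : Letter}
    (hh : h ∈ P.S ++ P.F) : ∃ V1 V2, P.frame i b j = V1 ++ tau h :: V2 ∧ V1.count h = 1 ∧
      V2.count h = 1 ∧ V1.count (tau h) = 0 ∧ V2.count (tau h) = 0 := by
  rcases List.mem_append.1 hh with h1 | h1
  · exact hP.frame_tri_S hb i j h1
  · obtain ⟨V1, V2, e, c1, c2, c3, c4⟩ := hP.rev.frame_tri_S hb.rev j i (h := h)
      (by simpa [Pat.rev] using h1)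
    refine ⟨V2.reverse, V1.reverse, ?_, ?_, ?_, ?_, ?_⟩
    · have := congrArg List.reverse e
      rw [← frame_reverse, List.reverse_reverse] at this
      rw [this]
      simp
    all_goals simpa using by assumption

namespace Sys

variable {A : List Letter → Prop} (hA : P.Sys A) {v : List Letter} (hv : A v)
include hA hv

theorem tri {h : Letter} (hh : h ∈ P.S ++ P.F) : ∃ V1 V2, v = V1 ++ tau h :: V2 ∧
    V1.count h = 1 ∧ V2.count h = 1 ∧ V1.count (tau h) = 0 ∧ V2.count (tau h) = 0 := by
  obtain ⟨i, j, b, rfl, hb⟩ := hA.expl v hv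
  exact hA.good.frame_tri hb _ _ hh

theorem count_z {h : Letter} (hh : h ∈ P.S ++ P.F) : v.count h = 2 := by
  obtain ⟨V1, V2, rfl, h1, h2, -, -⟩ := hA.tri hv hh
  have hz := hA.good.isZ h hh
  rw [List.count_append, List.count_cons, h1, h2]
  simp [tau_ne hz hz]

theorem count_tau {h : Letter} (hh : h ∈ P.S ++ P.F) : v.count (tau h) = 1 := by
  obtain ⟨V1, V2, rfl, -, -, h1, h2⟩ := hA.tri hv hh
  rw [List.count_append, List.count_cons, h1, h2]
  simp

theorem mem {a : Letter} (ha : a ∈ v) :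
    a = .x ∨ a ∈ P.S ++ P.F ∨ (∃ h ∈ P.S ++ P.F, a = tau h) ∨ IsY a := by
  obtain ⟨i, j, b, rfl, hb⟩ := hA.expl v hv
  simp only [frame, List.mem_append, mem_oS, mem_oF, hb.mem, List.mem_replicate] at ha
  rcases ha with (h | ⟨s, hs, h⟩) | h | h | h | h | ⟨s, hs, h⟩
  · exact Or.inr (Or.inl (List.mem_append_left _ h))
  · exact Or.inr (Or.inr (Or.inl ⟨s, List.mem_append_left _ hs, h⟩))
  · exact Or.inl h.2
  · exact Or.inr ((hA.good.blk_mem a h).imp_right Or.inr)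
  · exact Or.inl h.2
  · exact Or.inr (Or.inl (List.mem_append_right _ h))
  · exact Or.inr (Or.inr (Or.inl ⟨s, List.mem_append_right _ hs, h⟩))

theorem dst_eq : dst v = P.isl := by
  obtain ⟨i, j, b, rfl, hb⟩ := hA.expl v hv
  exact hA.good.dst_frame hb i j

/-- The block is free of repetitions and the outer parts contain no `y`, so each `y` has at most one
island in `isl`. -/
theorem not_between_y {y e : Letter} (hy : IsY y) (he : e ≠ y) : ¬ [y, e, y].Sublist v := by
  intro h
  have h1 := sublist_dst h (by simp [he, he.symm])
  rw [hA.dst_eq hv] at h1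
  have h2 := h1.count_le y
  have hn : P.blk.count y ≤ 1 := List.nodup_iff_count_le_one.1 hA.good.blk_nodup y
  have c1 : (oS P.S).count y = 0 := count_oS_eq_zero
    (fun h => not_isY_of_isZ (hA.good.S_isZ _ h) hy)
    (fun s hs h => not_isY_tau (hA.good.S_isZ _ hs) (h ▸ hy))
  have c2 : (oF P.F).count y = 0 := count_oF_eq_zero
    (fun h => not_isY_of_isZ (hA.good.F_isZ _ h) hy)
    (fun s hs h => not_isY_tau (hA.good.F_isZ _ hs) (h ▸ hy))
  have hx := (ne_x_of_isY hy).symm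
  simp [isl, List.count_append, List.count_cons, c1, c2, hx] at h2
  omega

/-- The island sequence contains `x` only twice, while the alternating subsequence with three `x`
would survive in it. -/
theorem not_alternating_x {e e' : Letter} (he : e ≠ .x) (he' : e' ≠ .x) :
    ¬ [.x, e, .x, e', .x].Sublist v := by
  intro h
  have h1 := sublist_dst h (by simp [he, he.symm, he', he'.symm])
  rw [hA.dst_eq hv] at h1
  have h2 := h1.count_le .x
  have c0 : P.blk.count .x = 0 := List.count_eq_zero.2 hA.good.x_blk
  have c1 : (oS P.S).count .x = 0 := List.count_eq_zero.2 (x_notMem_oS hA.good.S_isZ)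
  have c2 : (oF P.F).count .x = 0 := List.count_eq_zero.2 (x_notMem_oF hA.good.F_isZ)
  simp [isl, List.count_append, c0, c1, c2, he, he'] at h2

/-- Nothing but the block lies between the two groups of `x`; if `x` occurs on both sides of a
factor, this factor contains the whole block, or it is a power of `x` that precedes or follows
the block. -/
theorem split_x {r1 m r2 : List Letter} (e : v = (r1 ++ [.x]) ++ (m ++ .x :: r2)) :
    (∃ i1 i2 j1 j2 b, P.Blk b ∧ r1 ++ [.x] = oS P.S ++ List.replicate (i1 + 1) .x ∧
      m = List.replicate i2 .x ++ (b ++ List.replicate j1 .x) ∧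
      .x :: r2 = List.replicate (j2 + 1) .x ++ oF P.F) ∨
    (∃ i1 i2 i3 j b, P.Blk b ∧ r1 ++ [.x] = oS P.S ++ List.replicate (i1 + 1) .x ∧
      m = List.replicate i2 .x ∧
      .x :: r2 = List.replicate (i3 + 1) .x ++ (b ++ (List.replicate (j + 1) .x ++ oF P.F))) ∨
    (∃ i j1 j2 j3 b, P.Blk b ∧
      r1 ++ [.x] = oS P.S ++ (List.replicate (i + 1) .x ++ (b ++ List.replicate (j1 + 1) .x)) ∧
      m = List.replicate j2 .x ∧ .x :: r2 = List.replicate (j3 + 1) .x ++ oF P.F) := by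
  -- `key` pushes a marked `x` past a prefix free of `x`; `key2` decides whether it lies inside a
  -- given power of `x` or beyond it. Used for both marked letters, they leave exactly the three
  -- configurations.
  have key : ∀ (B C u w : List Letter), Letter.x ∉ B → u ++ .x :: w = B ++ C →
      ∃ D, u = B ++ D ∧ D ++ .x :: w = C := by
    intro B C u w hB h
    rcases List.append_eq_append_iff.1 h with ⟨D, h1, h2⟩ | ⟨D, h1, h2⟩
    · cases D with
      | nil => exact ⟨[], by simpa using h1.symm, by simpa using h2⟩
      | cons d D =>
        rw [List.cons_append, List.cons.injEq] at h2
        exact absurd (by rw [h1, ← h2.1]; simp) hB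
    · exact ⟨D, h1, h2.symm⟩
  have key2 : ∀ (n : ℕ) (C u w : List Letter), u ++ .x :: w = List.replicate n .x ++ C →
      (∃ k k', n = k + k' + 1 ∧ u = List.replicate k .x ∧
        .x :: w = List.replicate (k' + 1) .x ++ C) ∨
      ∃ D, u = List.replicate n .x ++ D ∧ D ++ .x :: w = C := by
    intro n
    induction n with
    | zero => intro C u w h; exact Or.inr ⟨u, by simp, by simpa using h⟩
    | succ n ih =>
      intro C u w h
      cases u with
      | nil => exact Or.inl ⟨0, n, by omega, rfl, by simpa using h⟩
      | cons a u =>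
        rw [List.replicate_succ, List.cons_append, List.cons_append, List.cons.injEq] at h
        obtain ⟨rfl, h⟩ := h
        rcases ih C u w h with ⟨k, k', rfl, h1, h2⟩ | ⟨D, h1, h2⟩
        · exact Or.inl ⟨k + 1, k', by omega, by rw [h1]; rfl, h2⟩
        · exact Or.inr ⟨D, by rw [h1]; rfl, h2⟩
  obtain ⟨i, j, b, rfl, hb⟩ := hA.expl v hv
  have hxS := x_notMem_oS hA.good.S_isZ
  have hxF := x_notMem_oF hA.good.F_isZ
  have hxb : Letter.x ∉ b := fun h => hA.good.x_blk (hb.mem.1 h)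
  have nF : ∀ u w, u ++ .x :: w ≠ oF P.F := fun u w h => hxF (h ▸ by simp)
  rw [frame, List.append_assoc, List.singleton_append] at e
  obtain ⟨D, rfl, hD⟩ := key _ _ _ _ hxS e.symm
  rcases key2 _ _ _ _ hD with ⟨k, k', hk, rfl, h2⟩ | ⟨D, rfl, hD2⟩
  · rw [List.replicate_succ, List.cons_append, List.cons.injEq] at h2
    have e1 : oS P.S ++ List.replicate k Letter.x ++ [.x] =
      oS P.S ++ List.replicate (k + 1) .x := by rw [List.append_assoc, ← List.replicate_succ']
    rcases key2 _ _ _ _ h2.2 with ⟨n, n', hn, rfl, h3⟩ | ⟨D, rfl, hD2⟩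
    · exact Or.inr (Or.inl ⟨k, n, n', j, b, hb, e1, rfl, h3⟩)
    · obtain ⟨D, rfl, hD3⟩ := key _ _ _ _ hxb hD2
      rcases key2 _ _ _ _ hD3 with ⟨n, n', hn, rfl, h3⟩ | ⟨D, rfl, hD4⟩
      · exact Or.inl ⟨k, k', n, n', b, hb, e1, rfl, h3⟩
      · exact absurd ‹_› (nF _ _)
  · obtain ⟨D, rfl, hD3⟩ := key _ _ _ _ hxb hD2
    rcases key2 _ _ _ _ hD3 with ⟨k, k', hk, rfl, h2⟩ | ⟨D, rfl, hD2⟩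
    · rw [List.replicate_succ, List.cons_append, List.cons.injEq] at h2
      rcases key2 _ _ _ _ h2.2 with ⟨n, n', hn, rfl, h3⟩ | ⟨D, rfl, hD⟩
      · refine Or.inr (Or.inr ⟨i, k, n, n', b, hb, ?_, rfl, h3⟩)
        simp only [List.append_assoc, ← List.replicate_succ']
      · exact absurd ‹_› (nF _ _)
    · exact absurd ‹_› (nF _ _)

end Sys

end Pat


/-! ### Identities of generated varieties and of `M(xyx)` -/

theorem toList_lift (r : Letter → Word) (v : Word) :
    (FreeMonoid.lift r v).toList = v.toList.flatMap fun a => (r a).toList := by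
  induction v using FreeMonoid.inductionOn' with
  | one => simp
  | of_mul a v ih =>
    rw [map_mul, FreeMonoid.lift_eval_of, FreeMonoid.toList_mul, ih]
    simp

theorem fic_generatedBy {M : Type} [Monoid M] {u v : Word} :
    (Variety.generatedBy M).FIC u v ↔ Satisfies M u v := by
  constructor
  · intro h
    exact h (MonCat.of M) ((Variety.generatedBy_le_iff M _).1 le_rfl)
  · intro h N hN
    refine hN (u, v) ?_
    intro P hP
    rw [Set.mem_singleton_iff] at hP
    subst hP
    exact h

/-- Values of words in a Rees quotient of a quotient of the free monoid. -/
theorem lift_mk {N : Type} [Monoid N] (c : Con N) (r : Letter → N) (v : Word) :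
    FreeMonoid.lift (fun a => (r a : c.Quotient)) v = (FreeMonoid.lift r v : N) := by
  have : FreeMonoid.lift (fun a => (r a : c.Quotient)) = c.mk'.comp (FreeMonoid.lift r) := by
    apply FreeMonoid.hom_eq
    intro a
    simp
  rw [this]
  rfl

section XYX

theorem le_count_flatMap {r : Letter → List Letter} {c e : Letter} (he : e ∈ r c)
    (v : List Letter) : v.count c ≤ (v.flatMap r).count e := by
  induction v with
  | nil => simp
  | cons a v ih =>
    rw [List.flatMap_cons, List.count_append, List.count_cons]
    split_ifs with h
    · have : a = c := by simpa using h
      subst this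
      have := List.one_le_count_iff.2 he
      omega
    · omega

/-- A letter in the value of `c` occurs twice in `xyx`, so it is `x`, and the image is all of `xyx`.
The letter `y 0` comes from some simple `s`, which by hypothesis has all occurrences of `c` on one
side. These already supply both `x`, so the nonempty remainder, which starts or ends the word,
contains no `x`; but `xyx` starts and ends with `x`. -/
theorem not_factor_xyx {v : List Letter} {c : Letter} (h2 : 2 ≤ v.count c)
    (hb : ∀ s r1 r2, v = r1 ++ s :: r2 → v.count s = 1 → c ∈ r1 → c ∈ r2 → False)
    {r : Letter → List Letter} (hc : r c ≠ []) (p q : List Letter) :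
    [.x, .y 0, .x] ≠ p ++ (v.flatMap r ++ q) := by
  intro h
  obtain ⟨e, he⟩ := List.exists_mem_of_ne_nil _ hc
  have hcount := fun a => congrArg (List.count a) h
  simp only [List.count_append] at hcount
  have h3 := h2.trans (le_count_flatMap he v)
  have hex : e = .x := by
    have := hcount e
    by_contra hne
    have h0 : List.count e [Letter.x, .y 0, .x] ≤ 1 := by
      have h1 : (Letter.x == e) = false := by simp [Ne.symm hne]
      simp only [List.count_cons, List.count_nil, h1]
      split_ifs <;> simp_all
    omega
  subst hex
  have hx := hcount .x
  have h4 : List.count Letter.x [Letter.x, .y 0, .x] = 2 := by decide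
  have hp : p = [] := by
    cases p with
    | nil => rfl
    | cons a p =>
      rw [List.cons_append, List.cons.injEq] at h
      rw [h4, ← h.1, List.count_cons_self] at hx
      omega
  have hq : q = [] := by
    rcases List.eq_nil_or_concat q with hq | ⟨q', a, rfl⟩
    · exact hq
    · have h' := congrArg List.getLast? h
      rw [List.concat_eq_append, ← List.append_assoc, ← List.append_assoc,
        List.getLast?_concat] at h'
      simp only [List.getLast?_cons_cons, List.getLast?_singleton, Option.some.injEq] at h'
      subst h'
      simp only [List.concat_eq_append, List.count_append, List.count_cons_self, h4] at hx
      omega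
  subst hp hq
  rw [List.nil_append, List.append_nil] at h
  obtain ⟨s, hs, hys⟩ : ∃ s ∈ v, Letter.y 0 ∈ r s := by
    rw [← List.mem_flatMap, ← h]
    simp
  have hs1 : v.count s = 1 := by
    have h1 := le_count_flatMap hys v
    rw [← h] at h1
    have h2 : List.count (Letter.y 0) [Letter.x, .y 0, .x] = 1 := by decide
    have := List.one_le_count_iff.2 hs
    omega
  obtain ⟨r1, r2, rfl⟩ := List.append_of_mem hs
  have hsc : s ≠ c := by rintro rfl; omega
  have hne : r s ≠ [] := List.ne_nil_of_mem hys
  rw [List.flatMap_append, List.flatMap_cons] at h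
  have hx' := congrArg (List.count Letter.x) h
  rw [h4] at hx'
  simp only [List.count_append] at hx'
  have hc2 : 2 ≤ r1.count c + r2.count c := by
    simpa [List.count_append, List.count_cons, hsc] using h2
  by_cases h1 : c ∈ r1
  · by_cases h2 : c ∈ r2
    · exact hb s r1 r2 rfl hs1 h1 h2
    · rw [List.count_eq_zero.2 h2] at hc2
      have h5 := hc2.trans (by simpa using le_count_flatMap he r1)
      have h6 : Letter.x ∉ r s ++ r2.flatMap r := by
        rw [← List.count_eq_zero, List.count_append]; omega
      have h7 := congrArg List.getLast? h
      obtain ⟨w, a, hw⟩ : ∃ w a, r s ++ r2.flatMap r = w ++ [a] := by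
        rcases List.eq_nil_or_concat (r s ++ r2.flatMap r) with h | ⟨w, a, h⟩
        · simp [hne] at h
        · exact ⟨w, a, by rw [h, List.concat_eq_append]⟩
      rw [hw, ← List.append_assoc, List.getLast?_concat] at h7
      simp only [List.getLast?_cons_cons, List.getLast?_singleton, Option.some.injEq] at h7
      rw [hw, ← h7] at h6
      simp at h6
  · rw [List.count_eq_zero.2 h1] at hc2
    have h5 := hc2.trans (by simpa using le_count_flatMap he r2)
    have h6 : Letter.x ∉ r1.flatMap r ++ r s := by
      rw [← List.count_eq_zero, List.count_append]; omega
    obtain ⟨a, w, hw⟩ : ∃ a w, r1.flatMap r ++ r s = a :: w := by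
      cases h : r1.flatMap r ++ r s with
      | nil => simp [hne] at h
      | cons a w => exact ⟨a, w, rfl⟩
    rw [← List.append_assoc, hw, List.cons_append, List.cons.injEq] at h
    rw [hw, ← h.1] at h6
    simp at h6

theorem mem_factors_xyx {w : Word} :
    w ∈ factors {xyx} ↔ ∃ p q, [.x, .y 0, .x] = p ++ (w.toList ++ q) := by
  constructor
  · rintro ⟨u, hu, p, s, h⟩
    rw [Set.mem_singleton_iff] at hu
    subst hu
    refine ⟨p.toList, s.toList, ?_⟩
    have := congrArg FreeMonoid.toList h
    rw [FreeMonoid.toList_mul, FreeMonoid.toList_mul, List.append_assoc] at this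
    exact this
  · rintro ⟨p, q, h⟩
    refine ⟨xyx, rfl, FreeMonoid.ofList p, FreeMonoid.ofList q, ?_⟩
    apply FreeMonoid.toList.injective
    rw [FreeMonoid.toList_mul, FreeMonoid.toList_mul, List.append_assoc]
    exact h

theorem satisfies_xyx {u v : Word} : Satisfies (MWord {xyx}) u v ↔
    ∀ r : Letter → List Letter, u.toList.flatMap r = v.toList.flatMap r ∨
      ((∀ p q, [.x, .y 0, .x] ≠ p ++ (u.toList.flatMap r ++ q)) ∧
        ∀ p q, [.x, .y 0, .x] ≠ p ++ (v.toList.flatMap r ++ q)) := by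
  have key : ∀ r : Letter → Word, FreeMonoid.lift (fun a => (r a : MWord {xyx})) u =
      FreeMonoid.lift (fun a => (r a : MWord {xyx})) v ↔
      u.toList.flatMap (fun a => (r a).toList) = v.toList.flatMap (fun a => (r a).toList) ∨
      ((∀ p q, [.x, .y 0, .x] ≠ p ++ (u.toList.flatMap (fun a => (r a).toList) ++ q)) ∧
        ∀ p q, [.x, .y 0, .x] ≠ p ++ (v.toList.flatMap (fun a => (r a).toList) ++ q)) := by
    intro r
    rw [lift_mk, lift_mk, Con.eq]
    change (_ = _ ∨ _) ↔ _
    rw [mem_factors_xyx, mem_factors_xyx, ← toList_lift, ← toList_lift,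
      FreeMonoid.toList.injective.eq_iff]
    push Not
    rfl
  constructor
  · intro h r
    exact (key fun a => FreeMonoid.ofList (r a)).1 (h _)
  · intro h φ
    have : ∃ r : Letter → Word, φ = fun a => (r a : MWord {xyx}) := by
      choose r hr using fun a => Con.mk'_surjective (c := reesCon {xyx}) (φ a)
      exact ⟨r, funext fun a => (hr a).symm⟩
    obtain ⟨r, rfl⟩ := this
    exact (key r).2 (h _)

/-- If `c` is deleted the two sides coincide; otherwise both are sent to zero in the Rees quotient
by `not_factor_xyx`. -/
theorem satisfies_xyx_insert {c : Letter} {l1 l2 : List Letter} {i j : ℕ}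
    (h1 : 2 ≤ (l1 ++ (List.replicate (i + 1) c ++ l2)).count c)
    (h2 : 2 ≤ (l1 ++ (List.replicate (j + 1) c ++ l2)).count c)
    (hb : ∀ s r1 r2, l1 ++ (List.replicate (i + 1) c ++ l2) = r1 ++ s :: r2 →
      (l1 ++ (List.replicate (i + 1) c ++ l2)).count s = 1 → c ∈ r1 → c ∈ r2 → False) :
    Satisfies (MWord {xyx}) (FreeMonoid.ofList (l1 ++ (List.replicate (i + 1) c ++ l2)))
      (FreeMonoid.ofList (l1 ++ (List.replicate (j + 1) c ++ l2))) := by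
  rw [satisfies_xyx]
  intro r
  rw [FreeMonoid.toList_ofList, FreeMonoid.toList_ofList]
  by_cases hc : r c = []
  · left
    have : ∀ n, (List.replicate n c).flatMap r = [] := by
      intro n
      rw [List.flatMap_eq_nil_iff]
      intro a ha
      rw [(List.mem_replicate.1 ha).2, hc]
    simp only [List.flatMap_append, this]
  · refine Or.inr ⟨not_factor_xyx h1 hb hc, not_factor_xyx h2 ?_ hc⟩
    -- Changing a positive exponent of `c` to another one affects neither the multiplicity of `s`
    -- nor the sides of `s` on which `c` occurs, so the hypothesis transfers to the second word.
    intro s r1 r2 e hs hc1 hc2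
    have hsc : s ≠ c := by rintro rfl; omega
    have hs' : (l1 ++ (List.replicate (i + 1) c ++ l2)).count s = 1 := by
      rw [← hs]
      simp [List.count_append, List.count_replicate, hsc.symm]
    have hmem : s ∈ l1 ++ (List.replicate (j + 1) c ++ l2) := by rw [e]; simp
    have n1 : (l1 ++ (List.replicate (j + 1) c ++ l2)).count s = l1.count s + l2.count s := by
      simp [List.count_append, List.count_replicate, hsc.symm]
    have uniq : ∀ a b a' b' : List Letter, a ++ s :: b = a' ++ s :: b' →
        (a ++ s :: b).count s = 1 → a = a' ∧ b = b' := by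
      intro a b a' b' h h'
      have h'' := h'
      rw [h] at h''
      simp only [List.count_append, List.count_cons_self] at h' h''
      have ha : s ∉ a := by rw [← List.count_eq_zero]; omega
      have ha' : s ∉ a' := by rw [← List.count_eq_zero]; omega
      have hb : s ∉ b := by rw [← List.count_eq_zero]; omega
      have hb' : s ∉ b' := by rw [← List.count_eq_zero]; omega
      rcases List.append_eq_append_iff.1 h with ⟨D, e1, e2⟩ | ⟨D, e1, e2⟩
      · cases D with
        | nil => simpa [e1] using e2
        | cons d D =>
          rw [List.cons_append, List.cons.injEq] at e2
          exact absurd (by rw [e1, e2.1]; simp) ha'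
      · cases D with
        | nil => simpa [e1, eq_comm] using e2
        | cons d D =>
          rw [List.cons_append, List.cons.injEq] at e2
          exact absurd (by rw [e1, e2.1]; simp) ha
    rw [List.mem_append, List.mem_append] at hmem
    rcases hmem with h | h | h
    · obtain ⟨a, b, rfl⟩ := List.append_of_mem h
      rw [List.append_assoc, List.cons_append] at e hs
      obtain ⟨rfl, rfl⟩ := uniq _ _ _ _ e hs
      refine hb s a (b ++ (List.replicate (i + 1) c ++ l2)) (by simp) hs' hc1 ?_
      simp [List.replicate_succ]
    · exact hsc (List.mem_replicate.1 h).2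
    · obtain ⟨a, b, rfl⟩ := List.append_of_mem h
      rw [← List.append_assoc, ← List.append_assoc] at e hs
      obtain ⟨rfl, rfl⟩ := uniq _ _ _ _ e hs
      refine hb s (l1 ++ (List.replicate (i + 1) c ++ a)) b (by simp) hs' ?_ hc2
      simp [List.replicate_succ]

/-- The counts of two letters that form a pattern `z t z` in a word are determined modulo the
identities of `M(xyx)`. -/
theorem count_of_satisfies_xyx {u v V1 V2 : List Letter} {a t : Letter} (hat : a ≠ t)
    (h : Satisfies (MWord {xyx}) (FreeMonoid.ofList u) (FreeMonoid.ofList v))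
    (e : v = V1 ++ t :: V2) (h1 : V1.count a = 1) (h2 : V2.count a = 1)
    (h3 : V1.count t = 0) (h4 : V2.count t = 0) : u.count a = 2 ∧ u.count t = 1 := by
  -- Under this substitution `v` becomes `xyx` itself, which is not zero, so `u` must have the same
  -- value.
  set r : Letter → List Letter := fun b => if b = a then [.x] else if b = t then [.y 0] else []
    with hr
  have ra : r a = [.x] := by simp [hr]
  have rt : r t = [.y 0] := by simp [hr, hat.symm]
  have k1 : ∀ w : List Letter, w.count t = 0 → w.flatMap r = List.replicate (w.count a) .x := by
    intro w hw
    induction w with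
    | nil => rfl
    | cons b w ih =>
      rw [List.count_cons] at hw
      have hbt : b ≠ t := by rintro rfl; simp at hw
      rw [List.flatMap_cons, ih (by omega), List.count_cons]
      by_cases hba : b = a
      · simp [hba, ra, List.replicate_succ]
      · simp [hr, hba, hbt]
  have k2 : ∀ w : List Letter, (w.flatMap r).count .x = w.count a ∧
      (w.flatMap r).count (.y 0) = w.count t := by
    intro w
    induction w with
    | nil => simp
    | cons b w ih =>
      rw [List.flatMap_cons, List.count_append, List.count_append, ih.1, ih.2, List.count_cons,
        List.count_cons]
      by_cases hba : b = a
      · subst hba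
        simp [ra, hat, add_comm]
      · by_cases hbt : b = t
        · subst hbt
          simp [rt, hba, add_comm]
        · simp [hr, hba, hbt]
  have hv : v.flatMap r = [.x, .y 0, .x] := by
    rw [e, List.flatMap_append, List.flatMap_cons, k1 _ h3, k1 _ h4, h1, h2, rt]
    rfl
  rcases satisfies_xyx.1 h r with h | h
  · rw [FreeMonoid.toList_ofList, FreeMonoid.toList_ofList, hv] at h
    have := k2 u
    rw [h] at this
    exact ⟨this.1.symm.trans (by decide), this.2.symm.trans (by decide)⟩
  · refine absurd ?_ (h.2 [] [])
    rw [FreeMonoid.toList_ofList, hv]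
    rfl

end XYX


/-! ### The γ'-class of the word of a pattern -/

namespace Pat

variable {P : Pat}

/-- The `γ'`-class of the word of a pattern. -/
def cls (P : Pat) (v : List Letter) : Prop :=
  gammaPrime (FreeMonoid.ofList v) (FreeMonoid.ofList P.word)

theorem cls_iff {v : List Letter} : P.cls v ↔
    ((∀ a, v.count a = 1 ↔ P.word.count a = 1) ∧ dst v = dst P.word) ∧
      Satisfies (MWord {xyx}) (FreeMonoid.ofList v) (FreeMonoid.ofList P.word) := by
  rw [← fic_generatedBy]
  change (_ ∧ _) ∧ _ ↔ _
  refine and_congr_left fun _ => and_congr_left fun _ => ?_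
  exact Set.ext_iff

/-- The island sequence fixes the word up to exponents. By `M(xyx)` every `z` occurs twice and every
`tau z` once; since each `z` occurs both in its outer part and in the block, all these islands have
exponent one. The equality of the simple letters gives exponents at least two for the `y`'s. -/
theorem Good.expl (hP : P.Good) {v : List Letter} (hv : P.cls v) :
    ∃ i j b, v = P.frame (i + 1) b (j + 1) ∧ P.Blk b := by
  rw [cls_iff] at hv
  obtain ⟨⟨h1, h2⟩, h3⟩ := hv
  have hb0 := blk_bl hP
  have hct : ∀ h ∈ P.S ++ P.F, v.count h = 2 ∧ v.count (tau h) = 1 := by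
    intro h hh
    obtain ⟨V1, V2, e, c1, c2, c3, c4⟩ := hP.frame_tri hb0 1 1 hh
    exact count_of_satisfies_xyx (tau_ne (hP.isZ h hh) (hP.isZ h hh)).symm h3 e c1 c2 c3 c4
  have h2' : dst v = oS P.S ++ ([.x] ++ (P.blk ++ ([.x] ++ oF P.F))) := by
    rw [h2]
    exact hP.dst_frame hb0 0 0
  obtain ⟨v1, w, rfl, d1, hw⟩ := exists_append_of_dst h2'
  obtain ⟨v2, w, rfl, d2, hw⟩ := exists_append_of_dst hw
  obtain ⟨b, w, rfl, d3, hw⟩ := exists_append_of_dst hw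
  obtain ⟨v4, v5, rfl, d4, d5⟩ := exists_append_of_dst hw
  obtain ⟨i, rfl⟩ := eq_replicate_of_dst d2
  obtain ⟨j, rfl⟩ := eq_replicate_of_dst d4
  have mb : ∀ {a}, a ∈ b ↔ a ∈ P.blk := fun {a} => by rw [← d3, mem_dst]
  have m1 : ∀ {a}, a ∈ v1 ↔ a ∈ oS P.S := fun {a} => by rw [← d1, mem_dst]
  have m5 : ∀ {a}, a ∈ v5 ↔ a ∈ oF P.F := fun {a} => by rw [← d5, mem_dst]
  simp only [List.count_append] at hct h1
  have cb : ∀ h ∈ P.S ++ P.F, 1 ≤ b.count h := fun h hh =>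
    List.one_le_count_iff.2 (mb.2 (hP.mem_blk h hh))
  have e1 : v1 = oS P.S := by
    rw [← d1, dst_of_nodup]
    rw [List.nodup_iff_count_le_one]
    intro a
    by_cases ha : a ∈ v1
    · rcases mem_oS.1 (m1.1 ha) with h | ⟨s, hs, rfl⟩
      · have := hct a (List.mem_append_left _ h)
        have := cb a (List.mem_append_left _ h)
        omega
      · have := hct s (List.mem_append_left _ hs)
        omega
    · rw [List.count_eq_zero.2 ha]; omega
  have e5 : v5 = oF P.F := by
    rw [← d5, dst_of_nodup]
    rw [List.nodup_iff_count_le_one]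
    intro a
    by_cases ha : a ∈ v5
    · rcases mem_oF.1 (m5.1 ha) with h | ⟨s, hs, rfl⟩
      · have := hct a (List.mem_append_right _ h)
        have := cb a (List.mem_append_right _ h)
        omega
      · have := hct s (List.mem_append_right _ hs)
        omega
    · rw [List.count_eq_zero.2 ha]; omega
  refine ⟨i, j, b, by rw [e1, e5, frame], d3, ?_, ?_⟩
  · intro h hh
    have h4 := cb h hh
    have h5 := (hct h hh).1
    rcases List.mem_append.1 hh with h6 | h6
    · have : 1 ≤ v1.count h := List.one_le_count_iff.2 (m1.2 (mem_oS.2 (Or.inl h6)))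
      omega
    · have : 1 ≤ v5.count h := List.one_le_count_iff.2 (m5.2 (mem_oF.2 (Or.inl h6)))
      omega
  · intro y hy hY
    have hc : ∀ (b' : List Letter) i j, (P.frame i b' j).count y = b'.count y := by
      intro b' i j
      have c1 : (oS P.S).count y = 0 := count_oS_eq_zero
        (fun h => not_isY_of_isZ (hP.S_isZ _ h) hY)
        (fun s hs h => not_isY_tau (hP.S_isZ _ hs) (h ▸ hY))
      have c2 : (oF P.F).count y = 0 := count_oF_eq_zero
        (fun h => not_isY_of_isZ (hP.F_isZ _ h) hY)
        (fun s hs h => not_isY_tau (hP.F_isZ _ hs) (h ▸ hY))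
      simp [frame, List.count_append, c1, c2, List.count_replicate, (ne_x_of_isY hY).symm]
    have h4 : 2 ≤ P.word.count y := by
      rw [word, hc]
      exact hb0.count_y y hy hY
    have h5 := h1 y
    have h6 := hc b (i + 1) (j + 1)
    rw [frame, ← e1, ← e5] at h6
    simp only [List.count_append] at h6
    have : 1 ≤ b.count y := List.one_le_count_iff.2 (mb.2 hy)
    omega

/-- Only `ins` needs an argument: no simple letter lies between two occurrences of `x` or of a `y`,
so changing an exponent is an identity of `M(xyx)`, and it preserves islands and simple letters. -/
theorem Good.sys (hP : P.Good) : P.Sys P.cls where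
  good := hP
  base := gammaPrime.refl _
  expl _ hv := hP.expl hv
  ins c l1 l2 i j hc h1 h2 hA := by
    set v := l1 ++ (List.replicate (i + 1) c ++ l2) with hv
    have hd : dst v = P.isl := by
      obtain ⟨i, j, b, e, hb⟩ := hP.expl hA
      rw [e, hP.dst_frame hb]
    have hb : ∀ s r1 r2, v = r1 ++ s :: r2 → v.count s = 1 → c ∈ r1 → c ∈ r2 → False := by
      obtain ⟨i', j', b, e, hb⟩ := hP.expl hA
      intro s r1 r2 e2 hs h1 h2
      have hsc : s ≠ c := by rintro rfl; omega
      have hsub : [c, s, c].Sublist v := by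
        rw [e2]
        have := (List.singleton_sublist.2 h1).append
          ((List.singleton_sublist.2 h2).cons_cons s)
        simpa using this
      have h3 := sublist_dst hsub (by simp [hsc, hsc.symm])
      rw [hd] at h3
      have hcount := h3.count_le c
      have hsv : s ∈ v := by rw [e2]; simp
      rcases hc with rfl | hy
      -- Only letters of the block lie between the two islands of `x`, and each of them occurs at
      -- least twice in the word.
      · have h4 : s ∈ P.S ∨ s ∈ P.F ∨ IsY s ∧ s ∈ P.blk := by
          have h5 : (Letter.x :: ([s] ++ [Letter.x])).Sublist P.isl := h3
          have h6 : s ∈ P.blk := by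
            have h7 : ∀ (B C u w : List Letter), Letter.x ∉ B → ∀ w : List Letter,
                (Letter.x :: w).Sublist (B ++ C) → (Letter.x :: w).Sublist C := by
              intro B C u w hB w h
              induction B with
              | nil => exact h
              | cons b B ih =>
                rw [List.mem_cons, not_or] at hB
                rcases List.cons_sublist_cons'.1 h with h | h
                · exact ih hB.2 h
                · exact absurd h.1 hB.1
            have h8 := h7 _ _ [] [] (x_notMem_oS hP.S_isZ) _ h5
            rw [List.cons_sublist_cons] at h8
            rw [List.sublist_append_iff] at h8
            obtain ⟨a1, a2, e3, h9, h10⟩ := h8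
            cases a1 with
            | nil =>
              rw [List.nil_append] at e3
              rw [← e3] at h10
              have := h10.count_le .x
              rw [List.count_cons_self, List.count_eq_zero.2 (x_notMem_oF hP.F_isZ)] at this
              exfalso
              rw [List.singleton_append] at h10
              rcases List.cons_sublist_cons'.1 h10 with h | h
              · exact x_notMem_oF hP.F_isZ (h.subset (by simp))
              · exact hsc h.1
            | cons a a1 =>
              rw [List.singleton_append, List.cons_append, List.cons.injEq] at e3
              rw [e3.1]
              exact h9.subset (by simp)
          rcases hP.blk_mem s h6 with h | h
          · rcases List.mem_append.1 h with h | h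
            · exact Or.inl h
            · exact Or.inr (Or.inl h)
          · exact Or.inr (Or.inr ⟨h, h6⟩)
        have h5 : 2 ≤ v.count s := by
          rcases h4 with h | h | ⟨h, h'⟩
          · obtain ⟨V1, V2, e4, c1, c2, -, -⟩ := hP.frame_tri hb (i' + 1) (j' + 1)
              (List.mem_append_left _ h)
            rw [e, e4, List.count_append, List.count_cons, c1, c2]
            omega
          · obtain ⟨V1, V2, e4, c1, c2, -, -⟩ := hP.frame_tri hb (i' + 1) (j' + 1)
              (List.mem_append_right _ h)
            rw [e, e4, List.count_append, List.count_cons, c1, c2]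
            omega
          · have := hb.count_y s h' h
            rw [e]
            simp only [frame, List.count_append]
            omega
        omega
      · have hn : P.blk.count c ≤ 1 := List.nodup_iff_count_le_one.1 hP.blk_nodup c
        have c1 : (oS P.S).count c = 0 := count_oS_eq_zero
          (fun h => not_isY_of_isZ (hP.S_isZ _ h) hy)
          (fun s hs h => not_isY_tau (hP.S_isZ _ hs) (h ▸ hy))
        have c2 : (oF P.F).count c = 0 := count_oF_eq_zero
          (fun h => not_isY_of_isZ (hP.F_isZ _ h) hy)
          (fun s hs h => not_isY_tau (hP.F_isZ _ hs) (h ▸ hy))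
        have hx := (ne_x_of_isY hy).symm
        simp [isl, List.count_append, List.count_cons, c1, c2, hx] at hcount
        omega
    rw [cls_iff] at hA ⊢
    refine ⟨⟨?_, ?_⟩, ?_⟩
    · intro a
      rw [← hA.1.1 a]
      by_cases hac : a = c
      · subst hac; omega
      · have : (c == a) = false := by simp [Ne.symm hac]
        simp [hv, List.count_append, List.count_replicate, this]
    · rw [← hA.1.2]
      exact dst_append_congr rfl (dst_append_congr
        (by rw [dst_replicate_succ, dst_replicate_succ]) rfl)
    · intro φ
      rw [← hA.2 φ]
      exact (satisfies_xyx_insert h1 h2 hb φ).symm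

end Pat


/-! ### The words `a^{(p)}_{n,m}[ρ]` are words of good patterns -/

/-- The index of a letter. -/
def idx : Letter → ℕ
  | .x => 0
  | .y i => i
  | .z i => i
  | .t i => i
  | .z' i => i
  | .t' i => i

/-- The three shapes of factors of the blocks, without repetition of the letter `y_i`. -/
def sh : ℕ → ℕ → List Letter
  | 0, i => [.z i]
  | 1, i => [.z i, .y i]
  | _, i => [.z i, .y i, .z' i]

/-- The letters `z_i` and `z_i'` that occur in a factor of a block. -/
def shz : ℕ → ℕ → List Letter
  | 0, i => [.z i]
  | 1, i => [.z i]
  | _, i => [.z i, .z' i]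

theorem idx_of_mem_sh {s i : ℕ} {a : Letter} (h : a ∈ sh s i) : idx a = i := by
  rcases s with _ | _ | s <;> simp [sh] at h <;> grind [idx]

theorem mem_shz {s i : ℕ} {a : Letter} : a ∈ shz s i ↔ a ∈ sh s i ∧ IsZ a := by
  rcases s with _ | _ | s <;> simp only [sh, shz, List.mem_cons, List.not_mem_nil, or_false] <;>
    cases a <;> simp [IsZ]

theorem isZ_or_isY_of_mem_sh {s i : ℕ} {a : Letter} (h : a ∈ sh s i) : IsZ a ∨ IsY a := by
  rcases s with _ | _ | s <;> simp [sh] at h <;>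
    cases a <;> simp_all [IsZ, IsY]

theorem nodup_sh (s i : ℕ) : (sh s i).Nodup := by
  rcases s with _ | _ | s <;> simp [sh]

theorem nodup_shz (s i : ℕ) : (shz s i).Nodup := by
  rcases s with _ | _ | s <;> simp [shz]

theorem nodup_flatMap_of_idx {g : ℕ → List Letter} {J : List ℕ} (hJ : J.Nodup)
    (hg : ∀ i, (g i).Nodup) (hi : ∀ i, ∀ a ∈ g i, idx a = i) : (J.flatMap g).Nodup := by
  rw [List.nodup_flatMap]
  refine ⟨fun i _ => hg i, hJ.imp fun {i j} hij a h1 h2 => hij ?_⟩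
  rw [← hi i a h1, hi j a h2]

/-- The sequence `1ρ, 2ρ, …, Nρ`. -/
def permList {N : ℕ} (ρ : Equiv.Perm (Fin N)) : List ℕ :=
  (List.finRange N).map fun i => (ρ i : ℕ) + 1

theorem nodup_permList {N : ℕ} (ρ : Equiv.Perm (Fin N)) : (permList ρ).Nodup := by
  refine (List.nodup_finRange N).map ?_
  intro i j h
  have : (ρ i : ℕ) = ρ j := by simpa using h
  exact ρ.injective (Fin.ext this)

theorem mem_permList {N : ℕ} (ρ : Equiv.Perm (Fin N)) {j : ℕ} :
    j ∈ permList ρ ↔ 1 ≤ j ∧ j ≤ N := by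
  simp only [permList, List.mem_map, List.mem_finRange, true_and]
  constructor
  · rintro ⟨i, rfl⟩
    have := (ρ i).isLt
    omega
  · rintro ⟨h1, h2⟩
    obtain ⟨i, hi⟩ := ρ.surjective ⟨j - 1, by omega⟩
    refine ⟨i, ?_⟩
    rw [hi]
    simp only
    omega

theorem isChain_permList {n m : ℕ} {ρ : Equiv.Perm (Fin (n + m))} (h : IsNMPerm n m ρ) :
    (permList ρ).IsChain fun i j => (i ≤ n ∧ n < j) ∨ (j ≤ n ∧ n < i) := by
  rw [List.isChain_iff_getElem]
  intro i hi
  simp only [permList, List.length_map, List.length_finRange] at hi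
  simp only [permList, List.getElem_map, List.getElem_finRange]
  have := h ⟨i, by omega⟩ ⟨i + 1, by omega⟩ rfl
  simp only [Fin.cast_mk]
  omega

theorem toList_prodFrom (a len : ℕ) (f : ℕ → Word) :
    (prodFrom a len f).toList = (List.range' a len).flatMap fun i => (f i).toList := by
  unfold prodFrom
  induction List.range' a len with
  | nil => simp
  | cons i l ih => rw [List.map_cons, List.prod_cons, FreeMonoid.toList_mul, ih]; rfl

theorem toList_prod_map {α : Type} (l : List α) (f : α → Word) :
    ((l.map f).prod).toList = l.flatMap fun i => (f i).toList := by
  induction l with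
  | nil => simp
  | cons i l ih => rw [List.map_cons, List.prod_cons, FreeMonoid.toList_mul, ih]; rfl

theorem toList_permProd {N : ℕ} (ρ : Equiv.Perm (Fin N)) (f : ℕ → Word) :
    (permProd ρ f).toList = (permList ρ).flatMap fun i => (f i).toList := by
  rw [permProd, toList_prod_map, permList, List.flatMap_map]

theorem toList_permProdDel {N : ℕ} (ρ : Equiv.Perm (Fin N)) (hN : 0 < N) :
    ∃ J j, permList ρ = J ++ [j] ∧ ∀ f : ℕ → Word, (permProdDel ρ f).toList =
      (J.flatMap fun i => (f i).toList) ++ (deleteLetter (.y j) (f j)).toList := by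
  obtain ⟨M, rfl⟩ : ∃ M, N = M + 1 := ⟨N - 1, by omega⟩
  refine ⟨(List.finRange M).map fun i => (ρ i.castSucc : ℕ) + 1, (ρ (Fin.last M) : ℕ) + 1, ?_, ?_⟩
  · rw [permList, List.finRange_succ_last]
    simp
  · intro f
    rw [permProdDel, toList_prod_map, List.finRange_succ_last, List.flatMap_append,
      List.flatMap_map, List.flatMap_map]
    congr 1
    · congr 1
      funext i
      rw [if_neg]
      have := i.isLt
      simp only [Fin.val_castSucc]
      omega
    · simp

/-- The patterns of the words `a^{(p)}_{n,m}[ρ]`. -/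
theorem good_of_perm {n m s1 s2 : ℕ} {ρ : Equiv.Perm (Fin (n + m))} (h : IsNMPerm n m ρ)
    {f l : Letter} {mid r : List Letter}
    (hB : (permList ρ).flatMap (fun i => if i ≤ n then sh s1 i else sh s2 i) =
      (f :: (mid ++ [l])) ++ r) (hr : ∀ a ∈ r, IsY a) (hf : ¬ IsY f) (hl : ¬ IsY l) :
    (Pat.mk ((List.range' 1 n).flatMap (shz s1)) ((List.range' (n + 1) m).flatMap (shz s2))
      f mid l).Good := by
  set S := (List.range' 1 n).flatMap (shz s1) with hS
  set F := (List.range' (n + 1) m).flatMap (shz s2) with hF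
  set g : ℕ → List Letter := fun i => if i ≤ n then sh s1 i else sh s2 i with hg
  have gi : ∀ i, ∀ a ∈ g i, idx a = i := by
    intro i a ha
    simp only [hg] at ha
    split_ifs at ha <;> exact idx_of_mem_sh ha
  have gzy : ∀ i, ∀ a ∈ g i, IsZ a ∨ IsY a := by
    intro i a ha
    simp only [hg] at ha
    split_ifs at ha <;> exact isZ_or_isY_of_mem_sh ha
  have mS : ∀ a, a ∈ S ↔ IsZ a ∧ a ∈ g (idx a) ∧ 1 ≤ idx a ∧ idx a ≤ n := by
    intro a
    simp only [hS, List.mem_flatMap, List.mem_range'_1, mem_shz]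
    constructor
    · rintro ⟨i, hi, ha, hz⟩
      obtain rfl := idx_of_mem_sh ha
      have : idx a ≤ n := by omega
      exact ⟨hz, by simpa [hg, this] using ha, by omega, this⟩
    · rintro ⟨hz, ha, h1, h2⟩
      refine ⟨idx a, by omega, ?_, hz⟩
      simpa [hg, h2] using ha
  have mF : ∀ a, a ∈ F ↔ IsZ a ∧ a ∈ g (idx a) ∧ n < idx a ∧ idx a ≤ n + m := by
    intro a
    simp only [hF, List.mem_flatMap, List.mem_range'_1, mem_shz]
    constructor
    · rintro ⟨i, hi, ha, hz⟩
      obtain rfl := idx_of_mem_sh ha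
      have : ¬ idx a ≤ n := by omega
      exact ⟨hz, by simpa [hg, this] using ha, by omega, by omega⟩
    · rintro ⟨hz, ha, h1, h2⟩
      refine ⟨idx a, by omega, ?_, hz⟩
      have : ¬ idx a ≤ n := by omega
      simpa [hg, this] using ha
  have mSF : ∀ a, a ∈ S ++ F ↔ IsZ a ∧ a ∈ g (idx a) ∧ 1 ≤ idx a ∧ idx a ≤ n + m := by
    intro a
    rw [List.mem_append, mS, mF]
    constructor
    · rintro (⟨h1, h2, h3, h4⟩ | ⟨h1, h2, h3, h4⟩) <;> exact ⟨h1, h2, by omega, by omega⟩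
    · rintro ⟨h1, h2, h3, h4⟩
      rcases le_or_gt (idx a) n with h5 | h5
      · exact Or.inl ⟨h1, h2, h3, h5⟩
      · exact Or.inr ⟨h1, h2, h5, h4⟩
  set B := (permList ρ).flatMap g with hBdef
  have mB : ∀ a, a ∈ B ↔ a ∈ g (idx a) ∧ 1 ≤ idx a ∧ idx a ≤ n + m := by
    intro a
    simp only [hBdef, List.mem_flatMap, mem_permList]
    constructor
    · rintro ⟨i, hi, ha⟩
      obtain rfl := gi i a ha
      exact ⟨ha, hi⟩
    · rintro ⟨ha, hi⟩
      exact ⟨idx a, hi, ha⟩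
  have nB : B.Nodup := nodup_flatMap_of_idx (nodup_permList ρ)
    (fun i => by simp only [hg]; split_ifs <;> exact nodup_sh _ _) gi
  have nil_notMem : [] ∉ (permList ρ).map g := by
    rw [List.mem_map]
    rintro ⟨i, -, hi⟩
    simp only [hg] at hi
    rcases s1 with _ | _ | s1 <;> rcases s2 with _ | _ | s2 <;> split_ifs at hi <;>
      simp [sh] at hi
  have gchain : ∀ (R : Letter → Letter → Prop), (∀ a b, IsY a → R a b) → (∀ a b, IsY b → R a b) →
      ∀ i, (g i).IsChain R := by
    intro R h1 h2 i
    have : ∀ s, (sh s i).IsChain R := by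
      intro s
      rcases s with _ | _ | s
      · simp [sh]
      · simp [sh, h2 (.z i) (.y i) trivial]
      · simp [sh, h2 (.z i) (.y i) trivial, h1 (.y i) (.z' i) trivial]
    simp only [hg]
    split_ifs <;> exact this _
  -- Inside one factor, of two neighbours one is always a `y`. At the border of two factors one
  -- index is at most `n` and the other is larger, because `ρ` is an `(n,m)`-permutation.
  have cB : B.IsChain fun a b => ¬ (a ∈ S ∧ b ∈ S) ∧ ¬ (a ∈ F ∧ b ∈ F) := by
    rw [hBdef, List.flatMap_def, List.isChain_flatten nil_notMem]
    constructor
    · intro l hl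
      obtain ⟨i, -, rfl⟩ := List.mem_map.1 hl
      refine gchain _ ?_ ?_ i
      · intro a b ha
        simp only [mS, mF]
        have := fun h => not_isY_of_isZ (a := a) h ha
        tauto
      · intro a b ha
        simp only [mS, mF]
        have := fun h => not_isY_of_isZ (a := b) h ha
        tauto
    · rw [List.isChain_map]
      refine (isChain_permList h).imp ?_
      intro i j hij a ha b hb
      have h1 := gi i a (List.mem_of_getLast? ha)
      have h2 := gi j b (List.mem_of_mem_head? hb)
      simp only [mS, mF]
      omega
  have blkB : ∀ a, a ∈ f :: (mid ++ [l]) → a ∈ B := fun a ha => by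
    rw [hB]; exact List.mem_append_left _ ha
  have hSF : ∀ a, a ∈ f :: (mid ++ [l]) → ¬ IsY a → a ∈ S ++ F := by
    intro a ha hy
    have h1 := (mB a).1 (blkB a ha)
    exact (mSF a).2 ⟨(gzy _ a h1.1).resolve_right hy, h1⟩
  have cblk : (f :: (mid ++ [l])).IsChain fun a b => ¬ (a ∈ S ∧ b ∈ S) ∧ ¬ (a ∈ F ∧ b ∈ F) := by
    rw [hB] at cB
    exact cB.left_of_append
  refine ⟨?_, ?_, ?_, ?_, ?_, ?_, ?_, ?_, ?_⟩
  · change (S ++ F).Nodup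
    rw [List.nodup_append]
    refine ⟨nodup_flatMap_of_idx List.nodup_range' (fun i => nodup_shz _ i)
      (fun i a ha => idx_of_mem_sh (mem_shz.1 ha).1), nodup_flatMap_of_idx List.nodup_range'
      (fun i => nodup_shz _ i) (fun i a ha => idx_of_mem_sh (mem_shz.1 ha).1), ?_⟩
    rintro a h1 b h2 rfl
    have := (mS a).1 h1
    have := (mF a).1 h2
    omega
  · intro a ha
    exact ((mSF a).1 ha).1
  · rw [hB] at nB
    exact nB.of_append_left
  · intro a ha
    by_cases hy : IsY a
    · exact Or.inr hy
    · exact Or.inl (hSF a ha hy)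
  · intro a ha
    have h1 := (mSF a).1 ha
    have h2 := (mB a).2 h1.2
    rw [hB] at h2
    rcases List.mem_append.1 h2 with h3 | h3
    · exact h3
    · exact absurd (hr a h3) (not_isY_of_isZ h1.1)
  · exact hSF f (by simp) hf
  · exact hSF l (by simp) hl
  · intro b r' hb
    rw [hb, List.isChain_cons_cons] at cblk
    exact cblk.1
  · intro b r' hb
    have e : f :: (mid ++ [l]) = (f :: mid) ++ [l] := rfl
    rw [e, hb, List.append_assoc] at cblk
    have := cblk.right_of_append
    simp only [List.singleton_append, List.isChain_cons_cons] at this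
    refine ⟨fun h => this.1.1 h.symm, fun h => this.1.2 h.symm⟩


theorem exists_cons_append_singleton {α : Type} {B : List α} (h : 2 ≤ B.length) :
    ∃ f mid l, B = f :: (mid ++ [l]) := by
  cases B with
  | nil => simp at h
  | cons f B =>
    rcases List.eq_nil_or_concat B with rfl | ⟨mid, l, rfl⟩
    · simp at h
    · exact ⟨f, mid, l, by rw [List.concat_eq_append]⟩

theorem sh_eq_cons (s i : ℕ) : ∃ r, sh s i = .z i :: r := by
  rcases s with _ | _ | s <;> exact ⟨_, rfl⟩

theorem sh_eq_concat {s : ℕ} (hs : s ≠ 1) (i : ℕ) : ∃ r l, sh s i = r ++ [l] ∧ ¬ IsY l := by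
  rcases s with _ | _ | s
  · exact ⟨[], .z i, rfl, id⟩
  · exact absurd rfl hs
  · exact ⟨[.z i, .y i], .z' i, rfl, id⟩

theorem bl_flatMap {α : Type} (J : List α) (g : α → List Letter) :
    bl (J.flatMap g) = J.flatMap fun i => bl (g i) := List.flatMap_assoc

theorem oS_flatMap {α : Type} (J : List α) (g : α → List Letter) :
    oS (J.flatMap g) = J.flatMap fun i => oS (g i) := List.flatMap_assoc

theorem oF_flatMap {α : Type} (J : List α) (g : α → List Letter) :
    oF (J.flatMap g) = J.flatMap fun i => oF (g i) := List.flatMap_assoc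

theorem permList_one {N : ℕ} (ρ : Equiv.Perm (Fin N)) (hN : N = 1) : permList ρ = [1] := by
  obtain ⟨j, hj⟩ := List.length_eq_one_iff.1
    (show (permList ρ).length = 1 by simp [permList, hN])
  have := (mem_permList ρ (j := j)).1 (by simp [hj])
  rw [hj, show j = 1 by omega]

/-- Shapes other than `1` end in some `z` or `z'`, so neither end of the block is a `y`. This covers
`p = 1, 2`, including the cases with a single permuted index. -/
theorem exists_good_of_flatMap {n m s1 s2 : ℕ} {ρ : Equiv.Perm (Fin (n + m))}
    (h : IsNMPerm n m ρ) (h1 : s1 ≠ 1) (h2 : s2 ≠ 1)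
    (h3 : 2 ≤ ((permList ρ).flatMap (fun i => if i ≤ n then sh s1 i else sh s2 i)).length) :
    ∃ P : Pat, P.Good ∧ P.S = (List.range' 1 n).flatMap (shz s1) ∧
      P.F = (List.range' (n + 1) m).flatMap (shz s2) ∧
      P.blk = (permList ρ).flatMap (fun i => if i ≤ n then sh s1 i else sh s2 i) := by
  obtain ⟨f, mid, l, hB⟩ := exists_cons_append_singleton h3
  refine ⟨⟨_, _, f, mid, l⟩, good_of_perm h (r := []) (by rw [List.append_nil]; exact hB)
    (by simp) ?_ ?_, rfl, rfl, hB.symm⟩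
  · cases hp : permList ρ with
    | nil => rw [hp] at hB; simp at hB
    | cons j J =>
      rw [hp, List.flatMap_cons] at hB
      obtain ⟨r, hr⟩ : ∃ r, (if j ≤ n then sh s1 j else sh s2 j) = .z j :: r := by
        split_ifs <;> exact sh_eq_cons _ _
      rw [hr, List.cons_append, List.cons.injEq] at hB
      rw [← hB.1]
      exact id
  · rcases List.eq_nil_or_concat (permList ρ) with hp | ⟨J, j, hp⟩
    · rw [hp] at hB; simp at hB
    · rw [hp, List.concat_eq_append, List.flatMap_append, List.flatMap_singleton] at hB
      obtain ⟨r, l', hr, hl'⟩ : ∃ r l', (if j ≤ n then sh s1 j else sh s2 j) = r ++ [l'] ∧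
          ¬ IsY l' := by
        split_ifs <;> exact sh_eq_concat ‹_› _
      rw [hr, ← List.append_assoc, ← List.cons_append] at hB
      have := List.append_inj_right' hB rfl
      rw [List.cons.injEq] at this
      rw [← this.1]
      exact hl'

/-- This covers `p = 3, 4`. If the last factor ends in a `y`, this letter is the remainder `r` of
`good_of_perm`, so the block ends in `z j`. -/
theorem exists_good_of_del {n m s1 s2 : ℕ} {ρ : Equiv.Perm (Fin (n + m))}
    (h : IsNMPerm n m ρ) (h1 : s1 ≤ 1) (h2 : s2 ≤ 1) {J : List ℕ} {j : ℕ}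
    (hJ : permList ρ = J ++ [j]) (hne : J ≠ []) :
    ∃ P : Pat, P.Good ∧ P.S = (List.range' 1 n).flatMap (shz s1) ∧
      P.F = (List.range' (n + 1) m).flatMap (shz s2) ∧
      P.blk = J.flatMap (fun i => if i ≤ n then sh s1 i else sh s2 i) ++ [.z j] := by
  cases J with
  | nil => exact absurd rfl hne
  | cons i J =>
    obtain ⟨r, hr⟩ : ∃ r, (if i ≤ n then sh s1 i else sh s2 i) = .z i :: r := by
      split_ifs <;> exact sh_eq_cons _ _
    obtain ⟨r', hr', hy⟩ : ∃ r', (if j ≤ n then sh s1 j else sh s2 j) = .z j :: r' ∧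
        ∀ a ∈ r', IsY a := by
      have : ∀ s ≤ 1, ∃ r', sh s j = .z j :: r' ∧ ∀ a ∈ r', IsY a := by
        intro s hs
        interval_cases s
        · exact ⟨[], rfl, by simp⟩
        · exact ⟨[.y j], rfl, by simp [IsY]⟩
      split_ifs
      · exact this _ h1
      · exact this _ h2
    refine ⟨⟨_, _, .z i, r ++ J.flatMap (fun i => if i ≤ n then sh s1 i else sh s2 i), .z j⟩,
      good_of_perm h (r := r') ?_ hy id id, rfl, rfl, ?_⟩
    · rw [hJ, List.flatMap_append, List.flatMap_cons, hr, List.flatMap_singleton, hr']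
      simp
    · rw [List.flatMap_cons, hr]
      simp [Pat.blk]

theorem exists_good (k k' p : ℕ) (hp : p = 1 ∨ p = 2 ∨ p = 3 ∨ p = 4)
    (hnd : 2 ≤ k + k' ∨ (p = 1 ∧ k = 0 ∧ k' = 1) ∨ (p = 2 ∧ k = 1 ∧ k' = 0))
    (π : Equiv.Perm (Fin (k + k'))) (hπ : IsNMPerm k k' π) :
    ∃ P : Pat, P.Good ∧ (aWord p k k' π).toList = P.word := by
  have len : ∀ s1 s2, 2 ≤ k + k' →
      2 ≤ ((permList π).flatMap (fun i => if i ≤ k then sh s1 i else sh s2 i)).length := by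
    intro s1 s2 h2
    rw [List.length_flatMap]
    have h3 : ∀ (L : List ℕ) (u : ℕ → ℕ), (∀ i, 1 ≤ u i) → L.length ≤ (L.map u).sum := by
      intro L u hu
      induction L with
      | nil => simp
      | cons a L ih =>
        have := hu a
        simp only [List.length_cons, List.map_cons, List.sum_cons]
        omega
    have h4 := h3 (permList π) (fun i => (if i ≤ k then sh s1 i else sh s2 i).length) (by
      intro i
      split_ifs
      · obtain ⟨r, hr⟩ := sh_eq_cons s1 i
        simp [hr]
      · obtain ⟨r, hr⟩ := sh_eq_cons s2 i
        simp [hr])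
    have h5 : (permList π).length = k + k' := by simp [permList]
    omega
  rcases hp with rfl | rfl | hp
  · obtain ⟨P, hP, hS, hF, hb⟩ := exists_good_of_flatMap (s1 := 0) (s2 := 2) hπ (by omega)
      (by omega) (by
        rcases hnd with h | ⟨-, rfl, rfl⟩ | h
        · exact len _ _ h
        · rw [permList_one π rfl]
          simp [sh]
        · omega)
    refine ⟨P, hP, ?_⟩
    rw [Pat.word, Pat.frame, hS, hF, hb, bl_flatMap, oS_flatMap, oF_flatMap]
    simp only [aWord, a1, FreeMonoid.toList_mul, toList_prodFrom, toList_permProd,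
      FreeMonoid.toList_of, List.append_assoc]
    congr 3
    congr 1
    funext i
    unfold zw1
    split_ifs <;> rfl
  · obtain ⟨P, hP, hS, hF, hb⟩ := exists_good_of_flatMap (s1 := 2) (s2 := 0) hπ (by omega)
      (by omega) (by
        rcases hnd with h | h | ⟨-, rfl, rfl⟩
        · exact len _ _ h
        · omega
        · rw [permList_one π rfl]
          simp [sh])
    refine ⟨P, hP, ?_⟩
    rw [Pat.word, Pat.frame, hS, hF, hb, bl_flatMap, oS_flatMap, oF_flatMap]
    simp only [aWord, a2, FreeMonoid.toList_mul, toList_prodFrom, toList_permProd,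
      FreeMonoid.toList_of, List.append_assoc]
    congr 3
    congr 1
    funext i
    unfold zw2
    split_ifs <;> rfl
  · have h2 : 2 ≤ k + k' := by omega
    obtain ⟨J, j, hJ, hdel⟩ := toList_permProdDel π (by omega)
    have hne : J ≠ [] := by
      rintro rfl
      have := congrArg List.length hJ
      simp [permList] at this
      omega
    rcases hp with rfl | rfl
    · obtain ⟨P, hP, hS, hF, hb⟩ := exists_good_of_del (s1 := 1) (s2 := 0) hπ (by omega)
        (by omega) hJ hne
      refine ⟨P, hP, ?_⟩
      rw [Pat.word, Pat.frame, hS, hF, hb, bl_append, bl_flatMap, oS_flatMap, oF_flatMap]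
      simp only [aWord, a3, FreeMonoid.toList_mul, toList_prodFrom, hdel,
        FreeMonoid.toList_of, List.append_assoc]
      congr 3
      · congr 1
        funext i
        unfold zw3
        split_ifs <;> rfl
      · congr 1
        unfold zw3 deleteLetter
        split_ifs <;> simp [bl, sq, IsY, pow_two]
    · obtain ⟨P, hP, hS, hF, hb⟩ := exists_good_of_del (s1 := 0) (s2 := 1) hπ (by omega)
        (by omega) hJ hne
      refine ⟨P, hP, ?_⟩
      rw [Pat.word, Pat.frame, hS, hF, hb, bl_append, bl_flatMap, oS_flatMap, oF_flatMap]
      simp only [aWord, a4, FreeMonoid.toList_mul, toList_prodFrom, hdel,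
        FreeMonoid.toList_of, List.append_assoc]
      congr 3
      · congr 1
        funext i
        unfold zw4
        split_ifs <;> rfl
      · congr 1
        unfold zw4 deleteLetter
        split_ifs <;> simp [bl, sq, IsY, pow_two]


/-! ### Syntactic monoids and the failure of distributivity -/

section Syntactic

variable {α : Type}

/-- The syntactic congruence of a set of words. -/
def synCon (C : List α → Prop) : Con (FreeMonoid α) where
  r a b := ∀ p s : List α, C (p ++ (a.toList ++ s)) ↔ C (p ++ (b.toList ++ s))
  iseqv :=
    { refl := fun _ _ _ => Iff.rfl
      symm := fun h p s => (h p s).symm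
      trans := fun h1 h2 p s => (h1 p s).trans (h2 p s) }
  mul' := by
    intro a b c d h1 h2 p s
    rw [FreeMonoid.toList_mul, FreeMonoid.toList_mul, List.append_assoc, List.append_assoc, h1,
      ← List.append_assoc, h2, List.append_assoc]

/-- The set `C` is compatible with the identity `u ≈ v`. -/
def Closed (C : List α → Prop) (u v : Word) : Prop :=
  ∀ (φ : Letter → List α) (p s : List α),
    C (p ++ (u.toList.flatMap φ ++ s)) ↔ C (p ++ (v.toList.flatMap φ ++ s))

theorem toList_lift' (r : Letter → FreeMonoid α) (v : Word) :
    (FreeMonoid.lift r v).toList = v.toList.flatMap fun a => (r a).toList := by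
  induction v using FreeMonoid.inductionOn' with
  | one => simp
  | of_mul a v ih =>
    rw [map_mul, FreeMonoid.lift_eval_of, FreeMonoid.toList_mul, ih]
    simp

theorem satisfies_synCon {C : List α → Prop} {u v : Word} :
    Satisfies (synCon C).Quotient u v ↔ Closed C u v := by
  have key : ∀ r : Letter → FreeMonoid α,
      FreeMonoid.lift (fun a => (r a : (synCon C).Quotient)) u =
        FreeMonoid.lift (fun a => (r a : (synCon C).Quotient)) v ↔
      ∀ p s : List α, C (p ++ (u.toList.flatMap (fun a => (r a).toList) ++ s)) ↔
        C (p ++ (v.toList.flatMap (fun a => (r a).toList) ++ s)) := by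
    intro r
    rw [lift_mk, lift_mk, Con.eq]
    change (∀ p s : List α, C _ ↔ C _) ↔ _
    rw [toList_lift', toList_lift']
  constructor
  · intro h φ
    exact (key fun a => FreeMonoid.ofList (φ a)).1 (h _)
  · intro h φ
    obtain ⟨r, rfl⟩ : ∃ r : Letter → FreeMonoid α, φ = fun a => (r a : (synCon C).Quotient) := by
      choose r hr using fun a => Con.mk'_surjective (c := synCon C) (φ a)
      exact ⟨r, funext fun a => (hr a).symm⟩
    exact (key r).2 (h _)

/-- The syntactic monoid of an intersection satisfies all common identities of the two syntactic
monoids; this places it in the join of any two varieties that contain them. -/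
theorem Closed.and {C D : List α → Prop} {u v : Word} (h1 : Closed C u v) (h2 : Closed D u v) :
    Closed (fun w => C w ∧ D w) u v := fun φ p s => and_congr (h1 φ p s) (h2 φ p s)

theorem mem_of_closed {V : Variety} {C : List α → Prop} (h : ∀ u v, V.FIC u v → Closed C u v) :
    MonCat.of (synCon C).Quotient ∈ V.carrier := by
  rw [← V.models_identities]
  intro e he
  exact satisfies_synCon.2 (h e.1 e.2 he)

/-- Four words whose identities separate three subvarieties in a non-distributive way. -/
theorem not_isDistributive_of_closed {V : Variety} {W0 Wi Wj Wij : Word} {CX CY : List α → Prop}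
    (hX : ∀ u v, V.FIC u v → Closed CX u v) (hY : ∀ u v, V.FIC u v → Closed CY u v)
    (h1 : Closed CX W0 Wi) (h2 : Closed CX Wj Wij) (h3 : Closed CY W0 Wj)
    (h4 : Closed (fun w => CX w ∧ CY w) Wi Wij) (h5 : ¬ Closed (fun w => CX w ∧ CY w) W0 Wj) :
    ¬ V.IsDistributive := by
  intro hd
  let VX := V ⊓ Variety.var {(W0, Wi), (Wj, Wij)}
  let VY := V ⊓ Variety.var {(W0, Wj)}
  let VZ := V ⊓ Variety.var {(Wi, Wij)}
  have hd' : (VX ⊔ VY) ⊓ VZ = (VX ⊓ VZ) ⊔ (VY ⊓ VZ) :=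
    congrArg Subtype.val (hd ⟨VX, (inf_le_left : VX ≤ V)⟩ ⟨VY, (inf_le_left : VY ≤ V)⟩
      ⟨VZ, (inf_le_left : VZ ≤ V)⟩)
  have hC : ∀ u v, V.FIC u v → Closed (fun w => CX w ∧ CY w) u v :=
    fun u v h => (hX u v h).and (hY u v h)
  have mX : MonCat.of (synCon CX).Quotient ∈ VX.carrier := by
    refine ⟨mem_of_closed hX, ?_⟩
    rintro e (rfl | rfl)
    · exact satisfies_synCon.2 h1
    · exact satisfies_synCon.2 h2
  have mY : MonCat.of (synCon CY).Quotient ∈ VY.carrier := by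
    refine ⟨mem_of_closed hY, ?_⟩
    rintro e rfl
    exact satisfies_synCon.2 h3
  have mC : MonCat.of (synCon fun w => CX w ∧ CY w).Quotient ∈ ((VX ⊔ VY) ⊓ VZ).carrier := by
    refine ⟨?_, mem_of_closed hC, ?_⟩
    · intro e he
      exact satisfies_synCon.2 ((satisfies_synCon.1 (he _ (Or.inl mX))).and
        (satisfies_synCon.1 (he _ (Or.inr mY))))
    · rintro e rfl
      exact satisfies_synCon.2 h4
  rw [hd'] at mC
  refine h5 (satisfies_synCon.1 (mC (W0, Wj) ?_))
  -- In the first meet the chain `W0 ≈ Wi ≈ Wij ≈ Wj` holds; in the second one `W0 ≈ Wj` is among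
  -- the defining identities.
  rintro N (⟨⟨-, hN1⟩, -, hN2⟩ | ⟨⟨-, hN1⟩, -⟩) φ
  · have e1 := hN1 (W0, Wi) (Or.inl rfl) φ
    have e2 := hN1 (Wj, Wij) (Or.inr rfl) φ
    have e3 := hN2 (Wi, Wij) rfl φ
    exact e1.trans (e3.trans e2.symm)
  · exact hN1 (W0, Wj) rfl φ

end Syntactic

/-- The identities of `M_α([w]^α)` preserve the class of `w`. -/
theorem con_of_fic {c : Con Word} {w u v : Word}
    (h : (Variety.generatedBy (MCon c {(w : c.Quotient)})).FIC u v) (φ : Letter → Word)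
    (p q : Word) (hu : c (p * FreeMonoid.lift φ u * q) w) :
    c (p * FreeMonoid.lift φ v * q) w := by
  have h1 := fic_generatedBy.1 h fun a => ((φ a : c.Quotient) : MCon c {(w : c.Quotient)})
  rw [lift_mk, lift_mk, lift_mk, lift_mk, Con.eq] at h1
  rcases h1 with h1 | ⟨h1, -⟩
  · rw [Con.eq] at h1
    exact c.trans (c.mul (c.mul (c.refl p) (c.symm h1)) (c.refl q)) hu
  · refine absurd ⟨_, rfl, (p : c.Quotient), (q : c.Quotient), ?_⟩ h1
    rw [← Con.coe_mul, ← Con.coe_mul, Con.eq]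
    exact c.symm hu

/-- In the Rees quotient over the class only factors of the class are nonzero, so an identity cannot
lead out of the class in any context. All later closure properties with respect to identities of the
variety rest on this. -/
theorem Pat.cls_of_fic {P : Pat} {w u v : Word} (hw : w.toList = P.word)
    (h : (varietyMGammaPrime w).FIC u v) (φ : Letter → List Letter) (p q : List Letter) :
    P.cls (p ++ (u.toList.flatMap φ ++ q)) ↔ P.cls (p ++ (v.toList.flatMap φ ++ q)) := by
  have key : ∀ u v, (varietyMGammaPrime w).FIC u v → P.cls (p ++ (u.toList.flatMap φ ++ q)) →
      P.cls (p ++ (v.toList.flatMap φ ++ q)) := by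
    intro u v h hu
    have hw' : w = FreeMonoid.ofList P.word := by rw [← hw]; rfl
    have e : ∀ u : Word, FreeMonoid.ofList (p ++ (u.toList.flatMap φ ++ q)) =
        FreeMonoid.ofList p * FreeMonoid.lift (fun a => FreeMonoid.ofList (φ a)) u *
          FreeMonoid.ofList q := by
      intro u
      apply FreeMonoid.toList.injective
      rw [FreeMonoid.toList_mul, FreeMonoid.toList_mul, toList_lift]
      simp
    unfold Pat.cls at hu ⊢
    rw [e, ← hw'] at hu ⊢
    exact con_of_fic h _ _ _ hu
  exact ⟨key u v h, key v u ((varietyMGammaPrime w).FIC.symm h)⟩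


/-! ### Repeating a letter inside a factor of repeated letters -/

section Insertion

variable {α : Type}

theorem exists_replicate_of_forall {l : List Letter} {a : Letter} (h : ∀ e ∈ l, e = a) :
    ∃ n, l = List.replicate n a := ⟨l.length, List.eq_replicate_length.2 h⟩

theorem sublist_of_mem_between {a e : Letter} {l1 l2 l3 : List Letter} (h : e ∈ l2) :
    [a, e, a].Sublist (l1 ++ (a :: (l2 ++ (a :: l3)))) := by
  refine List.Sublist.trans ?_ (List.sublist_append_right _ _)
  refine List.Sublist.cons_cons _ ?_
  exact (List.singleton_sublist.2 h).append (List.Sublist.cons_cons _ (List.nil_sublist _))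

theorem count_le_count_flatMap [BEq α] [LawfulBEq α] {r : α → List Letter} {c : α} {e : Letter}
    (he : e ∈ r c) (v : List α) : v.count c ≤ (v.flatMap r).count e := by
  induction v with
  | nil => simp
  | cons a v ih =>
    rw [List.flatMap_cons, List.count_append, List.count_cons]
    split_ifs with h
    · have : a = c := by simpa using h
      subst this
      have := List.one_le_count_iff.2 he
      omega
    · omega

variable {P : Pat} {A : List Letter → Prop}

/-- The possible values of a letter that surrounds a factor all of whose letters are repeated. -/
theorem Pat.Sys.value_of_surround [BEq α] [LawfulBEq α] (hA : P.Sys A) {p q : List Letter}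
    {Pp M R : List α} {c : α} {χ : α → List Letter}
    (hM : ∀ b ∈ M, 2 ≤ (Pp ++ (c :: (M ++ (c :: R)))).count b)
    (hv : A (p ++ ((Pp ++ (c :: (M ++ (c :: R)))).flatMap χ ++ q))) :
    χ c = [] ∨ ∃ a k, χ c = List.replicate (k + 1) a ∧
      (a = .x ∨ IsY a ∧ ∀ e ∈ M.flatMap χ, e = a) := by
  set U := Pp ++ (c :: (M ++ (c :: R))) with hU
  set u := p ++ (U.flatMap χ ++ q) with hu
  have hu2 : u = (p ++ Pp.flatMap χ) ++ (χ c ++ (M.flatMap χ ++ (χ c ++ (R.flatMap χ ++ q)))) := by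
    simp [hu, hU, List.flatMap_append]
  have hcount : ∀ b e, e ∈ χ b → U.count b ≤ u.count e := by
    intro b e he
    have h1 := count_le_count_flatMap he U
    have h2 : u.count e = p.count e + ((U.flatMap χ).count e + q.count e) := by
      simp only [hu, List.count_append]
    omega
  have hcU : 2 ≤ U.count c := by
    rw [hU]
    simp only [List.count_append, List.count_cons_self]
    omega
  have hc2 : ∀ e ∈ χ c, 2 ≤ u.count e := fun e he => hcU.trans (hcount c e he)
  have hm2 : ∀ e ∈ M.flatMap χ, 2 ≤ u.count e := by
    intro e he
    obtain ⟨b, hb, he⟩ := List.mem_flatMap.1 he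
    exact (hM b hb).trans (hcount b e he)
  have hxy : ∀ e ∈ χ c, e = .x ∨ IsY e := by
    intro e he
    have he1 := hc2 e he
    rcases hA.mem hv (List.count_pos_iff.1 (by omega : 0 < u.count e)) with
      h | h | ⟨h, hh, rfl⟩ | h
    · exact Or.inl h
    -- A letter `z` would have `tau e` between its two occurrences. All letters in the two images of
    -- `c` and in the factor between them occur at least twice, so the simple letter `tau e` lies
    -- outside; then one side of it contains both occurrences of `e`.
    · exfalso
      obtain ⟨V1, V2, e1, c1, c2, c3, c4⟩ := hA.tri hv h
      have ht := hA.count_tau hv h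
      have hmem : tau e ∈ u := List.count_pos_iff.1 (by omega)
      have n1 : tau e ∉ χ c := fun h' => by have := hc2 _ h'; omega
      have n2 : tau e ∉ M.flatMap χ := fun h' => by have := hm2 _ h'; omega
      have he2 : 1 ≤ (χ c).count e := List.one_le_count_iff.2 he
      have hmem' : tau e ∈ p ++ Pp.flatMap χ ∨ tau e ∈ R.flatMap χ ++ q := by
        rw [hu2] at hmem
        simp only [List.mem_append] at hmem n2 ⊢
        tauto
      rw [List.count_eq_zero] at c3 c4
      change u = _ at e1
      rcases hmem' with h' | h'
      · obtain ⟨a1, a2, ha⟩ := List.append_of_mem h'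
        rw [hu2, ha, List.append_assoc, List.cons_append] at e1
        obtain ⟨-, -, rfl⟩ := (List.append_cons_inj_of_notMem c3 c4).1 e1.symm
        simp only [List.count_append] at c2
        omega
      · obtain ⟨a1, a2, ha⟩ := List.append_of_mem h'
        rw [hu2, ha] at e1
        simp only [← List.append_assoc] at e1
        obtain ⟨rfl, -, -⟩ := (List.append_cons_inj_of_notMem c3 c4).1 e1.symm
        simp only [List.count_append] at c1
        omega
    · have := hA.count_tau hv hh
      change u.count _ = 1 at this
      omega
    · exact Or.inr h
  rcases List.eq_nil_or_concat (χ c) with h0 | ⟨s0, a0, h0⟩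
  · exact Or.inl h0
  right
  -- Each `y` forms a single island, so a `y` in the value of `c` forces everything up to its copy
  -- in the next value of `c` to be the same `y`.
  by_cases hy : ∃ y ∈ χ c, IsY y
  · obtain ⟨y, hyc, hy⟩ := hy
    obtain ⟨s1, s2, hs⟩ := List.append_of_mem hyc
    have hb : ∀ e ∈ s2 ++ (M.flatMap χ ++ s1), e = y := by
      intro e he
      by_contra hne
      refine hA.not_between_y hv hy hne ?_
      have h1 := sublist_of_mem_between (a := y) (l1 := (p ++ Pp.flatMap χ) ++ s1)
        (l3 := s2 ++ (R.flatMap χ ++ q)) he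
      change List.Sublist _ u
      rw [hu2, hs]
      simpa using h1
    obtain ⟨n, hn⟩ := exists_replicate_of_forall (l := χ c) (a := y) (by
      intro e he
      rw [hs, List.mem_append, List.mem_cons] at he
      rcases he with he | he | he
      · exact hb e (by simp [he])
      · exact he
      · exact hb e (by simp [he]))
    cases n with
    | zero => rw [hn] at hyc; simp at hyc
    | succ n =>
      exact ⟨y, n, hn, Or.inr ⟨hy, fun e he => hb e
        (List.mem_append_right _ (List.mem_append_left _ he))⟩⟩
  · obtain ⟨n, hn⟩ := exists_replicate_of_forall (l := χ c) (a := .x) (by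
      intro e he
      exact (hxy e he).resolve_right fun h => hy ⟨e, he, h⟩)
    cases n with
    | zero => rw [hn] at h0; simp at h0
    | succ n => exact ⟨.x, n, hn, Or.inl rfl⟩

/-- As `m1` is a power of `a`, the inserted power only enlarges an existing island; the power after
`m2` guarantees that `a` occurs at least twice. -/
theorem Pat.Sys.insert_left (hA : P.Sys A) {a : Letter} (ha : a = .x ∨ IsY a) {k : ℕ}
    {A0 m1 m2 B0 : List Letter} (hm : ∀ e ∈ m1, e = a) :
    A (A0 ++ (List.replicate (k + 1) a ++ (m1 ++ (m2 ++ (List.replicate (k + 1) a ++ B0))))) ↔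
    A (A0 ++ (List.replicate (k + 1) a ++ (m1 ++ (List.replicate (k + 1) a ++
      (m2 ++ (List.replicate (k + 1) a ++ B0)))))) := by
  obtain ⟨n, rfl⟩ := exists_replicate_of_forall hm
  have e1 : A0 ++ (List.replicate (k + 1) a ++ (List.replicate n a ++
      (m2 ++ (List.replicate (k + 1) a ++ B0)))) =
      A0 ++ (List.replicate (k + n + 1) a ++ (m2 ++ (List.replicate (k + 1) a ++ B0))) := by
    rw [show k + n + 1 = (k + 1) + n by omega, List.replicate_add (k + 1) n]
    simp only [List.append_assoc]
  have e2 : A0 ++ (List.replicate (k + 1) a ++ (List.replicate n a ++ (List.replicate (k + 1) a ++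
      (m2 ++ (List.replicate (k + 1) a ++ B0))))) =
      A0 ++ (List.replicate (k + n + (k + 1) + 1) a ++
        (m2 ++ (List.replicate (k + 1) a ++ B0))) := by
    rw [show k + n + (k + 1) + 1 = (k + 1) + (n + (k + 1)) by omega,
      List.replicate_add (k + 1), List.replicate_add n]
    simp only [List.append_assoc]
  rw [e1, e2]
  constructor
  · exact hA.ins a A0 _ _ _ ha (by simp only [List.count_append, List.count_replicate_self]; omega)
      (by simp only [List.count_append, List.count_replicate_self]; omega)
  · exact hA.ins a A0 _ _ _ ha (by simp only [List.count_append, List.count_replicate_self]; omega)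
      (by simp only [List.count_append, List.count_replicate_self]; omega)

theorem Pat.Sys.insert_right (hA : P.Sys A) {a : Letter} (ha : a = .x ∨ IsY a) {k : ℕ}
    {A0 m1 m2 B0 : List Letter} (hm : ∀ e ∈ m2, e = a) :
    A (A0 ++ (List.replicate (k + 1) a ++ (m1 ++ (m2 ++ (List.replicate (k + 1) a ++ B0))))) ↔
    A (A0 ++ (List.replicate (k + 1) a ++ (m1 ++ (List.replicate (k + 1) a ++
      (m2 ++ (List.replicate (k + 1) a ++ B0)))))) := by
  have := hA.rev.insert_left ha (k := k) (A0 := B0.reverse) (m1 := m2.reverse)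
    (m2 := m1.reverse) (B0 := A0.reverse) (fun e he => hm e (List.mem_reverse.1 he))
  simpa using this

variable [BEq α] [LawfulBEq α] {p q : List Letter} {Pp M1 M2 R : List α} {c : α} {χ : α → List Letter}

/-- Deleting a repetition of a letter inside a factor all of whose letters are repeated. -/
theorem Pat.Sys.of_insert (hA : P.Sys A)
    (hM : ∀ b ∈ M1 ++ M2, 2 ≤ (Pp ++ (c :: ((M1 ++ M2) ++ (c :: R)))).count b)
    (hv : A (p ++ ((Pp ++ (c :: (M1 ++ (c :: (M2 ++ (c :: R)))))).flatMap χ ++ q))) :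
    A (p ++ ((Pp ++ (c :: ((M1 ++ M2) ++ (c :: R)))).flatMap χ ++ q)) := by
  have hM' : ∀ b ∈ M1 ++ (c :: M2), 2 ≤ (Pp ++ (c :: ((M1 ++ (c :: M2)) ++ (c :: R)))).count b := by
    intro b hb
    by_cases hbc : b = c
    · subst hbc
      simp only [List.count_append, List.count_cons_self]
      omega
    · have h1 : b ∈ M1 ++ M2 := by
        simp only [List.mem_append, List.mem_cons] at hb ⊢
        tauto
      have h2 := hM b h1
      simp only [List.count_append, List.count_cons] at h2 ⊢
      omega
  have hv' : A (p ++ ((Pp ++ (c :: ((M1 ++ (c :: M2)) ++ (c :: R)))).flatMap χ ++ q)) := by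
    simpa using hv
  have e1 : p ++ ((Pp ++ (c :: ((M1 ++ M2) ++ (c :: R)))).flatMap χ ++ q) = (p ++ Pp.flatMap χ) ++
      (χ c ++ (M1.flatMap χ ++ (M2.flatMap χ ++ (χ c ++ (R.flatMap χ ++ q))))) := by
    simp [List.flatMap_append]
  have e2 : p ++ ((Pp ++ (c :: (M1 ++ (c :: (M2 ++ (c :: R)))))).flatMap χ ++ q) =
      (p ++ Pp.flatMap χ) ++ (χ c ++ (M1.flatMap χ ++ (χ c ++
        (M2.flatMap χ ++ (χ c ++ (R.flatMap χ ++ q)))))) := by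
    simp [List.flatMap_append]
  rw [e2] at hv
  rw [e1]
  rcases hA.value_of_surround hM' hv' with h | ⟨a, k, h, ha⟩
  · rw [h] at hv ⊢
    simpa using hv
  · rw [h] at hv ⊢
    rcases ha with rfl | ⟨ha, hm⟩
    -- Other letters on both sides of the middle power would create three islands of `x`. Otherwise
    -- the middle power is adjacent to one of the surrounding powers and is absorbed by it.
    · by_cases h1 : ∃ e ∈ M1.flatMap χ, e ≠ .x
      · by_cases h2 : ∃ e ∈ M2.flatMap χ, e ≠ .x
        · exfalso
          obtain ⟨e, he, hne⟩ := h1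
          obtain ⟨e', he', hne'⟩ := h2
          refine hA.not_alternating_x hv hne hne' ?_
          refine List.Sublist.trans ?_ (List.sublist_append_right _ _)
          have t : [Letter.x].Sublist (List.replicate (k + 1) .x) := by simp
          have := t.append ((List.singleton_sublist.2 he).append (t.append
            ((List.singleton_sublist.2 he').append (t.append (List.nil_sublist
              (R.flatMap χ ++ q))))))
          exact this
        · push Not at h2
          exact (hA.insert_right (Or.inl rfl) h2).2 hv
      · push Not at h1
        exact (hA.insert_left (Or.inl rfl) h1).2 hv
    · refine (hA.insert_left (Or.inr ha) fun e he => hm e ?_).2 hv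
      rw [List.flatMap_append]
      exact List.mem_append_left _ he

/-- Repeating a letter inside a factor all of whose letters are repeated. -/
theorem Pat.Sys.insert (hA : P.Sys A)
    (hM : ∀ b ∈ M1 ++ M2, 2 ≤ (Pp ++ (c :: ((M1 ++ M2) ++ (c :: R)))).count b)
    (hv : A (p ++ ((Pp ++ (c :: ((M1 ++ M2) ++ (c :: R)))).flatMap χ ++ q)))
    (hc : ∀ k, χ c = List.replicate (k + 1) .x → (∃ e ∈ M1.flatMap χ, e ≠ .x) →
      (∃ e ∈ M2.flatMap χ, e ≠ .x) → False) :
    A (p ++ ((Pp ++ (c :: (M1 ++ (c :: (M2 ++ (c :: R)))))).flatMap χ ++ q)) := by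
  have e1 : p ++ ((Pp ++ (c :: ((M1 ++ M2) ++ (c :: R)))).flatMap χ ++ q) = (p ++ Pp.flatMap χ) ++
      (χ c ++ (M1.flatMap χ ++ (M2.flatMap χ ++ (χ c ++ (R.flatMap χ ++ q))))) := by
    simp [List.flatMap_append]
  have e2 : p ++ ((Pp ++ (c :: (M1 ++ (c :: (M2 ++ (c :: R)))))).flatMap χ ++ q) =
      (p ++ Pp.flatMap χ) ++ (χ c ++ (M1.flatMap χ ++ (χ c ++
        (M2.flatMap χ ++ (χ c ++ (R.flatMap χ ++ q)))))) := by
    simp [List.flatMap_append]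
  have hval := hA.value_of_surround hM hv
  rw [e1] at hv
  rw [e2]
  rcases hval with h | ⟨a, k, h, ha⟩
  · rw [h] at hv ⊢
    simpa using hv
  · rcases ha with rfl | ⟨ha, hm⟩
    · have := hc k h
      rw [h] at hv ⊢
      by_cases h1 : ∃ e ∈ M1.flatMap χ, e ≠ .x
      · have h2 := this h1
        exact (hA.insert_right (Or.inl rfl) fun e he => by
          by_contra hne; exact h2 ⟨e, he, hne⟩).1 hv
      · push Not at h1
        exact (hA.insert_left (Or.inl rfl) h1).1 hv
    · rw [h] at hv ⊢
      refine (hA.insert_left (Or.inr ha) fun e he => hm e ?_).1 hv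
      rw [List.flatMap_append]
      exact List.mem_append_left _ he

end Insertion


/-! ## Words over four copies of the alphabet -/

/-- The letters `(c, h)` of the four copies of the alphabet, and the letter `none` that stands
for `x` in all copies. -/
abbrev Ix : Type := Option (Fin 4 × Letter)

/-- The copy number `c` of a word. -/
def up (c : Fin 4) (l : List Letter) : List Ix := l.map fun h => some (c, h)

/-- The projection to the copy number `c`. -/
def pr (c : Fin 4) : Ix → List Letter
  | none => [.x]
  | some (d, h) => if d = c ∧ h ≠ .x then [h] else []

/-- The symmetry of the four copies. -/
def rl : Ix → Ix
  | none => none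
  | some (c, h) => some (c.rev, h)

/-- The word read from right to left, with the copies of the alphabet in the opposite order. -/
def Rr (w : List Ix) : List Ix := (w.map rl).reverse

theorem rl_rl (i : Ix) : rl (rl i) = i := by
  rcases i with _ | ⟨c, h⟩ <;> simp [rl]

theorem Rr_append (u v : List Ix) : Rr (u ++ v) = Rr v ++ Rr u := by simp [Rr]

theorem Rr_Rr (u : List Ix) : Rr (Rr u) = u := by
  simp only [Rr, List.map_reverse, List.reverse_reverse, List.map_map]
  conv_rhs => rw [← List.map_id u]
  congr 1
  funext i
  exact rl_rl i

theorem mem_Rr {u : List Ix} {i : Ix} : i ∈ Rr u ↔ rl i ∈ u := by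
  simp only [Rr, List.mem_reverse, List.mem_map]
  constructor
  · rintro ⟨j, hj, rfl⟩
    rwa [rl_rl]
  · exact fun h => ⟨_, h, rl_rl i⟩

theorem count_Rr (u : List Ix) (i : Ix) : (Rr u).count i = u.count (rl i) := by
  rw [Rr, List.count_reverse]
  conv_lhs => rw [← rl_rl i]
  exact List.count_map_of_injective _ _ (Function.LeftInverse.injective rl_rl) _

theorem Rr_cons (i : Ix) (u : List Ix) : Rr (i :: u) = Rr u ++ [rl i] := by simp [Rr]

theorem Rr_flatMap (u : List Ix) (φ : Ix → List Ix) :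
    Rr (u.flatMap φ) = (Rr u).flatMap fun i => Rr (φ (rl i)) := by
  induction u with
  | nil => rfl
  | cons i u ih =>
    rw [List.flatMap_cons, Rr_append, ih, Rr_cons, List.flatMap_append]
    simp [rl_rl]

theorem reverse_flatMap_Rr (u : List Ix) (g : Ix → List Letter) :
    (u.flatMap g).reverse = (Rr u).flatMap fun i => (g (rl i)).reverse := by
  induction u with
  | nil => rfl
  | cons i u ih =>
    rw [List.flatMap_cons, List.reverse_append, ih, Rr_cons, List.flatMap_append]
    simp [rl_rl]

theorem pr_rl (c : Fin 4) (i : Ix) : (pr c (rl i)).reverse = pr c.rev i := by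
  rcases i with _ | ⟨d, h⟩
  · rfl
  · simp only [rl, pr, Fin.rev_eq_iff]
    split_ifs <;> rfl

theorem flatMap_pr_Rr (u : List Ix) (c : Fin 4) :
    (Rr u).flatMap (pr c) = (u.flatMap (pr c.rev)).reverse := by
  rw [reverse_flatMap_Rr]
  congr 1
  funext i
  rw [pr_rl, Fin.rev_rev]

theorem up_append (c : Fin 4) (u v : List Letter) : up c (u ++ v) = up c u ++ up c v :=
  List.map_append

theorem Rr_up (c : Fin 4) (u : List Letter) : Rr (up c u) = up c.rev u.reverse := by
  simp [Rr, up, rl]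

theorem mem_up {c d : Fin 4} {h : Letter} {u : List Letter} :
    some (d, h) ∈ up c u ↔ c = d ∧ h ∈ u := by
  simp [up]
  tauto

theorem up_flatMap_pr {c d : Fin 4} {u : List Letter} (hu : Letter.x ∉ u) :
    (up d u).flatMap (pr c) = if d = c then u else [] := by
  induction u with
  | nil => simp [up]
  | cons h u ih =>
    rw [List.mem_cons, not_or] at hu
    have := ih hu.2
    rw [up] at this ⊢
    rw [List.map_cons, List.flatMap_cons, this]
    by_cases hd : d = c <;> simp [pr, hd, Ne.symm hu.1]

theorem mem_flatMap_pr {w : List Ix} {c : Fin 4} {h : Letter} (hx : h ≠ .x) :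
    h ∈ w.flatMap (pr c) ↔ some (c, h) ∈ w := by
  rw [List.mem_flatMap]
  constructor
  · rintro ⟨_ | ⟨d, k⟩, hi, hh⟩
    · simp [pr, hx] at hh
    · simp only [pr] at hh
      split_ifs at hh with hd
      · obtain rfl : h = k := by simpa using hh
        rwa [← hd.1]
      · simp at hh
  · intro hi
    exact ⟨_, hi, by simp [pr, hx]⟩

theorem count_flatMap_pr (w : List Ix) (c : Fin 4) {h : Letter} (hx : h ≠ .x) :
    (w.flatMap (pr c)).count h = w.count (some (c, h)) := by
  induction w with
  | nil => rfl
  | cons i w ih =>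
    rw [List.flatMap_cons, List.count_append, ih, List.count_cons, add_comm]
    congr 1
    rcases i with _ | ⟨d, k⟩
    · simp [pr, hx.symm]
    · simp only [pr]
      by_cases hk : k = h
      · subst hk
        by_cases hd : d = c <;> simp [hx, hd]
      · have : some (d, k) ≠ some (c, h) := by simp [hk]
        split_ifs <;> simp_all

/-! ### The separating words and languages -/

namespace Pat

variable (P : Pat)

/-- The left outer part. -/
def Pw : List Ix := ([0, 1, 2, 3] : List (Fin 4)).flatMap fun c => up c (oS P.S)

/-- The right outer part. -/
def Qw : List Ix := ([0, 1, 2, 3] : List (Fin 4)).flatMap fun c => up c (oF P.F)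

/-- The block without its first and its last letter. -/
def mdw : List Ix :=
  up 0 (bl P.mid) ++ (some (3, P.f) :: (up 2 (bl P.blk) ++ (up 1 (bl P.blk) ++
    (some (0, P.l) :: up 3 (bl P.mid)))))

/-- The word with `e1` inserted after the first and `e2` before the last letter of the block. -/
def W (e1 e2 : List Ix) : List Ix :=
  P.Pw ++ (none :: some (0, P.f) :: (e1 ++ (P.mdw ++ (e2 ++ (some (3, P.l) :: none :: P.Qw)))))

/-- All tests that do not involve powers of `x` give the same result for `w` as for `W [] []`. -/
def Evt (A : List Letter → Prop) (w : List Ix) : Prop :=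
  ∀ (p0 : List Letter) (g : Ix → List Letter) (q0 : List Letter),
    (∀ i k, g i ≠ List.replicate (k + 1) .x) →
    (A (p0 ++ (w.flatMap g ++ q0)) ↔ A (p0 ++ ((P.W [] []).flatMap g ++ q0)))

/-- The words that agree with `W [] []` and have good projections to the copies 1, 2, 3. -/
def CX (A : List Letter → Prop) (w : List Ix) : Prop :=
  P.Evt A w ∧ ∀ c : Fin 4, c ≠ 0 → A (w.flatMap (pr c))

/-- The words that agree with `W [] []` and have good projections to the copies 0, 1, 2. -/
def CY (A : List Letter → Prop) (w : List Ix) : Prop :=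
  P.Evt A w ∧ ∀ c : Fin 4, c ≠ 3 → A (w.flatMap (pr c))

variable {P}

theorem Rr_Pw : Rr P.Pw = P.rev.Qw := by
  simp only [Pw, Qw, List.flatMap_cons, List.flatMap_nil, Rr_append, Rr_up, oS_reverse,
    List.append_assoc, List.append_nil]
  rfl

theorem Rr_Qw : Rr P.Qw = P.rev.Pw := by
  rw [← Rr_Rr P.rev.Pw, Rr_Pw, rev_rev]

theorem Rr_mdw : Rr P.mdw = P.rev.mdw := by
  simp only [mdw, rev_blk, Rr_append, Rr_up, Rr_cons, rl, bl_reverse, List.append_assoc,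
    List.cons_append]
  rfl

/-- The arrangement of the blocks is self-dual: reversal with `c ↦ 3 - c` yields the same word of
the reversed pattern and exchanges the two places of insertion. Together with `CY_iff` it turns
statements on `CX` into statements on `CY`. -/
theorem Rr_W (e1 e2 : List Ix) : Rr (P.W e1 e2) = P.rev.W (Rr e2) (Rr e1) := by
  simp only [W, Rr_append, Rr_cons, Rr_Pw, Rr_Qw, Rr_mdw, rl, List.append_assoc,
    List.singleton_append]
  rfl

theorem Evt.rev {A : List Letter → Prop} {w : List Ix} (h : P.Evt A w) :
    P.rev.Evt (fun v => A v.reverse) (Rr w) := by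
  intro p0 g q0 hg
  have e : ∀ w : List Ix, (p0 ++ ((Rr w).flatMap g ++ q0)).reverse =
      q0.reverse ++ (w.flatMap (fun i => (g (rl i)).reverse) ++ p0.reverse) := by
    intro w
    rw [List.reverse_append, List.reverse_append, List.append_assoc, reverse_flatMap_Rr, Rr_Rr]
  have e0 : P.rev.W [] [] = Rr (P.W [] []) := by rw [Rr_W]; rfl
  simp only [e0, e]
  refine h _ _ _ fun i k hi => hg (rl i) k ?_
  have := congrArg List.reverse hi
  simpa using this

theorem CY.rev {A : List Letter → Prop} {w : List Ix} (h : P.CY A w) :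
    P.rev.CX (fun v => A v.reverse) (Rr w) := by
  refine ⟨h.1.rev, fun c hc => ?_⟩
  simp only [flatMap_pr_Rr, List.reverse_reverse]
  refine h.2 _ ?_
  revert hc
  revert c
  decide

theorem CX.rev {A : List Letter → Prop} {w : List Ix} (h : P.CX A w) :
    P.rev.CY (fun v => A v.reverse) (Rr w) := by
  refine ⟨h.1.rev, fun c hc => ?_⟩
  simp only [flatMap_pr_Rr, List.reverse_reverse]
  refine h.2 _ ?_
  revert hc
  revert c
  decide

theorem CY_iff {A : List Letter → Prop} {w : List Ix} :
    P.CY A w ↔ P.rev.CX (fun v => A v.reverse) (Rr w) := by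
  constructor
  · exact CY.rev
  · intro h
    have := h.rev
    rw [rev_rev, Rr_Rr] at this
    simpa using this

section Facts

variable (hP : P.Good)
include hP

theorem Good.x_bl_blk : Letter.x ∉ bl P.blk := fun h => hP.x_blk (mem_bl.1 h)

theorem Good.x_bl_mid : Letter.x ∉ bl P.mid := fun h => hP.x_blk (by
  rw [blk]
  exact List.mem_cons_of_mem _ (List.mem_append_left _ (mem_bl.1 h)))

theorem Good.Pw_pr (c : Fin 4) : P.Pw.flatMap (pr c) = oS P.S := by
  have hx := x_notMem_oS hP.S_isZ
  simp only [Pw, List.flatMap_cons, List.flatMap_nil, List.flatMap_append, up_flatMap_pr hx]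
  fin_cases c <;> simp

theorem Good.Qw_pr (c : Fin 4) : P.Qw.flatMap (pr c) = oF P.F := by
  have hx := x_notMem_oF hP.F_isZ
  simp only [Qw, List.flatMap_cons, List.flatMap_nil, List.flatMap_append, up_flatMap_pr hx]
  fin_cases c <;> simp

theorem Good.sq_f : sq P.f = [P.f] := by
  rw [sq, if_neg (not_isY_of_isZ (hP.isZ _ hP.f_mem))]

theorem Good.sq_l : sq P.l = [P.l] := by
  rw [sq, if_neg (not_isY_of_isZ (hP.isZ _ hP.l_mem))]

theorem Good.bl_blk : bl P.blk = P.f :: (bl P.mid ++ [P.l]) := by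
  rw [blk, bl_cons, bl_append, bl_cons, hP.sq_f, hP.sq_l]
  simp [bl]

theorem Good.f_ne_x : P.f ≠ .x := ne_x_of_isZ (hP.isZ _ hP.f_mem)

theorem Good.l_ne_x : P.l ≠ .x := ne_x_of_isZ (hP.isZ _ hP.l_mem)

/-- The blocks are interleaved, but each copy keeps its own order of letters, and both occurrences
of `none` lie at the ends of every block. -/
theorem Good.W_pr (c : Fin 4) : (P.W [] []).flatMap (pr c) = P.word := by
  have hx := hP.x_bl_blk
  have hm := hP.x_bl_mid
  simp only [W, mdw, List.flatMap_append, List.flatMap_cons, hP.Pw_pr, hP.Qw_pr,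
    up_flatMap_pr hx, up_flatMap_pr hm, word, frame, List.flatMap_nil, pr]
  have e := hP.bl_blk
  have hf := hP.f_ne_x
  have hl := hP.l_ne_x
  fin_cases c <;> simp [e, hf, hl]

theorem Good.W_CX {A : List Letter → Prop} (hA : P.Sys A) : P.CX A (P.W [] []) :=
  ⟨fun _ _ _ _ => Iff.rfl, fun c _ => by rw [hP.W_pr]; exact hA.base⟩

theorem Good.W_CY {A : List Letter → Prop} (hA : P.Sys A) : P.CY A (P.W [] []) :=
  ⟨fun _ _ _ _ => Iff.rfl, fun c _ => by rw [hP.W_pr]; exact hA.base⟩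

/-- The inserted `x` separates the last letter of block 3 from the first one, so the projection to
copy 3 contains `x f x l x`. -/
theorem Good.Wj_not_CX {A : List Letter → Prop} (hA : P.Sys A) : ¬ P.CX A (P.W [] [none]) := by
  intro h
  have h3 := h.2 3 (by decide)
  refine hA.not_alternating_x h3 hP.f_ne_x hP.l_ne_x ?_
  have h0 : [(none : Ix), some (3, P.f), none, some (3, P.l), none].Sublist (P.W [] [none]) := by
    unfold W mdw
    refine List.Sublist.trans ?_ (List.sublist_append_right _ _)
    refine List.Sublist.cons_cons _ (List.Sublist.cons _ ?_)
    rw [List.nil_append, List.append_assoc]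
    refine List.Sublist.trans ?_ (List.sublist_append_right _ _)
    rw [List.cons_append]
    refine List.Sublist.cons_cons _ ?_
    refine List.Sublist.trans ?_ (List.sublist_append_right _ _)
    refine List.Sublist.cons_cons _ (List.Sublist.cons_cons _ (List.Sublist.cons_cons _ ?_))
    exact List.nil_sublist _
  have h1 := h0.flatMap (pr 3)
  simpa [pr, hP.f_ne_x, hP.l_ne_x] using h1

end Facts

end Pat


/-! ### The order of outer letters in words of the languages -/

namespace Pat

variable {P : Pat} {A : List Letter → Prop}

theorem append_cons_inj {α : Type} {a : α} {l1 l2 r1 r2 : List α} (hl : a ∉ l2) (hr : a ∉ r2)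
    (e : l1 ++ a :: r1 = l2 ++ a :: r2) : l1 = l2 ∧ r1 = r2 := by
  obtain ⟨h1, -, h2⟩ := (List.append_cons_inj_of_notMem hl hr).1 e.symm
  exact ⟨h1.symm, h2.symm⟩

theorem Sys.tri_ix (hA : P.Sys A) {w : List Ix} {d : Fin 4} (hd : A (w.flatMap (pr d)))
    {h : Letter} (hh : h ∈ P.S ++ P.F) : ∃ R1 R2, w = R1 ++ some (d, tau h) :: R2 ∧
      R1.count (some (d, h)) = 1 ∧ R2.count (some (d, h)) = 1 ∧
      some (d, tau h) ∉ R1 ∧ some (d, tau h) ∉ R2 := by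
  have hz := hA.good.isZ h hh
  have hx := tau_ne_x hz
  have hx' := ne_x_of_isZ hz
  obtain ⟨V1, V2, e, c1, c2, c3, c4⟩ := hA.tri hd hh
  have hc := hA.count_tau hd hh
  rw [count_flatMap_pr _ _ hx] at hc
  obtain ⟨R1, R2, rfl⟩ := List.append_of_mem
    (List.count_pos_iff.1 (by omega : 0 < w.count (some (d, tau h))))
  rw [List.count_append, List.count_cons_self] at hc
  rw [List.flatMap_append, List.flatMap_cons] at e
  have e' : R1.flatMap (pr d) ++ tau h :: R2.flatMap (pr d) = V1 ++ tau h :: V2 := by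
    rw [← e]
    simp [pr, hx]
  rw [List.count_eq_zero] at c3 c4
  obtain ⟨rfl, rfl⟩ := append_cons_inj c3 c4 e'
  refine ⟨R1, R2, rfl, ?_, ?_, ?_, ?_⟩
  · rw [← count_flatMap_pr _ _ hx', c1]
  · rw [← count_flatMap_pr _ _ hx', c2]
  · rw [← List.count_eq_zero]; omega
  · rw [← List.count_eq_zero]; omega

/-- The order of the letters `(c, h)`, `h ∈ F`, in the right outer part. -/
def Before (F : List Letter) (d : Fin 4) (h : Letter) (d' : Fin 4) (h' : Letter) : Prop :=
  d < d' ∨ d = d' ∧ F.idxOf h < F.idxOf h'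

theorem Before.trichotomy {F : List Letter} {d d' : Fin 4} {h h' : Letter} (hh : h ∈ F) :
    Before F d h d' h' ∨ (d = d' ∧ h = h') ∨ Before F d' h' d h := by
  unfold Before
  rcases lt_trichotomy d d' with h1 | rfl | h1
  · exact Or.inl (Or.inl h1)
  · rcases lt_trichotomy (F.idxOf h) (F.idxOf h') with h2 | h2 | h2
    · exact Or.inl (Or.inr ⟨rfl, h2⟩)
    · exact Or.inr (Or.inl ⟨rfl, (List.idxOf_inj hh).1 h2⟩)
    · exact Or.inr (Or.inr (Or.inr ⟨rfl, h2⟩))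
  · exact Or.inr (Or.inr (Or.inl h1))

theorem exists_split_of_idxOf_lt {F : List Letter} {h h' : Letter} (hh' : h' ∈ F)
    (hlt : F.idxOf h < F.idxOf h') : ∃ F1 F2 F3, F = F1 ++ h :: (F2 ++ h' :: F3) := by
  have hh : h ∈ F := List.idxOf_lt_length_iff.1 (hlt.trans (List.idxOf_lt_length_iff.2 hh'))
  obtain ⟨F1, F2, rfl, hF1⟩ := List.eq_append_cons_of_mem hh
  rcases List.mem_append.1 hh' with h1 | h1
  · exfalso
    have h2 : h ∉ F1 := hF1
    rw [List.idxOf_append_of_notMem h2, List.idxOf_append_of_mem h1] at hlt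
    have := List.idxOf_lt_length_iff.2 h1
    omega
  · rcases List.mem_cons.1 h1 with rfl | h1
    · exact absurd hlt (lt_irrefl _)
    · obtain ⟨F2, F3, rfl⟩ := List.append_of_mem h1
      exact ⟨F1, F2, F3, rfl⟩

theorem up_oF_split (c : Fin 4) (F1 F2 : List Letter) (h : Letter) : up c (oF (F1 ++ h :: F2)) =
    up c (oF F1) ++ some (c, tau h) :: some (c, h) :: up c (oF F2) := by
  rw [oF_append, oF_cons, up_append]
  rfl

theorem Before.exists_Qw {d d' : Fin 4} {h h' : Letter} (hb : Before P.F d h d' h')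
    (hh : h ∈ P.F) (hh' : h' ∈ P.F) : ∃ Q1 Q2 Q3, P.Qw =
      Q1 ++ some (d, tau h) :: some (d, h) ::
        (Q2 ++ some (d', tau h') :: some (d', h') :: Q3) := by
  rcases hb with hlt | ⟨rfl, hlt⟩
  · have hs : ∃ X Y Z : List (Fin 4), [0, 1, 2, 3] = X ++ d :: (Y ++ d' :: Z) := by
      have : [d, d'].Sublist ([0, 1, 2, 3] : List (Fin 4)) := by
        revert hlt
        revert d d'
        decide
      obtain ⟨X, r, e, h1, h2⟩ := List.cons_sublist_iff.1 this
      obtain ⟨X1, X2, rfl⟩ := List.append_of_mem h1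
      obtain ⟨Z1, Z2, rfl⟩ := List.append_of_mem (List.singleton_sublist.1 h2)
      exact ⟨X1, X2 ++ Z1, Z2, by rw [e]; simp⟩
    obtain ⟨X, Y, Z, e⟩ := hs
    obtain ⟨F1, F2, e1⟩ := List.append_of_mem hh
    obtain ⟨F3, F4, e2⟩ := List.append_of_mem hh'
    refine ⟨X.flatMap (fun c => up c (oF P.F)) ++ up d (oF F1), up d (oF F2) ++
      (Y.flatMap (fun c => up c (oF P.F)) ++ up d' (oF F3)), up d' (oF F4) ++
      Z.flatMap (fun c => up c (oF P.F)), ?_⟩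
    have k1 := up_oF_split d F1 F2 h
    have k2 := up_oF_split d' F3 F4 h'
    rw [← e1] at k1
    rw [← e2] at k2
    rw [Qw, e, List.flatMap_append, List.flatMap_cons, List.flatMap_append, List.flatMap_cons,
      k1, k2]
    simp
  · obtain ⟨F1, F2, F3, e⟩ := exists_split_of_idxOf_lt hh' hlt
    have hs : ∃ X Y : List (Fin 4), [0, 1, 2, 3] = X ++ d :: Y := by
      refine List.append_of_mem ?_
      revert d
      decide
    obtain ⟨X, Y, e'⟩ := hs
    have k := up_oF_split d F1 (F2 ++ h' :: F3) h
    rw [← e, up_oF_split] at k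
    refine ⟨X.flatMap (fun c => up c (oF P.F)) ++ up d (oF F1), up d (oF F2), up d (oF F3) ++
      Y.flatMap (fun c => up c (oF P.F)), ?_⟩
    rw [Qw, e', List.flatMap_append, List.flatMap_cons, k]
    simp

theorem mem_Qw {c : Fin 4} {h : Letter} (hh : h ∈ P.F) : some (c, h) ∈ P.Qw := by
  rw [Qw, List.mem_flatMap]
  exact ⟨c, by revert c; decide, mem_up.2 ⟨rfl, mem_oF.2 (Or.inl hh)⟩⟩

theorem mem_Pw {c : Fin 4} {h : Letter} (hh : h ∈ P.S) : some (c, h) ∈ P.Pw := by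
  rw [Pw, List.mem_flatMap]
  exact ⟨c, by revert c; decide, mem_up.2 ⟨rfl, mem_oS.2 (Or.inl hh)⟩⟩

theorem flatMap_eq_replicate {α : Type} [BEq α] [LawfulBEq α] {a : α} {g : α → List Letter}
    {h : Letter} (ha : g a = [h]) {l : List α} (hl : ∀ i ∈ l, i ≠ a → g i = []) :
    l.flatMap g = List.replicate (l.count a) h := by
  induction l with
  | nil => rfl
  | cons b l ih =>
    rw [List.flatMap_cons, ih fun i hi => hl i (List.mem_cons_of_mem _ hi), List.count_cons]
    by_cases hb : b = a
    · simp [hb, ha, List.replicate_succ]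
    · simp [hb, hl b List.mem_cons_self hb]

/-- Here `t` and `ζ` stand for `tau h` and `h` in one copy, and `T` is a later simple letter of the
right outer part. In `W [] []` the letter `T` follows `t` and both occurrences of `ζ`; two tests
show that this order cannot change in `w`. -/
theorem Sys.not_tau_before_aux (hA : P.Sys A) {w : List Ix} (hE : P.Evt A w) {h : Letter}
    (hm : h ∈ P.S ++ P.F) {T t ζ : Ix} (n1 : T ≠ t) (n2 : T ≠ ζ) (n3 : t ≠ ζ)
    {U V Z : List Ix} (hU : P.W [] [] = U ++ t :: (V ++ T :: Z)) (tU : t ∉ U) (tV : t ∉ V)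
    (tZ : t ∉ Z) (TU : T ∉ U) (TV : T ∉ V) (TZ : T ∉ Z) (cU : U.count ζ = 1) (cV : V.count ζ = 1)
    (cZ : Z.count ζ = 0) {R1 R2 : List Ix} (ew : w = R1 ++ t :: R2) (cw1 : R1.count ζ = 1)
    (cw2 : R2.count ζ = 1) (nw1 : t ∉ R1) (nw2 : t ∉ R2) {S1 S2 : List Ix}
    (eS : w = S1 ++ T :: S2) (nS1 : T ∉ S1) (nS2 : T ∉ S2) : ¬ [T, ζ].Sublist w := by
  intro hsub
  have hz := hA.good.isZ h hm
  obtain ⟨V1, V2, eV, cV1, cV2, nV1, nV2⟩ := hA.tri hA.base hm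
  rw [List.count_eq_zero] at nV1 nV2
  obtain ⟨α1, α2, rfl⟩ := List.append_of_mem (List.count_pos_iff.1 (by omega : 0 < V1.count h))
  obtain ⟨β1, β2, rfl⟩ := List.append_of_mem (List.count_pos_iff.1 (by omega : 0 < V2.count h))
  rw [List.count_append, List.count_cons_self] at cV1 cV2
  subst ew
  have hTw : T ∈ R1 ++ t :: R2 := by rw [eS]; simp
  rcases List.mem_append.1 hTw with h1 | h1
  · obtain ⟨u1, u2, rfl⟩ := List.append_of_mem h1
    have eS' : u1 ++ T :: (u2 ++ t :: R2) = S1 ++ T :: S2 := by rw [← eS]; simp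
    obtain ⟨rfl, rfl⟩ := append_cons_inj nS1 nS2 eS'
    -- If `T` precedes `t`: these letters carry two halves of the word of the pattern, which `W []
    -- []` restores. In `w` the halves are exchanged and no `h` follows `tau h`.
    let g : Ix → List Letter := fun i => if i = t then α1 ++ h :: (α2 ++ tau h :: β1) else
      if i = T then h :: β2 else []
    have gt : g t = α1 ++ h :: (α2 ++ tau h :: β1) := if_pos rfl
    have gT : g T = h :: β2 := by simp [g, n1]
    have g0 : ∀ l : List Ix, t ∉ l → T ∉ l → l.flatMap g = [] := by
      intro l h1 h2
      rw [List.flatMap_eq_nil_iff]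
      intro i hi
      have e1 : i ≠ t := by rintro rfl; exact h1 hi
      have e2 : i ≠ T := by rintro rfl; exact h2 hi
      simp [g, e1, e2]
    have hx := ne_x_of_isZ hz
    have hg := hE [] g [] (by
      intro i k hi
      have h0 : ∀ e ∈ g i, e = Letter.x := by
        rw [hi]; intro e he; exact (List.mem_replicate.1 he).2
      by_cases e1 : i = t
      · rw [e1, gt] at h0
        exact hx (h0 h (by simp))
      · by_cases e2 : i = T
        · rw [e2, gT] at h0
          exact hx (h0 h (by simp))
        · simp [g, e1, e2] at hi)
    have ev0 : (P.W [] []).flatMap g = P.word := by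
      rw [hU, List.flatMap_append, List.flatMap_cons, List.flatMap_append, List.flatMap_cons,
        g0 U tU TU, g0 V tV TV, g0 Z tZ TZ, gt, gT, eV]
      simp
    have ev1 : (u1 ++ T :: u2 ++ t :: R2).flatMap g =
        (h :: β2) ++ (α1 ++ h :: (α2 ++ tau h :: β1)) := by
      have m1 : t ∉ u1 := fun h' => nw1 (by simp [h'])
      have m2 : t ∉ u2 := fun h' => nw1 (by simp [h'])
      have m3 : T ∉ u2 := fun h' => nS2 (by simp [h'])
      have m4 : T ∉ R2 := fun h' => nS2 (by simp [h'])
      rw [List.append_assoc, List.cons_append, List.flatMap_append, List.flatMap_cons,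
        List.flatMap_append, List.flatMap_cons, g0 u1 m1 nS1, g0 u2 m2 m3, g0 R2 nw2 m4, gt, gT]
      simp
    rw [ev0, ev1, List.nil_append, List.append_nil, List.nil_append, List.append_nil] at hg
    have hA2 := hg.2 hA.base
    obtain ⟨X1, X2, eX, -, cX, nX1, nX2⟩ := hA.tri hA2 hm
    rw [List.count_eq_zero] at nX1 nX2
    have eX' : (h :: β2) ++ (α1 ++ h :: (α2 ++ tau h :: β1)) =
        ((h :: β2) ++ (α1 ++ h :: α2)) ++ tau h :: β1 := by simp
    rw [eX'] at eX
    obtain ⟨-, rfl⟩ := append_cons_inj nX1 nX2 eX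
    omega
  · rw [List.mem_cons] at h1
    obtain ⟨u2, u3, rfl⟩ := List.append_of_mem (h1.resolve_left n1)
    have eS' : (R1 ++ t :: u2) ++ T :: u3 = S1 ++ T :: S2 := by rw [← eS]; simp
    obtain ⟨rfl, rfl⟩ := append_cons_inj nS1 nS2 eS'
    have hζ3 : ζ ∈ u3 := by
      have e : R1 ++ t :: (u2 ++ T :: u3) = (R1 ++ t :: u2) ++ T :: u3 := by simp
      rw [e] at hsub
      have : ∀ l : List Ix, T ∉ l → [T, ζ].Sublist (l ++ T :: u3) → ζ ∈ u3 := by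
        intro l hl h1
        induction l with
        | nil => exact List.singleton_sublist.1 (List.cons_sublist_cons.1 h1)
        | cons a l ih =>
          rw [List.mem_cons, not_or] at hl
          rcases List.cons_sublist_cons'.1 h1 with h1 | h1
          · exact ih hl.2 h1
          · exact absurd h1.1 hl.1
      exact this _ nS1 hsub
    have c3 : 1 ≤ u3.count ζ := List.one_le_count_iff.2 hζ3
    have cw2' : u2.count ζ + u3.count ζ = 1 := by
      rw [List.count_append, List.count_cons] at cw2
      simpa [n2] using cw2
    -- If `T` follows `t` but not both `ζ`: in `w` one `ζ` lies on each side of `T`, and the test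
    -- restores the word of the pattern. In `W [] []` both precede `T`, which gives two `h` before
    -- `tau h`.
    let g : Ix → List Letter := fun i => if i = ζ then [h] else
      if i = T then α2 ++ tau h :: β1 else []
    have gζ : g ζ = [h] := if_pos rfl
    have gT : g T = α2 ++ tau h :: β1 := by simp [g, n2]
    have g0 : ∀ l : List Ix, T ∉ l → l.flatMap g = List.replicate (l.count ζ) h := by
      intro l h2
      refine flatMap_eq_replicate gζ ?_
      intro i hi e1
      have e2 : i ≠ T := by rintro rfl; exact h2 hi
      simp [g, e1, e2]
    have hx := ne_x_of_isZ hz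
    have hg := hE α1 g β2 (by
      intro i k hi
      have h0 : ∀ e ∈ g i, e = Letter.x := by
        rw [hi]; intro e he; exact (List.mem_replicate.1 he).2
      by_cases e1 : i = ζ
      · rw [e1, gζ] at h0
        exact hx (h0 h (by simp))
      · by_cases e2 : i = T
        · rw [e2, gT] at h0
          exact tau_ne_x hz (h0 (tau h) (by simp))
        · simp [g, e1, e2] at hi)
    have ev0 : (P.W [] []).flatMap g = h :: h :: (α2 ++ tau h :: β1) := by
      have k0 : g t = [] := by simp [g, n3, n1.symm]
      rw [hU, List.flatMap_append, List.flatMap_cons, List.flatMap_append, List.flatMap_cons,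
        g0 U TU, g0 V TV, g0 Z TZ, cU, cV, cZ, k0, gT]
      simp
    have ev1 : (R1 ++ t :: (u2 ++ T :: u3)).flatMap g =
        h :: ((α2 ++ tau h :: β1) ++ [h]) := by
      have e : R1 ++ t :: (u2 ++ T :: u3) = (R1 ++ t :: u2) ++ T :: u3 := by simp
      have k0 : (R1 ++ t :: u2).count ζ = 1 := by
        rw [List.count_append, List.count_cons]
        simp only [beq_iff_eq, n3, if_false]
        omega
      rw [e, List.flatMap_append, List.flatMap_cons, g0 _ nS1, g0 _ nS2, k0,
        show u3.count ζ = 1 by omega, gT]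
      simp
    rw [ev0, ev1] at hg
    have hA2 := hg.1 (by
      have := hA.base
      rw [eV] at this
      simpa using this)
    obtain ⟨X1, X2, eX, cX, -, nX1, nX2⟩ := hA.tri hA2 hm
    rw [List.count_eq_zero] at nX1 nX2
    have eX' : α1 ++ (h :: h :: (α2 ++ tau h :: β1) ++ β2) =
        (α1 ++ h :: h :: α2) ++ tau h :: (β1 ++ β2) := by simp
    rw [eX'] at eX
    obtain ⟨rfl, -⟩ := append_cons_inj nX1 nX2 eX
    rw [List.count_append, List.count_cons_self, List.count_cons_self] at cX
    omega

theorem Sys.not_tau_before (hA : P.Sys A) {w : List Ix} (hE : P.Evt A w) {d d' : Fin 4}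
    (hd : A (w.flatMap (pr d))) (hd' : A (w.flatMap (pr d'))) {h h' : Letter} (hh : h ∈ P.F)
    (hh' : h' ∈ P.F) (hb : Before P.F d h d' h') :
    ¬ [some (d', tau h'), some (d, h)].Sublist w := by
  have hm := List.mem_append_right P.S hh
  have hm' := List.mem_append_right P.S hh'
  have hz := hA.good.isZ h hm
  have hz' := hA.good.isZ h' hm'
  have n1 : some (d', tau h') ≠ some (d, tau h) := by
    intro e
    rw [Option.some.injEq, Prod.mk.injEq] at e
    have := tau_inj hz' hz e.2
    subst this
    rcases hb with h1 | h1
    · exact absurd e.1 h1.ne'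
    · exact absurd h1.2 (lt_irrefl _)
  have n2 : some (d', tau h') ≠ some (d, h) := by
    intro e
    rw [Option.some.injEq, Prod.mk.injEq] at e
    exact tau_ne hz' hz e.2
  have n3 : some (d, tau h) ≠ some (d, h) := by
    intro e
    rw [Option.some.injEq, Prod.mk.injEq] at e
    exact tau_ne hz hz e.2
  have hW : ∀ c, A ((P.W [] []).flatMap (pr c)) := fun c => by
    rw [hA.good.W_pr]; exact hA.base
  obtain ⟨Q1, Q2, Q3, eQ⟩ := hb.exists_Qw hh hh'
  obtain ⟨U, hU⟩ : ∃ U, P.W [] [] = U ++ some (d, tau h) ::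
      ((some (d, h) :: Q2) ++ some (d', tau h') :: (some (d', h') :: Q3)) := by
    rw [W, eQ]
    refine ⟨P.Pw ++ none :: some (0, P.f) :: (P.mdw ++ some (3, P.l) :: none :: Q1), ?_⟩
    simp
  obtain ⟨R1, R2, eR, cR1, cR2, nR1, nR2⟩ := hA.tri_ix (hW d) hm
  obtain ⟨R3, R4, eR', -, -, nT1, nT2⟩ := hA.tri_ix (hW d') hm'
  rw [hU] at eR
  obtain ⟨rfl, rfl⟩ := append_cons_inj nR1 nR2 eR
  rw [hU, ← List.cons_append, ← List.append_assoc] at eR'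
  obtain ⟨rfl, rfl⟩ := append_cons_inj nT1 nT2 eR'
  obtain ⟨X1, X2, ew, cw1, cw2, nw1, nw2⟩ := hA.tri_ix hd hm
  obtain ⟨S1, S2, eS, -, -, nS1, nS2⟩ := hA.tri_ix hd' hm'
  rw [List.mem_append, not_or] at nR2 nT1
  rw [List.count_append, List.count_cons_self, List.count_cons] at cR2
  exact hA.not_tau_before_aux hE hm n1 n2 n3 hU nR1 nR2.1
    (fun h => nR2.2 (List.mem_cons_of_mem _ h)) nT1.1 (fun h => nT1.2 (List.mem_cons_of_mem _ h))
    nT2 cR1 (by rw [List.count_cons_self]; omega) (by omega) ew cw1 cw2 nw1 nw2 eS nS1 nS2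

end Pat


/-! ### Preimages of outer letters under a substitution -/

namespace Pat

variable {P : Pat} {A : List Letter → Prop}

/-- The copy number `d` of `w1 ++ (m ++ w2)` has its block in `m`. -/
structure Mid (P : Pat) (A : List Letter → Prop) (d : Fin 4) (w1 m w2 : List Ix) : Prop where
  mem : A ((w1 ++ (m ++ w2)).flatMap (pr d))
  left : ∃ i, w1.flatMap (pr d) = oS P.S ++ List.replicate (i + 1) .x
  mid : ∃ i b j, P.Blk b ∧ m.flatMap (pr d) = List.replicate i .x ++ (b ++ List.replicate j .x)
  right : ∃ j, w2.flatMap (pr d) = List.replicate (j + 1) .x ++ oF P.F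

theorem Mid.rev {d : Fin 4} {w1 m w2 : List Ix} (h : P.Mid A d w1 m w2) :
    P.rev.Mid (fun v => A v.reverse) d.rev (Rr w2) (Rr m) (Rr w1) where
  mem := by
    have e : Rr w2 ++ (Rr m ++ Rr w1) = Rr (w1 ++ (m ++ w2)) := by
      rw [Rr_append, Rr_append, List.append_assoc]
    simp only [e, flatMap_pr_Rr, Fin.rev_rev, List.reverse_reverse]
    exact h.mem
  left := by
    obtain ⟨j, e⟩ := h.right
    refine ⟨j, ?_⟩
    rw [flatMap_pr_Rr, Fin.rev_rev, e]
    simp [oF_reverse, Pat.rev]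
  mid := by
    obtain ⟨i, b, j, hb, e⟩ := h.mid
    refine ⟨j, b.reverse, i, hb.rev, ?_⟩
    rw [flatMap_pr_Rr, Fin.rev_rev, e]
    simp
  right := by
    obtain ⟨j, e⟩ := h.left
    refine ⟨j, ?_⟩
    rw [flatMap_pr_Rr, Fin.rev_rev, e]
    simp [oS_reverse, Pat.rev]

/-- The part of a word to the left of the image of the block. -/
def lft (P : Pat) (φ : Ix → List Ix) (p e1 : List Ix) : List Ix := p ++ (P.Pw.flatMap φ ++ e1)

/-- The part of a word to the right of the image of the block. -/
def rgt (P : Pat) (φ : Ix → List Ix) (e2 s : List Ix) : List Ix := e2 ++ (P.Qw.flatMap φ ++ s)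

/-- A word that consists of a left part, the image of a part `M` of the block, and a right
part. -/
structure Ctx (P : Pat) (A : List Letter → Prop) (φ : Ix → List Ix) (p e1 M e2 s : List Ix) :
    Prop where
  sys : P.Sys A
  evt : P.Evt A (P.lft φ p e1 ++ (M.flatMap φ ++ P.rgt φ e2 s))
  blk : ∀ b ∈ M, ∃ c k, b = some (c, k) ∧ (k ∈ P.S ∨ k ∈ P.F ∨ 2 ≤ M.count b)

variable {φ : Ix → List Ix} {p e1 M e2 s : List Ix}

theorem Rr_lft : Rr (P.lft φ p e1) = P.rev.rgt (fun i => Rr (φ (rl i))) (Rr e1) (Rr p) := by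
  rw [lft, rgt, Rr_append, Rr_append, Rr_flatMap, Rr_Pw, List.append_assoc]

theorem Rr_rgt : Rr (P.rgt φ e2 s) = P.rev.lft (fun i => Rr (φ (rl i))) (Rr s) (Rr e2) := by
  rw [lft, rgt, Rr_append, Rr_append, Rr_flatMap, Rr_Qw, List.append_assoc]

theorem Ctx.rev (h : P.Ctx A φ p e1 M e2 s) : P.rev.Ctx (fun v => A v.reverse)
    (fun i => Rr (φ (rl i))) (Rr s) (Rr e2) (Rr M) (Rr e1) (Rr p) where
  sys := h.sys.rev
  evt := by
    have := h.evt.rev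
    rw [Rr_append, Rr_append, Rr_lft, Rr_rgt, Rr_flatMap, List.append_assoc] at this
    exact this
  blk b hb := by
    obtain ⟨c, k, e, hk⟩ := h.blk (rl b) (mem_Rr.1 hb)
    refine ⟨c.rev, k, ?_, ?_⟩
    · rw [← rl_rl b, e]; rfl
    · rw [count_Rr]
      simp only [Pat.rev, List.mem_reverse]
      tauto

/-- The block contains `(d, k)` exactly once, and nothing to the left of the block contains it. A
preimage in `S` would produce a further occurrence on the left through `Pw`, and a letter repeated
in `M` would produce two occurrences in the middle. -/
theorem Ctx.exists_preimage (h : P.Ctx A φ p e1 M e2 s) {d : Fin 4}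
    (hm : P.Mid A d (P.lft φ p e1) (M.flatMap φ) (P.rgt φ e2 s)) {k : Letter} (hk : k ∈ P.F) :
    ∃ c k', k' ∈ P.F ∧ some (c, k') ∈ M ∧ some (d, k) ∈ φ (some (c, k')) := by
  have hP := h.sys.good
  have hmem := List.mem_append_right P.S hk
  have hz := hP.isZ k hmem
  have hx := ne_x_of_isZ hz
  have c0 := h.sys.count_z hm.mem hmem
  obtain ⟨i, e1'⟩ := hm.left
  obtain ⟨j, e2'⟩ := hm.right
  have n1 : k ∉ (P.lft φ p e1).flatMap (pr d) := by
    rw [e1', List.mem_append, mem_oS, List.mem_replicate]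
    rintro ((h1 | ⟨s, hs, h1⟩) | h1)
    · exact hP.disjoint h1 hk
    · exact tau_ne (hP.S_isZ s hs) hz h1.symm
    · exact hx h1.2
  have c2 : ((P.rgt φ e2 s).flatMap (pr d)).count k = 1 := by
    rw [e2', List.count_append, List.count_replicate]
    have : (oF P.F).count k = 1 :=
      List.count_eq_one_of_mem (oF_nodup hP.F_nodup hP.F_isZ) (mem_oF.2 (Or.inl hk))
    rw [this]
    simp [hx.symm]
  rw [List.flatMap_append, List.flatMap_append, List.count_append, List.count_append,
    List.count_eq_zero.2 n1, c2] at c0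
  have c1 : (M.flatMap φ).count (some (d, k)) = 1 := by
    rw [← count_flatMap_pr _ _ hx]
    omega
  have hM := List.count_pos_iff.1 (by omega : 0 < (M.flatMap φ).count (some (d, k)))
  obtain ⟨b, hb, hbk⟩ := List.mem_flatMap.1 hM
  obtain ⟨c, k', rfl, hk' | hk' | hk'⟩ := h.blk b hb
  · exfalso
    apply n1
    rw [mem_flatMap_pr hx, lft, List.mem_append, List.mem_append, List.mem_flatMap]
    exact Or.inr (Or.inl ⟨_, mem_Pw hk', hbk⟩)
  · exact ⟨c, k', hk', hb, hbk⟩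
  · exfalso
    have : ∀ l : List Ix, l.count (some (c, k')) ≤ (l.flatMap φ).count (some (d, k)) := by
      intro l
      induction l with
      | nil => simp
      | cons a l ih =>
        rw [List.flatMap_cons, List.count_append, List.count_cons]
        split_ifs with h
        · have : a = some (c, k') := by simpa using h
          subst this
          have := List.one_le_count_iff.2 hbk
          omega
        · omega
    have := this M
    omega

/-- The order of letters of the right outer part is reflected by taking preimages. -/
theorem Ctx.before (h : P.Ctx A φ p e1 M e2 s) {d d' : Fin 4}
    (hd : P.Mid A d (P.lft φ p e1) (M.flatMap φ) (P.rgt φ e2 s))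
    (hd' : P.Mid A d' (P.lft φ p e1) (M.flatMap φ) (P.rgt φ e2 s)) {k k' a a' : Letter}
    (hk : k ∈ P.F) (hk' : k' ∈ P.F) (hb : Before P.F d k d' k') {c c' : Fin 4} (ha : a ∈ P.F)
    (ha' : a' ∈ P.F) (hM' : some (c', a') ∈ M)
    (hφ : some (d, k) ∈ φ (some (c, a))) (hφ' : some (d', k') ∈ φ (some (c', a'))) :
    Before P.F c a c' a' := by
  by_contra hcon
  have hm' := List.mem_append_right P.S hk'
  -- If the order failed, `(c, a)` would equal `(c', a')` or come after it in `Qw`, so some `(d, k)`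
  -- would occur in the image of `(c', a')` or later.
  obtain ⟨Q1, Q2, eQ, hin⟩ : ∃ Q1 Q2, P.Qw = Q1 ++ some (c', a') :: Q2 ∧
      some (c, a) ∈ some (c', a') :: Q2 := by
    rcases Before.trichotomy (F := P.F) (d := c) (d' := c') (h' := a') ha with h1 | ⟨rfl, rfl⟩ | h1
    · exact absurd h1 hcon
    · obtain ⟨Q1, Q2, e⟩ := List.append_of_mem (mem_Qw (c := c) ha)
      exact ⟨Q1, Q2, e, List.mem_cons_self⟩
    · obtain ⟨Q1, Q2, Q3, e⟩ := h1.exists_Qw ha' ha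
      refine ⟨Q1 ++ [some (c', tau a')], Q2 ++ some (c, tau a) :: some (c, a) :: Q3, ?_, by simp⟩
      rw [e]
      simp
  have hnot := h.sys.not_tau_before h.evt hd.mem hd'.mem hk hk' hb
  obtain ⟨R1, R2, eR, cR1, cR2, nR1, nR2⟩ := h.sys.tri_ix hd'.mem hm'
  have hz' := h.sys.good.isZ k' hm'
  set L := P.lft φ p e1 ++ (M.flatMap φ ++ (e2 ++ Q1.flatMap φ)) with hL
  have ew : P.lft φ p e1 ++ (M.flatMap φ ++ P.rgt φ e2 s) =
      L ++ (φ (some (c', a')) ++ (Q2.flatMap φ ++ s)) := by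
    simp [hL, rgt, eQ]
  rw [ew] at eR hnot
  have cL : 1 ≤ L.count (some (d', k')) := by
    refine List.one_le_count_iff.2 ?_
    simp only [hL, List.mem_append, List.mem_flatMap]
    exact Or.inr (Or.inl ⟨_, hM', hφ'⟩)
  have cφ : 1 ≤ (φ (some (c', a'))).count (some (d', k')) := List.one_le_count_iff.2 hφ'
  have hTmem : some (d', tau k') ∈ L ++ (φ (some (c', a')) ++ (Q2.flatMap φ ++ s)) := by
    rw [eR]; simp
  -- The simple letter of `(d', k')` separates its two occurrences, one from `M` and one from `(c',
  -- a')` in `Qw`. If it lies in `L`, it precedes some `(d, k)`, against `hnot`. In the image of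
  -- `(c', a')` it would also occur in the image of `M`; further right, both occurrences would
  -- precede it.
  rcases List.mem_append.1 hTmem with hT | hT
  · refine hnot ?_
    have h1 : some (d, k) ∈ φ (some (c', a')) ++ (Q2.flatMap φ ++ s) := by
      rw [List.mem_cons] at hin
      rcases hin with hin | hin
      · rw [← hin]
        exact List.mem_append_left _ hφ
      · exact List.mem_append_right _ (List.mem_append_left _ (List.mem_flatMap.2 ⟨_, hin, hφ⟩))
    exact (List.singleton_sublist.2 hT).append (List.singleton_sublist.2 h1)
  rcases List.mem_append.1 hT with hT | hT
  · have hT2 : some (d', tau k') ∈ L := by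
      simp only [hL, List.mem_append, List.mem_flatMap]
      exact Or.inr (Or.inl ⟨_, hM', hT⟩)
    have h1 := congrArg (List.count (some (d', tau k'))) eR
    clear_value L
    have h2 := List.one_le_count_iff.2 hT
    have h3 := List.one_le_count_iff.2 hT2
    simp only [List.count_append, List.count_cons_self, List.count_eq_zero.2 nR1,
      List.count_eq_zero.2 nR2] at h1
    omega
  · obtain ⟨B1, B2, eB⟩ := List.append_of_mem hT
    have eR' : (L ++ (φ (some (c', a')) ++ B1)) ++ some (d', tau k') :: B2 =
        R1 ++ some (d', tau k') :: R2 := by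
      rw [← eR, eB]
      simp
    clear_value L
    obtain ⟨rfl, rfl⟩ := append_cons_inj nR1 nR2 eR'
    rw [List.count_append, List.count_append] at cR1
    omega

theorem length_lt_of_injOn {α β : Type} [DecidableEq α] {l : List α} {l' : List β} {a : β}
    (f : α → β) (hl : l.Nodup) (hmap : ∀ x ∈ l, f x ∈ l' ∧ f x ≠ a)
    (hinj : ∀ x ∈ l, ∀ y ∈ l, f x = f y → x = y) (ha : a ∈ l') : l.length < l'.length := by
  classical
  have h1 : (l.map f).Nodup := hl.map_on hinj
  have h2 : (a :: l.map f).Nodup := by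
    rw [List.nodup_cons]
    refine ⟨fun h => ?_, h1⟩
    obtain ⟨x, hx, e⟩ := List.mem_map.1 h
    exact (hmap x hx).2 e
  have h3 : (a :: l.map f) ⊆ l' := by
    intro b hb
    rcases List.mem_cons.1 hb with rfl | hb
    · exact ha
    · obtain ⟨x, hx, rfl⟩ := List.mem_map.1 hb
      exact (hmap x hx).1
  have := (h2.subperm h3).length_le
  simpa using this

/-- Two different letters are comparable in the outer order, and by `Ctx.before` a common preimage
would come before itself. -/
theorem Ctx.injective (h : P.Ctx A φ p e1 M e2 s) {d d' : Fin 4}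
    (hd : P.Mid A d (P.lft φ p e1) (M.flatMap φ) (P.rgt φ e2 s))
    (hd' : P.Mid A d' (P.lft φ p e1) (M.flatMap φ) (P.rgt φ e2 s)) {k k' a : Letter}
    (hk : k ∈ P.F) (hk' : k' ∈ P.F) {c : Fin 4} (ha : a ∈ P.F) (hM : some (c, a) ∈ M)
    (hφ : some (d, k) ∈ φ (some (c, a))) (hφ' : some (d', k') ∈ φ (some (c, a))) :
    d = d' ∧ k = k' := by
  have irr : ¬ Before P.F c a c a := by
    rintro (h | h)
    · exact absurd h (lt_irrefl _)
    · exact absurd h.2 (lt_irrefl _)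
  rcases Before.trichotomy (F := P.F) (d := d) (d' := d') (h' := k') hk with h1 | h1 | h1
  · exact absurd (h.before hd hd' hk hk' h1 ha ha hM hφ hφ') irr
  · exact h1
  · exact absurd (h.before hd' hd hk' hk h1 ha ha hM hφ' hφ) irr

/-- As copy `d` comes before copy `c`, all preimages of its letters from `F` come before `(0, g)`.
So they lie in copy 0 and avoid `g`, and `F` would be mapped injectively into `F` without `g`. -/
theorem Ctx.false_of_lt (h : P.Ctx A φ p e1 M e2 s) {c d : Fin 4}
    (hd : P.Mid A d (P.lft φ p e1) (M.flatMap φ) (P.rgt φ e2 s))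
    (hc : P.Mid A c (P.lft φ p e1) (M.flatMap φ) (P.rgt φ e2 s)) {g : Letter} (hg : g ∈ P.F)
    (hdc : d < c) (hM : some (0, g) ∈ M) (hφ : some (c, g) ∈ φ (some (0, g))) : False := by
  have key : ∀ k ∈ P.F, ∃ k' ∈ P.F, k' ≠ g ∧ some (0, k') ∈ M ∧
      some (d, k) ∈ φ (some (0, k')) := by
    intro k hk
    obtain ⟨c', k', hk', hM', hφ'⟩ := h.exists_preimage hd hk
    rcases h.before hd hc hk hg (Or.inl hdc) hk' hg hM hφ' hφ with h1 | ⟨rfl, h1⟩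
    · exact absurd h1 (by simp)
    · exact ⟨k', hk', by rintro rfl; exact lt_irrefl _ h1, hM', hφ'⟩
  choose! f hf using key
  refine absurd (length_lt_of_injOn f h.sys.good.F_nodup (a := g) (l' := P.F)
    (fun k hk => ⟨(hf k hk).1, (hf k hk).2.1⟩) ?_ hg) (lt_irrefl _)
  intro k hk k' hk' e
  have h1 := hf k hk
  have h2 := hf k' hk'
  rw [← e] at h2
  exact (h.injective hd hd hk hk' h1.1 h1.2.2.1 h1.2.2.2 h2.2.2.2).2

/-- The same count at the other end of the order: nothing outside copy 3 comes after `(3, g)`.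
Applied to the reversed pattern it settles the letters `g` of `S` in `Ctx.false_of_lt'`. -/
theorem Ctx.false_of_gt (h : P.Ctx A φ p e1 M e2 s) {c d : Fin 4}
    (hd : P.Mid A d (P.lft φ p e1) (M.flatMap φ) (P.rgt φ e2 s))
    (hc : P.Mid A c (P.lft φ p e1) (M.flatMap φ) (P.rgt φ e2 s)) {g : Letter} (hg : g ∈ P.F)
    (hdc : c < d) (hφ : some (c, g) ∈ φ (some (3, g))) : False := by
  have key : ∀ k ∈ P.F, ∃ k' ∈ P.F, k' ≠ g ∧ some (3, k') ∈ M ∧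
      some (d, k) ∈ φ (some (3, k')) := by
    intro k hk
    obtain ⟨c', k', hk', hM', hφ'⟩ := h.exists_preimage hd hk
    rcases h.before hc hd hg hk (Or.inl hdc) hg hk' hM' hφ hφ' with h1 | ⟨rfl, h1⟩
    · have := c'.isLt
      rw [Fin.lt_def] at h1
      simp at h1
      omega
    · exact ⟨k', hk', by rintro rfl; exact lt_irrefl _ h1, hM', hφ'⟩
  choose! f hf using key
  refine absurd (length_lt_of_injOn f h.sys.good.F_nodup (a := g) (l' := P.F)
    (fun k hk => ⟨(hf k hk).1, (hf k hk).2.1⟩) ?_ hg) (lt_irrefl _)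
  intro k hk k' hk' e
  have h1 := hf k hk
  have h2 := hf k' hk'
  rw [← e] at h2
  exact (h.injective hd hd hk hk' h1.1 h1.2.2.1 h1.2.2.2 h2.2.2.2).2

/-- All four copies of `F` would be mapped injectively into four copies of `F` with one letter
missing. -/
theorem Ctx.false_of_all (h : P.Ctx A φ p e1 M e2 s)
    (hd : ∀ d, P.Mid A d (P.lft φ p e1) (M.flatMap φ) (P.rgt φ e2 s)) {g : Letter} (hg : g ∈ P.F)
    {c : Fin 4} (hM : some (c, g) ∉ M) : False := by
  have key : ∀ i : Fin 4 × Letter, i.2 ∈ P.F → ∃ j : Fin 4 × Letter, j.2 ∈ P.F ∧ some j ∈ M ∧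
      some i ∈ φ (some j) := by
    rintro ⟨d, k⟩ hk
    obtain ⟨c', k', hk', hM', hφ'⟩ := h.exists_preimage (hd d) hk
    exact ⟨(c', k'), hk', hM', hφ'⟩
  choose! f hf using key
  have mem : ∀ i : Fin 4 × Letter, i ∈ List.product (List.finRange 4) P.F ↔ i.2 ∈ P.F := by
    rintro ⟨d, k⟩
    rw [List.pair_mem_product]
    simp
  refine absurd (length_lt_of_injOn f ((List.nodup_finRange 4).product h.sys.good.F_nodup)
    (a := (c, g)) (l' := List.product (List.finRange 4) P.F) ?_ ?_ ((mem _).2 hg)) (lt_irrefl _)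
  · intro i hi
    have h1 := hf i ((mem i).1 hi)
    refine ⟨(mem _).2 h1.1, fun e => hM ?_⟩
    rw [← e]
    exact h1.2.1
  · intro i hi j hj e
    have h1 := hf i ((mem i).1 hi)
    have h2 := hf j ((mem j).1 hj)
    rw [← e] at h2
    have := h.injective (hd i.1) (hd j.1) ((mem i).1 hi) ((mem j).1 hj) h1.1 h1.2.1 h1.2.2 h2.2.2
    exact Prod.ext this.1 this.2

theorem Ctx.false_of_lt' (h : P.Ctx A φ p e1 M e2 s) {c d : Fin 4}
    (hd : P.Mid A d (P.lft φ p e1) (M.flatMap φ) (P.rgt φ e2 s))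
    (hc : P.Mid A c (P.lft φ p e1) (M.flatMap φ) (P.rgt φ e2 s)) {g : Letter}
    (hg : g ∈ P.S ++ P.F)
    (hdc : d < c) (hM : some (0, g) ∈ M) (hφ : some (c, g) ∈ φ (some (0, g))) : False := by
  rcases List.mem_append.1 hg with hg | hg
  · have r1 := hd.rev
    have r2 := hc.rev
    rw [Rr_lft, Rr_rgt, Rr_flatMap] at r1 r2
    refine h.rev.false_of_gt r1 r2 (g := g) (by simpa [Pat.rev] using hg) (Fin.rev_lt_rev.2 hdc) ?_
    rw [mem_Rr]
    simpa [rl] using hφ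
  · exact h.false_of_lt hd hc hg hdc hM hφ

theorem Ctx.false_of_all' (h : P.Ctx A φ p e1 M e2 s)
    (hd : ∀ d, P.Mid A d (P.lft φ p e1) (M.flatMap φ) (P.rgt φ e2 s)) {g : Letter}
    (hg : g ∈ P.S ++ P.F) {c : Fin 4} (hM : some (c, g) ∉ M) : False := by
  rcases List.mem_append.1 hg with hg | hg
  · have r1 : ∀ d, P.rev.Mid (fun v => A v.reverse) d
        (P.rev.lft (fun i => Rr (φ (rl i))) (Rr s) (Rr e2))
        ((Rr M).flatMap (fun i => Rr (φ (rl i))))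
        (P.rev.rgt (fun i => Rr (φ (rl i))) (Rr e1) (Rr p)) := by
      intro d
      have := (hd d.rev).rev
      rwa [Rr_lft, Rr_rgt, Rr_flatMap, Fin.rev_rev] at this
    refine h.rev.false_of_all r1 (g := g) (c := c.rev) (by simpa [Pat.rev] using hg) ?_
    rw [mem_Rr]
    simpa [rl] using hM
  · exact h.false_of_all hd hg hM

end Pat


/-! ## Tests for the order of the first two letters of the block in different copies -/

/-- The substitution that keeps `h`, replaces `tau h` by `K` and deletes all other letters. -/
def loc (h : Letter) (K : List Letter) (a : Letter) : List Letter :=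
  if a = h then [h] else if a = tau h then K else []

/-- The substitution that acts as `loc h K` on the copy `c`, as `loc h' K'` on the copy `d` and
deletes all other letters. -/
def pt (c : Fin 4) (h : Letter) (K : List Letter) (d : Fin 4) (h' : Letter) (K' : List Letter) :
    Ix → List Letter
  | none => []
  | some (e, a) => if e = c then loc h K a else if e = d then loc h' K' a else []

theorem tau_of_isY {a : Letter} (h : IsY a) : tau a = a := by
  cases a <;> simp_all [IsY, tau]

theorem tau_ne_x' {h : Letter} (hh : IsZ h ∨ IsY h) : tau h ≠ .x := by
  rcases hh with hh | hh
  · exact tau_ne_x hh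
  · rw [tau_of_isY hh]; exact ne_x_of_isY hh

theorem ne_x_of_or {h : Letter} (hh : IsZ h ∨ IsY h) : h ≠ .x := by
  rcases hh with hh | hh
  · exact ne_x_of_isZ hh
  · exact ne_x_of_isY hh

theorem loc_x {h : Letter} (hh : IsZ h ∨ IsY h) (K : List Letter) : loc h K .x = [] := by
  rw [loc, if_neg (ne_x_of_or hh).symm, if_neg (tau_ne_x' hh).symm]

theorem loc_self (h : Letter) (K : List Letter) : loc h K h = [h] := if_pos rfl

theorem loc_ne_replicate {h : Letter} (hh : IsZ h ∨ IsY h) {K : List Letter} (hK : tau h ∈ K)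
    (a : Letter) (k : ℕ) : loc h K a ≠ List.replicate (k + 1) .x := by
  unfold loc
  intro e
  split_ifs at e with h1 h2
  · have : h ∈ List.replicate (k + 1) Letter.x := by rw [← e]; simp
    exact ne_x_of_or hh (List.mem_replicate.1 this).2
  · rw [e] at hK
    exact tau_ne_x' hh (List.mem_replicate.1 hK).2
  · simp [List.replicate_succ] at e

section pt

variable {c d : Fin 4} {h h' : Letter} {K K' : List Letter}

theorem pt_symm (hcd : c ≠ d) : pt c h K d h' K' = pt d h' K' c h K := by
  funext i
  rcases i with _ | ⟨e, a⟩
  · rfl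
  · simp only [pt]
    split_ifs <;> simp_all

theorem pt_ne_replicate (hh : IsZ h ∨ IsY h) (hh' : IsZ h' ∨ IsY h') (hK : tau h ∈ K)
    (hK' : tau h' ∈ K') (i : Ix) (k : ℕ) : pt c h K d h' K' i ≠ List.replicate (k + 1) .x := by
  rcases i with _ | ⟨e, a⟩
  · simp [pt, List.replicate_succ]
  · simp only [pt]
    split_ifs
    · exact loc_ne_replicate hh hK a k
    · exact loc_ne_replicate hh' hK' a k
    · simp [List.replicate_succ]

theorem flatMap_pt_left (hcd : c ≠ d) (hh : IsZ h ∨ IsY h) (hh' : IsZ h' ∨ IsY h') {w : List Ix}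
    (hw : ∀ a ∈ w.flatMap (pr d), loc h' K' a = []) :
    w.flatMap (pt c h K d h' K') = (w.flatMap (pr c)).flatMap (loc h K) := by
  induction w with
  | nil => rfl
  | cons i w ih =>
    rw [List.flatMap_cons, List.flatMap_cons, List.flatMap_append,
      ih fun a ha => hw a (by rw [List.flatMap_cons]; exact List.mem_append_right _ ha)]
    congr 1
    rcases i with _ | ⟨e, a⟩
    · simp [pt, pr, loc_x hh]
    · by_cases hx : a = .x
      · simp [pt, pr, hx, loc_x hh, loc_x hh']
      · have := hw a
        simp only [List.flatMap_cons, List.mem_append] at this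
        by_cases hc : e = c
        · simp [pt, pr, hx, hc]
        · by_cases hd : e = d
          · simp [pt, pr, hd, hcd.symm, this (Or.inl (by simp [pr, hx, hd]))]
          · simp [pt, pr, hc, hd]

theorem flatMap_pt_right (hcd : c ≠ d) (hh : IsZ h ∨ IsY h) (hh' : IsZ h' ∨ IsY h') {w : List Ix}
    (hw : ∀ a ∈ w.flatMap (pr c), loc h K a = []) :
    w.flatMap (pt c h K d h' K') = (w.flatMap (pr d)).flatMap (loc h' K') := by
  rw [pt_symm hcd]
  exact flatMap_pt_left hcd.symm hh' hh hw

theorem up_flatMap_pt (e : Fin 4) (u : List Letter) : (up e u).flatMap (pt c h K d h' K') =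
    if e = c then u.flatMap (loc h K) else if e = d then u.flatMap (loc h' K') else [] := by
  induction u with
  | nil => simp [up]
  | cons a u ih =>
    rw [up] at ih ⊢
    rw [List.map_cons, List.flatMap_cons, ih]
    simp only [pt]
    split_ifs <;> rfl

end pt

theorem loc_oS {S : List Letter} (hz : ∀ s ∈ S, IsZ s) {h : Letter} (hh : IsZ h ∨ IsY h)
    (hS : h ∉ S) (K : List Letter) (i : ℕ) :
    ∀ a ∈ oS S ++ List.replicate i .x, loc h K a = [] := by
  intro a ha
  rw [List.mem_append, List.mem_replicate] at ha
  rcases ha with ha | ⟨-, rfl⟩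
  · have h1 : a ≠ h := by
      rintro rfl
      rcases mem_oS.1 ha with h1 | ⟨s, hs, h1⟩
      · exact hS h1
      · rcases hh with hh | hh
        · exact tau_ne (hz s hs) hh h1.symm
        · exact not_isY_tau (hz s hs) (h1 ▸ hh)
    have h2 : a ≠ tau h := by
      rcases hh with hh | hh
      · rintro rfl
        rcases mem_oS.1 ha with h1 | ⟨s, hs, h1⟩
        · exact tau_ne hh (hz _ h1) rfl
        · exact hS (tau_inj hh (hz s hs) h1 ▸ hs)
      · rwa [tau_of_isY hh]
    rw [loc, if_neg h1, if_neg h2]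
  · exact loc_x hh K

/-- Cut `oS S` at `h`: the part before `h` becomes the prefix `p0`, and the part after `tau h`,
followed by `X`, is put into the value of `tau h`. So `h` and `tau h` alone rebuild the outer part,
whatever the exponent of `x`. -/
theorem exists_left_aux {S : List Letter} (hn : S.Nodup) (hz : ∀ s ∈ S, IsZ s) {h : Letter}
    (hh : IsZ h) (hS : h ∈ S) (X : List Letter) :
    ∃ p0 K, tau h ∈ K ∧ ∀ i, p0 ++ (oS S ++ List.replicate i Letter.x).flatMap (loc h K) =
      oS S ++ X := by
  obtain ⟨S1, S2, rfl⟩ := List.append_of_mem hS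
  rw [List.nodup_middle, List.nodup_cons, List.mem_append, not_or] at hn
  refine ⟨oS S1, tau h :: (oS S2 ++ X), List.mem_cons_self, fun i => ?_⟩
  have e1 := loc_oS (fun s hs => hz s (List.mem_append_left _ hs)) (Or.inl hh) hn.1.1
    (tau h :: (oS S2 ++ X)) 0
  have e2 := loc_oS (fun s hs => hz s (List.mem_append_right _ (List.mem_cons_of_mem _ hs)))
    (Or.inl hh) hn.1.2 (tau h :: (oS S2 ++ X)) i
  rw [List.replicate_zero, List.append_nil] at e1
  rw [oS_append, oS_cons, List.append_assoc, List.cons_append, List.cons_append,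
    List.flatMap_append, List.flatMap_eq_nil_iff.2 e1, List.flatMap_cons, List.flatMap_cons,
    List.flatMap_eq_nil_iff.2 e2, loc_self, loc, if_neg (tau_ne hh hh), if_pos rfl]
  simp

/-- The left outer part can be built from the outer parts of two copies. -/
theorem exists_left {S : List Letter} (hn : S.Nodup) (hz : ∀ s ∈ S, IsZ s) {h h' : Letter}
    (hh : IsZ h ∨ IsY h) (hh' : IsZ h' ∨ IsY h') (hS : ¬ (h ∈ S ∧ h' ∈ S)) (X : List Letter) :
    ∃ p0 K0 K0', tau h ∈ K0 ∧ tau h' ∈ K0' ∧ ∀ K K', (h ∈ S → K = K0) → (h' ∈ S → K' = K0') →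
      ∀ (c d : Fin 4) (w : List Ix), c ≠ d → (∃ i, w.flatMap (pr c) = oS S ++ List.replicate i .x) →
      (∃ i, w.flatMap (pr d) = oS S ++ List.replicate i .x) →
      p0 ++ w.flatMap (pt c h K d h' K') = oS S ++ X := by
  have zS : ∀ {h : Letter}, h ∈ S → IsZ h := fun h1 => hz _ h1
  -- At most one of the two letters belongs to `S`; its copy rebuilds the left part while the other
  -- copy is deleted. If neither does, the constant prefix supplies everything.
  by_cases h1 : h ∈ S
  · have h2 : h' ∉ S := fun h2 => hS ⟨h1, h2⟩
    obtain ⟨p0, K0, hK, e⟩ := exists_left_aux hn hz (zS h1) h1 X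
    refine ⟨p0, K0, [tau h'], hK, by simp, ?_⟩
    rintro K K' hK1 - c d w hcd ⟨i, ei⟩ ⟨j, ej⟩
    rw [flatMap_pt_left hcd hh hh' (by rw [ej]; exact loc_oS hz hh' h2 K' j), ei, hK1 h1, e]
  · by_cases h2 : h' ∈ S
    · obtain ⟨p0, K0, hK, e⟩ := exists_left_aux hn hz (zS h2) h2 X
      refine ⟨p0, [tau h], K0, by simp, hK, ?_⟩
      rintro K K' - hK1 c d w hcd ⟨i, ei⟩ ⟨j, ej⟩
      rw [flatMap_pt_right hcd hh hh' (by rw [ei]; exact loc_oS hz hh h1 K i), ej, hK1 h2, e]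
    · refine ⟨oS S ++ X, [tau h], [tau h'], by simp, by simp, ?_⟩
      rintro K K' - - c d w hcd ⟨i, ei⟩ ⟨j, ej⟩
      rw [flatMap_pt_left hcd hh hh' (by rw [ej]; exact loc_oS hz hh' h2 K' j), ei,
        List.flatMap_eq_nil_iff.2 (loc_oS hz hh h1 K i), List.append_nil]

theorem reverse_flatMap_pr (w : List Ix) (c : Fin 4) :
    w.reverse.flatMap (pr c) = (w.flatMap (pr c)).reverse := by
  rw [List.reverse_flatMap]
  congr 1
  funext i
  rcases i with _ | ⟨e, a⟩
  · rfl
  · simp only [pr, Function.comp]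
    split_ifs <;> rfl

theorem reverse_flatMap_pt (w : List Ix) (c d : Fin 4) (h h' : Letter) (K K' : List Letter) :
    w.reverse.flatMap (pt c h K d h' K') =
      (w.flatMap (pt c h K.reverse d h' K'.reverse)).reverse := by
  rw [List.reverse_flatMap]
  congr 1
  funext i
  rcases i with _ | ⟨e, a⟩
  · rfl
  · simp only [pt, loc, Function.comp]
    split_ifs <;> simp

/-- The right outer part can be built from the outer parts of two copies. -/
theorem exists_right {F : List Letter} (hn : F.Nodup) (hz : ∀ s ∈ F, IsZ s) {h h' : Letter}
    (hh : IsZ h ∨ IsY h) (hh' : IsZ h' ∨ IsY h') (hF : ¬ (h ∈ F ∧ h' ∈ F)) (X : List Letter) :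
    ∃ q0 K0 K0', tau h ∈ K0 ∧ tau h' ∈ K0' ∧ ∀ K K', (h ∈ F → K = K0) → (h' ∈ F → K' = K0') →
      ∀ (c d : Fin 4) (w : List Ix), c ≠ d → (∃ i, w.flatMap (pr c) = List.replicate i .x ++ oF F) →
      (∃ i, w.flatMap (pr d) = List.replicate i .x ++ oF F) →
      w.flatMap (pt c h K d h' K') ++ q0 = X ++ oF F := by
  obtain ⟨p0, K0, K0', hK, hK', e⟩ := exists_left (S := F.reverse) (List.nodup_reverse.2 hn)
    (fun s hs => hz s (List.mem_reverse.1 hs)) hh hh' (by simpa using hF) X.reverse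
  refine ⟨p0.reverse, K0.reverse, K0'.reverse, by simpa using hK, by simpa using hK', ?_⟩
  rintro K K' h1 h2 c d w hcd ⟨i, ei⟩ ⟨j, ej⟩
  have := e K.reverse K'.reverse (fun h => by simp [h1 (by simpa using h)])
    (fun h => by simp [h2 (by simpa using h)]) c d w.reverse hcd
    ⟨i, by rw [reverse_flatMap_pr, ei]; simp [oF_reverse]⟩
    ⟨j, by rw [reverse_flatMap_pr, ej]; simp [oF_reverse]⟩
  have := congrArg List.reverse this
  rw [reverse_flatMap_pt] at this
  simpa [oS_reverse] using this

namespace Pat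

variable {P : Pat} {A : List Letter → Prop}

theorem Good.isZ_or (hP : P.Good) {h : Letter} (hh : h ∈ P.blk) : IsZ h ∨ IsY h :=
  (hP.blk_mem h hh).imp_left (hP.isZ h)

theorem Good.loc_blk (hP : P.Good) {h a : Letter} (hh : h ∈ P.blk) (K : List Letter)
    (ha : a = .x ∨ a ∈ P.blk) (hne : a ≠ h) : loc h K a = [] := by
  rw [loc, if_neg hne, if_neg]
  rintro rfl
  rcases ha with ha | ha
  · exact tau_ne_x' (hP.isZ_or hh) ha
  · rcases hP.blk_mem h hh with h1 | h1
    · exact hP.tau_blk h1 ha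
    · exact hne (tau_of_isY h1)

theorem Good.flatMap_loc (hP : P.Good) {h : Letter} (hh : h ∈ P.blk) (K : List Letter)
    {u : List Letter} (hu : ∀ a ∈ u, a = .x ∨ a ∈ P.blk) :
    u.flatMap (loc h K) = List.replicate (u.count h) h :=
  flatMap_eq_replicate (loc_self h K) fun a ha => hP.loc_blk hh K (hu a ha)

theorem Blk.eq_cons {b : List Letter} (hb : P.Blk b) : ∃ b', b = P.f :: b' := by
  obtain ⟨v1, v2, rfl, h1, -⟩ := exists_append_of_dst (l1 := [P.f]) (l2 := P.mid ++ [P.l])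
    (hb.dst_eq.trans rfl)
  obtain ⟨k, rfl⟩ := eq_replicate_of_dst h1
  exact ⟨_, rfl⟩

theorem Sys.head_eq (hA : P.Sys A) {h : Letter} {r : List Letter} (hh : h ≠ .x)
    (hv : A (oS P.S ++ (.x :: h :: r))) : h = P.f := by
  obtain ⟨i, j, b, e, hb⟩ := hA.expl _ hv
  obtain ⟨b', rfl⟩ := hb.eq_cons
  rw [frame, List.append_cancel_left_eq, List.replicate_succ, List.cons_append,
    List.cons.injEq] at e
  have e := e.2
  cases i with
  | zero =>
    rw [List.replicate_zero, List.nil_append, List.cons_append, List.cons.injEq] at e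
    exact e.1
  | succ i =>
    rw [List.replicate_succ, List.cons_append, List.cons.injEq] at e
    exact absurd e.1 hh

variable {g : Letter} {β : List Letter}

theorem blk_eq (hg : P.mid ++ [P.l] = g :: β) : P.blk = P.f :: g :: β := by rw [blk, hg]

theorem Good.bl_blk' (hP : P.Good) (hg : P.mid ++ [P.l] = g :: β) :
    bl P.blk = P.f :: (sq g ++ bl β) := by
  rw [blk_eq hg, bl_cons, bl_cons, hP.sq_f]
  rfl

theorem Good.bl_tail (hP : P.Good) (hg : P.mid ++ [P.l] = g :: β) :
    bl P.mid ++ [P.l] = sq g ++ bl β := by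
  have := hP.bl_blk
  rw [hP.bl_blk' hg, List.cons.injEq] at this
  exact this.2.symm

theorem Good.g_ne (hP : P.Good) (hg : P.mid ++ [P.l] = g :: β) : g ≠ P.f := by
  have := hP.blk_nodup
  rw [blk_eq hg] at this
  rintro rfl
  simp at this

theorem Good.f_notMem (hP : P.Good) (hg : P.mid ++ [P.l] = g :: β) : P.f ∉ β := by
  have := hP.blk_nodup
  rw [blk_eq hg] at this
  intro h
  simp [h] at this

theorem Good.g_notMem (hP : P.Good) (hg : P.mid ++ [P.l] = g :: β) : g ∉ β := by
  have := hP.blk_nodup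
  rw [blk_eq hg] at this
  intro h
  simp [h] at this

/-- The block cannot be contained in `f · bl β`, where `g` is missing; if it reached further to the
left, it would contain `f` twice. -/
theorem Sys.not_tail (hA : P.Sys A) (hg : P.mid ++ [P.l] = g :: β) {r : List Letter} :
    ¬ A (r ++ (P.f :: (bl β ++ (.x :: oF P.F)))) := by
  intro hv
  have hP := hA.good
  obtain ⟨i, j, b, e, hb⟩ := hA.expl _ hv
  obtain ⟨b', hb'⟩ := hb.eq_cons
  have hxβ : Letter.x ∉ P.f :: bl β := by
    intro h
    refine hP.x_blk ?_
    rw [blk_eq hg]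
    simp only [List.mem_cons, mem_bl] at h ⊢
    tauto
  have e1 : (r ++ (P.f :: bl β)) ++ [Letter.x] =
      (oS P.S ++ (List.replicate (i + 1) .x ++ (b ++ List.replicate j .x))) ++ [.x] := by
    rw [frame, List.replicate_succ' (n := j)] at e
    have e' : ((r ++ (P.f :: bl β)) ++ [Letter.x]) ++ oF P.F =
      ((oS P.S ++ (List.replicate (i + 1) .x ++ (b ++ List.replicate j .x))) ++ [.x]) ++ oF P.F := by
      simpa using e
    exact List.append_cancel_right e'
  have e2 := List.append_cancel_right e1
  cases j with
  | succ j =>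
    have h1 := congrArg List.getLast? e2
    rw [List.replicate_succ' (n := j)] at h1
    simp only [← List.append_assoc, List.getLast?_append_cons] at h1
    refine hxβ (List.mem_of_getLast? h1)
  | zero =>
    rw [List.replicate_zero, List.append_nil, ← List.append_assoc] at e2
    have hgb : g ∈ b := hb.mem.2 (by rw [blk_eq hg]; simp)
    have hg' : g ∉ P.f :: bl β := by
      rw [List.mem_cons, mem_bl]
      rintro (h | h)
      · exact hP.g_ne hg h
      · exact hP.g_notMem hg h
    rcases List.append_eq_append_iff.1 e2 with ⟨D, h1, h2⟩ | ⟨D, h1, h2⟩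
    · cases D with
      | nil =>
        rw [List.nil_append] at h2
        rw [h2] at hg'
        exact hg' hgb
      | cons a D =>
        have : Letter.x ∈ P.f :: bl β := by
          rw [h2]
          have h3 := congrArg List.getLast? h1
          rw [List.replicate_succ', ← List.append_assoc, List.getLast?_concat,
            List.getLast?_append_cons] at h3
          exact List.mem_append_left _ (List.mem_of_getLast? h3.symm)
        exact hxβ this
    · cases D with
      | nil =>
        rw [List.nil_append] at h2
        rw [← h2] at hg'
        exact hg' hgb
      | cons a D =>
        have hc := hb.count_z P.f hP.f_mem
        rw [h2] at hc hb'
        rw [List.cons_append, List.cons.injEq] at hb'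
        rw [hb'.1] at hc
        simp only [List.count_append, List.count_cons_self] at hc
        omega

/-- The pairs of copies such that the first letter of the block in the copy `c` precedes the
second letter in the copy `d`. -/
def Pos (c d : Fin 4) : Prop := c = 3 ∧ (d = 1 ∨ d = 2) ∨ (c = 1 ∨ c = 2) ∧ d = 3

/-- Without copy 0 the middle part reads: `f` of copy 3, block 2, block 1, the rest of block 3. Of
the two chosen copies only `f` in `c` and `g` in `d` remain. -/
theorem Good.W_pt (hP : P.Good) (hg : P.mid ++ [P.l] = g :: β) (c d : Fin 4) (K K' : List Letter)
    (hc : 0 ≠ c) (hd : 0 ≠ d) (hcd : c ≠ d) : (P.W [] []).flatMap (pt c P.f K d g K') =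
      (P.Pw ++ [none]).flatMap (pt c P.f K d g K') ++ (((if 3 = c then [P.f] else []) ++
        ((if 2 = c then [P.f] else if 2 = d then sq g else []) ++
        ((if 1 = c then [P.f] else if 1 = d then sq g else []) ++
        (if 3 = d then sq g else [])))) ++ (none :: P.Qw).flatMap (pt c P.f K d g K')) := by
  have e0 : P.W [] [] = (P.Pw ++ [none]) ++ (up 0 (P.f :: bl P.mid) ++ (up 3 [P.f] ++
      (up 2 (bl P.blk) ++ (up 1 (bl P.blk) ++ (up 0 [P.l] ++ (up 3 (bl P.mid ++ [P.l]) ++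
        (none :: P.Qw))))))) := by
    simp [W, mdw, up]
  have hf : P.f ∈ P.blk := by rw [blk]; simp
  have hgb : g ∈ P.blk := by rw [blk_eq hg]; simp
  have hβ : ∀ a ∈ bl β, a ∈ P.blk := fun a ha => by
    rw [blk_eq hg]
    have := mem_bl.1 ha
    simp [this]
  have hsq : ∀ a ∈ sq g, a = g := fun a ha => mem_sq.1 ha
  have f1 : (sq g).flatMap (loc P.f K) = [] := List.flatMap_eq_nil_iff.2 fun a ha => by
    rw [hsq a ha]; exact hP.loc_blk hf K (Or.inr hgb) (hP.g_ne hg)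
  have f2 : (bl β).flatMap (loc P.f K) = [] := List.flatMap_eq_nil_iff.2 fun a ha =>
    hP.loc_blk hf K (Or.inr (hβ a ha)) fun h => hP.f_notMem hg (h ▸ mem_bl.1 ha)
  have g1 : (sq g).flatMap (loc g K') = sq g := by
    unfold sq
    split_ifs <;> simp [loc_self]
  have g2 : (bl β).flatMap (loc g K') = [] := List.flatMap_eq_nil_iff.2 fun a ha =>
    hP.loc_blk hgb K' (Or.inr (hβ a ha)) fun h => hP.g_notMem hg (h ▸ mem_bl.1 ha)
  have g3 : loc g K' P.f = [] := hP.loc_blk hgb K' (Or.inr hf) (hP.g_ne hg).symm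
  rw [e0, List.flatMap_append, List.flatMap_append, List.flatMap_append, List.flatMap_append,
    List.flatMap_append, List.flatMap_append, List.flatMap_append]
  simp only [up_flatMap_pt, hP.bl_tail hg, hP.bl_blk' hg, List.flatMap_cons, List.flatMap_append,
    f1, f2, g1, g2, g3, loc_self, List.flatMap_nil, List.append_nil, List.nil_append, if_neg hc,
    if_neg hd, List.append_assoc]
  congr 1
  by_cases h3 : (3 : Fin 4) = c
  · have : ¬ (3 : Fin 4) = d := fun h => hcd (h3.symm.trans h)
    subst h3
    simp [this]
  · simp [h3]

/-- The tests that compare the positions of the first two letters of the block. -/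
theorem Sys.exists_test (hA : P.Sys A) (hg : P.mid ++ [P.l] = g :: β) : ∃ p0 q0 K K',
    (∀ (c d : Fin 4) (w : List Ix), c ≠ d →
      (∃ i, w.flatMap (pr c) = oS P.S ++ List.replicate i .x) →
      (∃ i, w.flatMap (pr d) = oS P.S ++ List.replicate i .x) →
      p0 ++ w.flatMap (pt c P.f K d g K') = oS P.S ++ [.x]) ∧
    (∀ (c d : Fin 4) (w : List Ix), c ≠ d →
      (∃ i, w.flatMap (pr c) = List.replicate i .x ++ oF P.F) →
      (∃ i, w.flatMap (pr d) = List.replicate i .x ++ oF P.F) →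
      w.flatMap (pt c P.f K d g K') ++ q0 = (bl β ++ [.x]) ++ oF P.F) ∧
    (∀ (w : List Ix) (c d : Fin 4), P.Evt A w → Pos c d →
      A (p0 ++ (w.flatMap (pt c P.f K d g K') ++ q0))) ∧
    (∀ w : List Ix, P.Evt A w → ¬ A (p0 ++ (w.flatMap (pt 1 P.f K 2 g K') ++ q0))) := by
  have hP := hA.good
  have hf : P.f ∈ P.blk := by rw [blk]; simp
  have hgb : g ∈ P.blk := by rw [blk_eq hg]; simp
  have zf := hP.isZ_or hf
  have zg := hP.isZ_or hgb
  -- The first two letters of the block are not of the same kind, so each outer part has to be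
  -- rebuilt from at most one of them. As `S` and `F` are disjoint, one value for each of `tau f`
  -- and `tau g` serves both sides.
  obtain ⟨k1, k2⟩ := hP.f_kind _ _ hg
  obtain ⟨p0, KL, KL', hKL, hKL', hL⟩ := exists_left hP.S_nodup hP.S_isZ zf zg k1 [.x]
  obtain ⟨q0, KR, KR', hKR, hKR', hR⟩ := exists_right hP.F_nodup hP.F_isZ zf zg k2 (bl β ++ [.x])
  obtain ⟨K, hK, h1, h2⟩ : ∃ K, tau P.f ∈ K ∧ (P.f ∈ P.S → K = KL) ∧ (P.f ∈ P.F → K = KR) := by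
    by_cases h : P.f ∈ P.S
    · exact ⟨KL, hKL, fun _ => rfl, fun h' => (hP.disjoint h h').elim⟩
    · exact ⟨KR, hKR, fun h' => absurd h' h, fun _ => rfl⟩
  obtain ⟨K', hK', h1', h2'⟩ : ∃ K', tau g ∈ K' ∧ (g ∈ P.S → K' = KL') ∧ (g ∈ P.F → K' = KR') := by
    by_cases h : g ∈ P.S
    · exact ⟨KL', hKL', fun _ => rfl, fun h' => (hP.disjoint h h').elim⟩
    · exact ⟨KR', hKR', fun h' => absurd h' h, fun _ => rfl⟩
  replace hL := hL K K' h1 h1'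
  replace hR := hR K K' h2 h2'
  have vW : ∀ c d : Fin 4, 0 ≠ c → 0 ≠ d → c ≠ d →
      p0 ++ ((P.W [] []).flatMap (pt c P.f K d g K') ++ q0) = oS P.S ++ (.x ::
        (((if 3 = c then [P.f] else []) ++
        ((if 2 = c then [P.f] else if 2 = d then sq g else []) ++
        ((if 1 = c then [P.f] else if 1 = d then sq g else []) ++
        (if 3 = d then sq g else [])))) ++ (bl β ++ (.x :: oF P.F)))) := by
    intro c d hc hd hcd
    have l1 : ∀ c, ∃ i, (P.Pw ++ [none]).flatMap (pr c) = oS P.S ++ List.replicate i .x :=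
      fun c => ⟨1, by rw [List.flatMap_append, hP.Pw_pr]; rfl⟩
    have r1 : ∀ c, ∃ i, (none :: P.Qw).flatMap (pr c) = List.replicate i .x ++ oF P.F :=
      fun c => ⟨1, by rw [List.flatMap_cons, hP.Qw_pr]; rfl⟩
    have eL := hL c d _ hcd (l1 c) (l1 d)
    have eR := hR c d _ hcd (r1 c) (r1 d)
    rw [hP.W_pt hg c d K K' hc hd hcd, List.append_assoc, ← List.append_assoc p0, eL,
      List.append_assoc, List.append_assoc _ _ q0, eR]
    simp
  refine ⟨p0, q0, K, K', hL, hR, ?_, ?_⟩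
  · intro w c d hw hcd
    have h0 : 0 ≠ c ∧ 0 ≠ d ∧ c ≠ d := by
      revert hcd
      unfold Pos
      revert c d
      decide
    rw [hw _ _ _ (pt_ne_replicate zf zg hK hK'), vW c d h0.1 h0.2.1 h0.2.2]
    have hb := hA.base
    rw [word, frame, hP.bl_blk' hg] at hb
    rcases hcd with ⟨rfl, rfl | rfl⟩ | ⟨rfl | rfl, rfl⟩ <;> simpa using hb
  -- In `W [] []` the whole block 2 precedes block 1, so this test puts `g` before `f`.
  · intro w hw
    rw [hw _ _ _ (pt_ne_replicate zf zg hK hK'), vW 1 2 (by decide) (by decide) (by decide)]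
    intro h
    obtain ⟨r, hr⟩ : ∃ r, sq g = g :: r := by
      unfold sq
      split_ifs <;> exact ⟨_, rfl⟩
    refine hP.g_ne hg (hA.head_eq (h := g) (ne_x_of_or zg) (r := r ++ (P.f :: (bl β ++
      (.x :: oF P.F)))) ?_)
    simpa [hr] using h

end Pat


/-! ## Relations between the copies -/

namespace Pat

variable {P : Pat} {A : List Letter → Prop} {w1 m m1 m2 w2 : List Ix} {c d e : Fin 4}

theorem Sys.mid_or (hA : P.Sys A) (hv : A ((w1 ++ (m ++ w2)).flatMap (pr d)))
    (h1 : ∃ r, w1.flatMap (pr d) = r ++ [.x]) (h2 : ∃ r, w2.flatMap (pr d) = .x :: r) :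
    P.Mid A d w1 m w2 ∨
    ((∃ i, w1.flatMap (pr d) = oS P.S ++ List.replicate i .x) ∧
      ∃ i, m.flatMap (pr d) = List.replicate i .x) ∨
    ((∃ i, m.flatMap (pr d) = List.replicate i .x) ∧
      ∃ i, w2.flatMap (pr d) = List.replicate i .x ++ oF P.F) := by
  obtain ⟨r1, h1⟩ := h1
  obtain ⟨r2, h2⟩ := h2
  have hv' := hv
  rw [List.flatMap_append, List.flatMap_append, h1, h2] at hv'
  rcases hA.split_x hv' rfl with ⟨i1, i2, j1, j2, b, hb, e1, e2, e3⟩ |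
    ⟨i1, i2, i3, j, b, hb, e1, e2, e3⟩ | ⟨i, j1, j2, j3, b, hb, e1, e2, e3⟩
  · exact Or.inl ⟨hv, ⟨i1, h1.trans e1⟩, ⟨i2, b, j1, hb, e2⟩, ⟨j2, h2.trans e3⟩⟩
  · exact Or.inr (Or.inl ⟨⟨_, h1.trans e1⟩, ⟨_, e2⟩⟩)
  · exact Or.inr (Or.inr ⟨⟨_, e2⟩, ⟨_, h2.trans e3⟩⟩)

theorem Mid.mem_blk (hd : P.Mid A d w1 m w2) {a : Letter} (ha : a ∈ m.flatMap (pr d)) :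
    a = .x ∨ a ∈ P.blk := by
  obtain ⟨i, b, j, hb, e⟩ := hd.mid
  rw [e, List.mem_append, List.mem_append, List.mem_replicate, List.mem_replicate, hb.mem] at ha
  tauto

theorem Mid.exists_count (hd : P.Mid A d w1 m w2) : ∃ b, P.Blk b ∧
    ∀ a ≠ Letter.x, (m.flatMap (pr d)).count a = b.count a := by
  obtain ⟨i, b, j, hb, e⟩ := hd.mid
  refine ⟨b, hb, fun a ha => ?_⟩
  rw [e]
  simp [List.count_append, List.count_replicate, ha.symm]

theorem Mid.flatMap_loc (hP : P.Good) (hd : P.Mid A d w1 m w2) {h : Letter} (hh : h ∈ P.blk)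
    (K : List Letter) : ∃ n, (m.flatMap (pr d)).flatMap (loc h K) = List.replicate (n + 1) h := by
  rw [hP.flatMap_loc hh K fun a => hd.mem_blk]
  obtain ⟨b, hb, e⟩ := hd.exists_count
  rw [e h (ne_x_of_or (hP.isZ_or hh))]
  have := List.count_pos_iff.2 (hb.mem.2 hh)
  exact ⟨b.count h - 1, by congr 1; omega⟩

theorem exists_second (P : Pat) : ∃ g β, P.mid ++ [P.l] = g :: β := by
  cases h : P.mid with
  | nil => exact ⟨_, _, rfl⟩
  | cons a t => exact ⟨_, _, rfl⟩

theorem Pos.ne (h : Pos c d) : c ≠ d := by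
  unfold Pos at h
  revert h
  revert c d
  decide

/-- If the block of one copy lies in the middle part, so does the block of another copy that
alternates with it. -/
theorem Sys.overlap (hA : P.Sys A) (hE : P.Evt A (w1 ++ (m ++ w2))) (hce : Pos c e)
    (hec : Pos e c) (hc : P.Mid A c w1 m w2) (hv : A ((w1 ++ (m ++ w2)).flatMap (pr e)))
    (h1 : ∃ r, w1.flatMap (pr e) = r ++ [.x]) (h2 : ∃ r, w2.flatMap (pr e) = .x :: r) :
    P.Mid A e w1 m w2 := by
  have hP := hA.good
  obtain ⟨g, β, hg⟩ := P.exists_second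
  have hf : P.f ∈ P.blk := by rw [blk]; simp
  have hgb : g ∈ P.blk := by rw [blk_eq hg]; simp
  have zf := hP.isZ_or hf
  have zg := hP.isZ_or hgb
  have nil_of : ∀ {h : Letter} (_ : IsZ h ∨ IsY h) (K : List Letter),
      (∃ i, m.flatMap (pr e) = List.replicate i .x) → ∀ a ∈ m.flatMap (pr e), loc h K a = [] := by
    rintro h hh K ⟨i, ei⟩ a ha
    rw [ei, List.mem_replicate] at ha
    rw [ha.2, loc_x hh]
  obtain ⟨p0, q0, K, K', hL, hR, hpos, -⟩ := hA.exists_test hg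
  obtain ⟨i0, l0⟩ := hc.left
  obtain ⟨j0, r0⟩ := hc.right
  rcases hA.mid_or hv h1 h2 with h | ⟨hl, hm⟩ | ⟨hm, hr⟩
  · exact h
  -- The block of `e` would lie to the right of `m`. In the test for the pair `(e, c)` the letter
  -- `g` of copy `c` then comes right after the initial `x`, where `f` should be.
  · exfalso
    have ht := hpos _ _ _ hE hec
    obtain ⟨n, hn⟩ := hc.flatMap_loc hP hgb K'
    rw [List.flatMap_append, List.flatMap_append, List.append_assoc, ← List.append_assoc p0,
      hL _ _ _ hec.ne hl ⟨_, l0⟩, flatMap_pt_right hec.ne zf zg (nil_of zf K hm), hn,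
      List.replicate_succ] at ht
    refine hP.g_ne hg (hA.head_eq (ne_x_of_or zg) (r := List.replicate n g ++
      (w2.flatMap (pt e P.f K c g K') ++ q0)) ?_)
    simpa using ht
  -- The block of `e` would lie to the left of `m`. In the test for `(c, e)` no `g` then stands
  -- between `f` and the final part, against `Sys.not_tail`.
  · exfalso
    have ht := hpos _ _ _ hE hce
    obtain ⟨n, hn⟩ := hc.flatMap_loc hP hf K
    rw [List.flatMap_append, List.flatMap_append, List.append_assoc, List.append_assoc,
      hR _ _ _ hce.ne ⟨_, r0⟩ hr, flatMap_pt_left hce.ne zf zg (nil_of zg K' hm), hn,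
      List.replicate_succ'] at ht
    refine hA.not_tail hg (r := p0 ++ (w1.flatMap (pt c P.f K e g K') ++ List.replicate n P.f)) ?_
    simpa using ht

/-- The block begins with `f`, so a prefix of the middle part that contains any letter but `x`
reaches this `f`. -/
theorem Mid.f_mem (hP : P.Good) (hd : P.Mid A d w1 (m1 ++ m2) w2)
    (hx : ∃ a ∈ m1.flatMap (pr d), a ≠ Letter.x) : some (d, P.f) ∈ m1 := by
  obtain ⟨a, ha, hax⟩ := hx
  obtain ⟨i, b, j, hb, e⟩ := hd.mid
  obtain ⟨b', rfl⟩ := hb.eq_cons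
  rw [← mem_flatMap_pr hP.f_ne_x]
  rw [List.flatMap_append] at e
  rcases List.append_eq_append_iff.1 e with ⟨D, h1, h2⟩ | ⟨D, h1, h2⟩
  · have : a ∈ List.replicate i Letter.x := by rw [h1]; exact List.mem_append_left _ ha
    exact absurd (List.mem_replicate.1 this).2 hax
  · cases D with
    | nil =>
      rw [List.append_nil] at h1
      rw [h1] at ha
      exact absurd (List.mem_replicate.1 ha).2 hax
    | cons a' D =>
      rw [List.cons_append, List.cons_append, List.cons.injEq] at h2
      rw [h1, h2.1]
      simp

/-- If `m1` contained no `f` of copy 2, then by `Mid.f_mem` it would contain no letter of that block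
at all. So `f` of copy 1 would precede `g` of copy 2 and the test for the pair `(1, 2)` would
succeed, while it fails for `W [] []`. -/
theorem Sys.pin (hA : P.Sys A) (hE : P.Evt A (w1 ++ ((m1 ++ m2) ++ w2)))
    (h1 : P.Mid A 1 w1 (m1 ++ m2) w2) (h2 : P.Mid A 2 w1 (m1 ++ m2) w2)
    (hf1 : some (1, P.f) ∈ m1) : some (2, P.f) ∈ m1 := by
  by_contra hcon
  have hP := hA.good
  obtain ⟨g, β, hg⟩ := P.exists_second
  have hf : P.f ∈ P.blk := by rw [blk]; simp
  have hgb : g ∈ P.blk := by rw [blk_eq hg]; simp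
  have zf := hP.isZ_or hf
  have zg := hP.isZ_or hgb
  obtain ⟨p0, q0, K, K', hL, hR, -, hneg⟩ := hA.exists_test hg
  obtain ⟨i1, l1⟩ := h1.left
  obtain ⟨j1, r1⟩ := h1.right
  obtain ⟨i2, l2⟩ := h2.left
  obtain ⟨j2, r2⟩ := h2.right
  have n12 : (1 : Fin 4) ≠ 2 := by decide
  have eL := hL 1 2 w1 n12 ⟨_, l1⟩ ⟨_, l2⟩
  have eR := hR 1 2 w2 n12 ⟨_, r1⟩ ⟨_, r2⟩
  obtain ⟨b1, hb1, c1⟩ := h1.exists_count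
  obtain ⟨b2, hb2, c2⟩ := h2.exists_count
  have x2 : ∀ a ∈ m1.flatMap (pr 2), a = Letter.x := by
    intro a ha
    by_contra hax
    exact hcon (h2.f_mem hP ⟨a, ha, hax⟩)
  have cf := c1 P.f hP.f_ne_x
  rw [hb1.count_z _ hP.f_mem, List.flatMap_append, List.count_append] at cf
  have cf1 := List.one_le_count_iff.2 ((mem_flatMap_pr hP.f_ne_x).2 hf1)
  have cf2 : (m1.flatMap (pr 1)).count P.f = 1 := by omega
  have cf3 : (m2.flatMap (pr 1)).count P.f = 0 := by omega
  have cg := c2 g (ne_x_of_or zg)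
  have cg1 : (m1.flatMap (pr 2)).count g = 0 := List.count_eq_zero.2 fun h =>
    ne_x_of_or zg (x2 g h)
  rw [List.flatMap_append, List.count_append, cg1, zero_add] at cg
  have e1 : m1.flatMap (pt 1 P.f K 2 g K') = [P.f] := by
    rw [flatMap_pt_left n12 zf zg fun a ha => by rw [x2 a ha, loc_x zg], hP.flatMap_loc hf K
      fun a ha => h1.mem_blk (by rw [List.flatMap_append]; exact List.mem_append_left _ ha), cf2]
    rfl
  have mb : ∀ d, P.Mid A d w1 (m1 ++ m2) w2 → ∀ a ∈ m2.flatMap (pr d), a = .x ∨ a ∈ P.blk :=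
    fun d hd a ha => hd.mem_blk (by rw [List.flatMap_append]; exact List.mem_append_right _ ha)
  have e2 : m2.flatMap (pt 1 P.f K 2 g K') = List.replicate (b2.count g) g := by
    rw [flatMap_pt_right n12 zf zg, hP.flatMap_loc hgb K' (mb 2 h2), cg]
    exact fun a ha => hP.loc_blk hf K (mb 1 h1 a ha) fun h => List.count_eq_zero.1 cf3 (h ▸ ha)
  refine hneg _ hE ?_
  have hb := hA.base
  have e3 : P.word = (oS P.S ++ [.x, P.f]) ++ (sq g ++ (bl β ++ (.x :: oF P.F))) := by
    rw [word, frame, hP.bl_blk' hg]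
    simp
  have e4 : p0 ++ ((w1 ++ ((m1 ++ m2) ++ w2)).flatMap (pt 1 P.f K 2 g K') ++ q0) =
      (oS P.S ++ [.x, P.f]) ++ (List.replicate (b2.count g) g ++ (bl β ++ (.x :: oF P.F))) := by
    rw [List.flatMap_append, List.flatMap_append, List.flatMap_append, e1, e2, List.append_assoc,
      ← List.append_assoc p0, eL, List.append_assoc _ _ q0, eR]
    simp
  rw [e4]
  rw [e3] at hb
  rcases hP.blk_mem g hgb with hz | hy
  · rw [hb2.count_z g hz]
    rwa [sq, if_neg (not_isY_of_isZ (hP.isZ g hz))] at hb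
  -- If `g` is a `y`, its exponent in copy 2 need not be two, but exponents from two on are
  -- interchangeable by `ins`.
  · have hc := hb2.count_y g hgb hy
    obtain ⟨n, hn⟩ : ∃ n, b2.count g = n + 1 + 1 := ⟨b2.count g - 2, by omega⟩
    rw [hn]
    refine hA.ins g _ _ 1 (n + 1) (Or.inr hy) ?_ ?_ (by simpa [sq, hy] using hb) <;>
    · simp only [List.count_append, List.count_replicate_self]
      omega

end Pat


/-! ## Inserting `none` into the words of the four copies -/

namespace Pat

variable {P : Pat} {A : List Letter → Prop}

/-- The words that agree with `W [] []` and have good projections to the copies in `D`. -/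
def CD (P : Pat) (D : Fin 4 → Prop) (A : List Letter → Prop) (w : List Ix) : Prop :=
  P.Evt A w ∧ ∀ c, D c → A (w.flatMap (pr c))

theorem CD_true {w : List Ix} : P.CD (fun _ => True) A w ↔ P.CX A w ∧ P.CY A w := by
  refine ⟨fun h => ⟨⟨h.1, fun c _ => h.2 c trivial⟩, ⟨h.1, fun c _ => h.2 c trivial⟩⟩,
    fun h => ⟨h.1.1, fun c _ => ?_⟩⟩
  by_cases hc : c = 0
  · exact h.2.2 c (by rw [hc]; decide)
  · exact h.1.2 c hc

/-- The condition on the letters of the middle part. -/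
def Rep (P : Pat) (M : List Ix) : Prop :=
  ∀ b ∈ M, ∃ c k, b = some (c, k) ∧ (k ∈ P.S ∨ k ∈ P.F ∨ 2 ≤ M.count b)

section Mids

theorem Pos.ne_zero {c e : Fin 4} (h : Pos c e) : e ≠ 0 := by
  unfold Pos at h
  revert h
  revert c e
  decide

theorem pos_three {c : Fin 4} (h0 : c ≠ 0) (h3 : c ≠ 3) : Pos c 3 ∧ Pos 3 c := by
  unfold Pos
  revert h0 h3
  revert c
  decide

variable {w1 m w2 : List Ix}

/-- Copy 3 alternates with copy 1 and with copy 2, so the position of one block passes through copy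
3 to the others. -/
theorem Sys.mid_ne_zero (hA : P.Sys A) (hE : P.Evt A (w1 ++ (m ++ w2)))
    (hv : ∀ d : Fin 4, d ≠ 0 → A ((w1 ++ (m ++ w2)).flatMap (pr d)) ∧
      (∃ r, w1.flatMap (pr d) = r ++ [.x]) ∧ ∃ r, w2.flatMap (pr d) = .x :: r)
    {c : Fin 4} (hc0 : c ≠ 0) (hc : P.Mid A c w1 m w2) : ∀ d ≠ 0, P.Mid A d w1 m w2 := by
  have step : ∀ c e : Fin 4, Pos c e → Pos e c → P.Mid A c w1 m w2 → P.Mid A e w1 m w2 := by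
    intro c e h1 h2 hc
    obtain ⟨h3, h4, h5⟩ := hv e h1.ne_zero
    exact hA.overlap hE h1 h2 hc h3 h4 h5
  have h3 : P.Mid A 3 w1 m w2 := by
    by_cases h : c = 3
    · rwa [← h]
    · exact step c 3 (pos_three hc0 h).1 (pos_three hc0 h).2 hc
  intro d hd
  by_cases h : d = 3
  · rwa [h]
  · exact step 3 d (pos_three hd h).2 (pos_three hd h).1 h3

theorem Mid.of_rev {d : Fin 4} (h : P.rev.Mid (fun v => A v.reverse) d.rev (Rr w2) (Rr m) (Rr w1)) :
    P.Mid A d w1 m w2 := by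
  have := h.rev
  simpa [rev_rev, Rr_Rr] using this

/-- The reversed statement links the copies 0, 1, 2. Both statements involve copy 1, so together
they connect all four copies. -/
theorem Sys.mid_all (hA : P.Sys A) (hE : P.Evt A (w1 ++ (m ++ w2)))
    (hv : ∀ d : Fin 4, A ((w1 ++ (m ++ w2)).flatMap (pr d)) ∧
      (∃ r, w1.flatMap (pr d) = r ++ [.x]) ∧ ∃ r, w2.flatMap (pr d) = .x :: r)
    {c : Fin 4} (hc : P.Mid A c w1 m w2) : ∀ d, P.Mid A d w1 m w2 := by
  have e : Rr (w1 ++ (m ++ w2)) = Rr w2 ++ (Rr m ++ Rr w1) := by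
    rw [Rr_append, Rr_append, List.append_assoc]
  have hE' := hE.rev
  rw [e] at hE'
  have h3 : ∀ c, c ≠ 3 → P.Mid A c w1 m w2 → ∀ d ≠ 3, P.Mid A d w1 m w2 := by
    intro c hc3 hc d hd
    have r0 : ∀ c : Fin 4, c ≠ 3 → c.rev ≠ 0 := by decide
    refine Mid.of_rev (hA.rev.mid_ne_zero hE' ?_ (r0 c hc3) hc.rev d.rev (r0 d hd))
    intro d _
    obtain ⟨h1, ⟨r, h2⟩, ⟨r', h3⟩⟩ := hv d.rev
    simp only [← e, flatMap_pr_Rr, List.reverse_reverse]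
    exact ⟨h1, ⟨r'.reverse, by simp [h3]⟩, ⟨r.reverse, by simp [h2]⟩⟩
  have h0 := fun c hc0 hc => hA.mid_ne_zero (c := c) hE (fun d _ => hv d) hc0 hc
  have h1 : P.Mid A 1 w1 m w2 := by
    by_cases hc0 : c = 0
    · exact h3 c (by rw [hc0]; decide) hc 1 (by decide)
    · exact h0 c hc0 hc 1 (by decide)
  intro d
  by_cases hd : d = 0
  · exact h3 1 (by decide) h1 d (by rw [hd]; decide)
  · exact h0 1 (by decide) h1 d hd

end Mids

section Step

variable {E1 M M1 M2 E2 : List Ix}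

/-- A word with outer parts `Pw` and `Qw` and a factor `M` that is surrounded by `none`. -/
def Uw (P : Pat) (E1 M E2 : List Ix) : List Ix :=
  (P.Pw ++ E1) ++ (none :: (M ++ (none :: (E2 ++ P.Qw))))

theorem Uw_eq (E1 M E2 : List Ix) (φ : Ix → List Ix) (p s : List Ix) :
    p ++ ((P.Uw E1 M E2).flatMap φ ++ s) = P.lft φ p (E1.flatMap φ ++ φ none) ++
      (M.flatMap φ ++ P.rgt φ (φ none ++ E2.flatMap φ) s) := by
  simp [Uw, lft, rgt, List.flatMap_append]

/-- A letter of `S` or `F` recurs in an outer part of its copy; the remaining letters are repeated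
inside `M`. -/
theorem Rep.count (hM : P.Rep M) : ∀ b ∈ M, 2 ≤ (P.Uw E1 M E2).count b := by
  intro b hb
  obtain ⟨c, k, rfl, hk⟩ := hM b hb
  have h1 := List.one_le_count_iff.2 hb
  simp only [Uw, List.count_append, List.count_cons]
  rcases hk with hk | hk | hk
  · have := List.one_le_count_iff.2 (mem_Pw (c := c) hk)
    omega
  · have := List.one_le_count_iff.2 (mem_Qw (c := c) hk)
    omega
  · omega

theorem flatMap_flatMap_append (p u s : List Ix) (φ : Ix → List Ix) (g : Ix → List Letter) :
    (p ++ (u.flatMap φ ++ s)).flatMap g =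
      p.flatMap g ++ (u.flatMap (fun i => (φ i).flatMap g) ++ s.flatMap g) := by
  rw [List.flatMap_append, List.flatMap_append, List.flatMap_assoc]

/-- The word `none` inserted between `M1` and `M2`. -/
theorem Sys.insert_ix (hA : P.Sys A) (hM : P.Rep (M1 ++ M2)) {φ : Ix → List Ix} {p s : List Ix}
    {p0 q0 : List Letter} {g : Ix → List Letter}
    (hv : A (p0 ++ ((p ++ ((P.Uw E1 (M1 ++ M2) E2).flatMap φ ++ s)).flatMap g ++ q0)))
    (hc : ∀ k, (φ none).flatMap g = List.replicate (k + 1) .x →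
      (∃ e ∈ (M1.flatMap φ).flatMap g, e ≠ .x) → (∃ e ∈ (M2.flatMap φ).flatMap g, e ≠ .x) →
      False) :
    A (p0 ++ ((p ++ ((P.Uw E1 (M1 ++ none :: M2) E2).flatMap φ ++ s)).flatMap g ++ q0)) := by
  rw [flatMap_flatMap_append] at hv ⊢
  have := hA.insert (p := p0 ++ p.flatMap g) (q := s.flatMap g ++ q0) (M1 := M1) (M2 := M2)
    (Pp := P.Pw ++ E1) (c := none) (R := E2 ++ P.Qw) (χ := fun i => (φ i).flatMap g) hM.count
    (by simpa [Uw] using hv) (by simpa [List.flatMap_assoc] using hc)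
  simpa [Uw] using this

theorem Sys.of_insert_ix (hA : P.Sys A) (hM : P.Rep (M1 ++ M2)) {φ : Ix → List Ix}
    {p s : List Ix} {p0 q0 : List Letter} {g : Ix → List Letter}
    (hv : A (p0 ++ ((p ++ ((P.Uw E1 (M1 ++ none :: M2) E2).flatMap φ ++ s)).flatMap g ++ q0))) :
    A (p0 ++ ((p ++ ((P.Uw E1 (M1 ++ M2) E2).flatMap φ ++ s)).flatMap g ++ q0)) := by
  rw [flatMap_flatMap_append] at hv ⊢
  have := hA.of_insert (p := p0 ++ p.flatMap g) (q := s.flatMap g ++ q0) (M1 := M1) (M2 := M2)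
    (Pp := P.Pw ++ E1) (c := none) (R := E2 ++ P.Qw) (χ := fun i => (φ i).flatMap g) hM.count
    (by simpa [Uw] using hv)
  simpa [Uw] using this

/-- If no insertion of `none` separates letters other than `x` in a copy in `D`, then the
set of words with good projections to the copies in `D` is closed under this insertion. -/
theorem Sys.CD_iff (hA : P.Sys A) (hM : P.Rep (M1 ++ M2)) {D : Fin 4 → Prop}
    (hcr : ∀ (φ : Ix → List Ix) (p s : List Ix),
      P.CD D A (p ++ ((P.Uw E1 (M1 ++ M2) E2).flatMap φ ++ s)) → ∀ c, D c → ∀ k,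
      (φ none).flatMap (pr c) = List.replicate (k + 1) .x →
      (∃ e ∈ (M1.flatMap φ).flatMap (pr c), e ≠ .x) →
      (∃ e ∈ (M2.flatMap φ).flatMap (pr c), e ≠ .x) → False)
    (φ : Ix → List Ix) (p s : List Ix) :
    P.CD D A (p ++ ((P.Uw E1 (M1 ++ M2) E2).flatMap φ ++ s)) ↔
    P.CD D A (p ++ ((P.Uw E1 (M1 ++ none :: M2) E2).flatMap φ ++ s)) := by
  have hE : ∀ (p0 : List Letter) (g : Ix → List Letter) (q0 : List Letter),
      (∀ i k, g i ≠ List.replicate (k + 1) .x) →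
      (A (p0 ++ ((p ++ ((P.Uw E1 (M1 ++ M2) E2).flatMap φ ++ s)).flatMap g ++ q0)) ↔
      A (p0 ++ ((p ++ ((P.Uw E1 (M1 ++ none :: M2) E2).flatMap φ ++ s)).flatMap g ++ q0))) := by
    intro p0 g q0 hg
    refine ⟨fun hv => hA.insert_ix hM hv fun k hk _ _ => ?_, hA.of_insert_ix hM⟩
    have hx : Letter.x ∈ (φ none).flatMap g := by rw [hk]; simp
    obtain ⟨i, hi, hgi⟩ := List.mem_flatMap.1 hx
    obtain ⟨n, hn⟩ := exists_replicate_of_forall (l := g i) (a := .x) fun e he => by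
      have : e ∈ (φ none).flatMap g := List.mem_flatMap.2 ⟨i, hi, he⟩
      rw [hk] at this
      exact (List.mem_replicate.1 this).2
    cases n with
    | zero => rw [hn] at hgi; simp at hgi
    | succ n => exact hg i n hn
  constructor
  · intro h
    refine ⟨fun p0 g q0 hg => ((hE p0 g q0 hg).symm.trans (h.1 p0 g q0 hg)), fun c hc => ?_⟩
    have := hA.insert_ix (p0 := []) (q0 := []) hM (by simpa using h.2 c hc) (hcr φ p s h c hc)
    simpa using this
  · intro h
    refine ⟨fun p0 g q0 hg => ((hE p0 g q0 hg).trans (h.1 p0 g q0 hg)), fun c hc => ?_⟩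
    have := hA.of_insert_ix (p0 := []) (q0 := []) (g := pr c) (φ := φ) (p := p) (s := s) hM
      (by simpa using h.2 c hc)
    simpa using this

/-- If `none` separates letters other than `x` in one copy, then the middle part contains the
block of this copy, and the powers of `x` surround the middle part in all copies in `D`. -/
theorem Sys.mid_of_crossing (hA : P.Sys A) (hM : P.Rep M) {D : Fin 4 → Prop} {φ : Ix → List Ix}
    {p s : List Ix} (h : P.CD D A (p ++ ((P.Uw E1 M E2).flatMap φ ++ s))) {c : Fin 4} (hc : D c)
    {k : ℕ} (hk : (φ none).flatMap (pr c) = List.replicate (k + 1) .x)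
    (hm : ∃ e ∈ (M.flatMap φ).flatMap (pr c), e ≠ .x) :
    P.Ctx A φ p (E1.flatMap φ ++ φ none) M (φ none ++ E2.flatMap φ) s ∧
    P.Mid A c (P.lft φ p (E1.flatMap φ ++ φ none)) (M.flatMap φ)
      (P.rgt φ (φ none ++ E2.flatMap φ) s) ∧
    ∀ d, D d → A ((P.lft φ p (E1.flatMap φ ++ φ none) ++ (M.flatMap φ ++
        P.rgt φ (φ none ++ E2.flatMap φ) s)).flatMap (pr d)) ∧
      (∃ r, (P.lft φ p (E1.flatMap φ ++ φ none)).flatMap (pr d) = r ++ [.x]) ∧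
      ∃ r, (P.rgt φ (φ none ++ E2.flatMap φ) s).flatMap (pr d) = .x :: r := by
  -- Only `none` projects to `x`. Its presence in `φ none` makes the value of `none` a nonempty
  -- power of `x` in every copy in `D`.
  have hnone : none ∈ φ none := by
    have hx : Letter.x ∈ (φ none).flatMap (pr c) := by rw [hk]; simp
    obtain ⟨i, hi, hgi⟩ := List.mem_flatMap.1 hx
    rcases i with _ | ⟨d, a⟩
    · exact hi
    · simp only [pr] at hgi
      split_ifs at hgi with h1
      · exact absurd (List.mem_singleton.1 hgi).symm h1.2
      · simp at hgi
  have hval : ∀ d, D d → ∃ k, (φ none).flatMap (pr d) = List.replicate (k + 1) .x := by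
    intro d hd
    have h1 := h.2 d hd
    rw [flatMap_flatMap_append] at h1
    have hx : Letter.x ∈ (φ none).flatMap (pr d) :=
      List.mem_flatMap.2 ⟨none, hnone, by simp [pr]⟩
    rcases hA.value_of_surround (Pp := P.Pw ++ E1) (M := M) (R := E2 ++ P.Qw) (c := none)
      hM.count h1 with h2 | ⟨a, k, h2, -⟩
    · rw [h2] at hx
      simp at hx
    · rw [h2] at hx
      rw [← (List.mem_replicate.1 hx).2] at h2
      exact ⟨k, h2⟩
  have hends : ∀ d, D d → A ((P.lft φ p (E1.flatMap φ ++ φ none) ++ (M.flatMap φ ++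
        P.rgt φ (φ none ++ E2.flatMap φ) s)).flatMap (pr d)) ∧
      (∃ r, (P.lft φ p (E1.flatMap φ ++ φ none)).flatMap (pr d) = r ++ [.x]) ∧
      ∃ r, (P.rgt φ (φ none ++ E2.flatMap φ) s).flatMap (pr d) = .x :: r := by
    intro d hd
    obtain ⟨k, hk⟩ := hval d hd
    refine ⟨by rw [← Uw_eq]; exact h.2 d hd, ?_, ?_⟩
    · refine ⟨p.flatMap (pr d) ++ ((P.Pw.flatMap φ).flatMap (pr d) ++
        ((E1.flatMap φ).flatMap (pr d) ++ List.replicate k .x)), ?_⟩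
      simp only [lft, List.flatMap_append, hk, List.replicate_succ', List.append_assoc]
    · refine ⟨List.replicate k .x ++ ((E2.flatMap φ).flatMap (pr d) ++
        ((P.Qw.flatMap φ).flatMap (pr d) ++ s.flatMap (pr d))), ?_⟩
      simp only [rgt, List.flatMap_append, hk, List.replicate_succ, List.append_assoc,
        List.cons_append]
  refine ⟨⟨hA, by rw [← Uw_eq]; exact h.1, hM⟩, ?_, hends⟩
  obtain ⟨h1, h2, h3⟩ := hends c hc
  obtain ⟨a, ha, hax⟩ := hm
  rcases hA.mid_or h1 h2 h3 with h4 | ⟨-, i, h4⟩ | ⟨⟨i, h4⟩, -⟩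
  · exact h4
  · rw [h4] at ha
    exact absurd (List.mem_replicate.1 ha).2 hax
  · rw [h4] at ha
    exact absurd (List.mem_replicate.1 ha).2 hax

/-- A harmful insertion puts the blocks 1, 2, 3 into the image of the factor and the letter `f` of
some copy `c` other than 0 into `φ (some (0, P.f))`. If `c` is 1, `Sys.pin` gives the same for copy
2. In each case a copy above copy 1 contradicts `Ctx.false_of_lt'` with `d = 1`; this is why two
undamaged inner copies are needed. -/
theorem Sys.CX_iff (hA : P.Sys A) (hM : P.Rep ([some (0, P.f)] ++ M2)) (φ : Ix → List Ix)
    (p s : List Ix) :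
    P.CX A (p ++ ((P.Uw E1 ([some (0, P.f)] ++ M2) E2).flatMap φ ++ s)) ↔
    P.CX A (p ++ ((P.Uw E1 ([some (0, P.f)] ++ none :: M2) E2).flatMap φ ++ s)) := by
  refine hA.CD_iff hM (D := fun c => c ≠ 0) ?_ φ p s
  intro φ p s h c hc k hk h1 h2
  obtain ⟨hctx, hmid, hends⟩ := hA.mid_of_crossing hM h hc hk (by
    obtain ⟨a, ha, hax⟩ := h1
    refine ⟨a, ?_, hax⟩
    rw [List.flatMap_append, List.flatMap_append]
    exact List.mem_append_left _ ha)
  have hall := hA.mid_ne_zero hctx.evt hends hc hmid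
  have hmid' := hmid
  rw [List.flatMap_append] at hmid'
  have hfc := hmid'.f_mem hA.good h1
  rw [List.flatMap_singleton] at hfc
  have key : ∀ c : Fin 4, 1 < c → some (c, P.f) ∈ φ (some (0, P.f)) → False := by
    intro c hc1 hc
    refine hctx.false_of_lt' (hall 1 (by decide)) (hall c ?_) hA.good.f_mem hc1 (by simp) hc
    rintro rfl
    exact absurd hc1 (by decide)
  by_cases h1c : c = 1
  · subst h1c
    have e2 := hctx.evt
    have m1 := hall 1 (by decide)
    have m2 := hall 2 (by decide)
    rw [List.flatMap_append, List.flatMap_singleton] at e2 m1 m2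
    exact key 2 (by decide) (hA.pin e2 m1 m2 hfc)
  · exact key c ((by decide : ∀ c : Fin 4, c ≠ 0 → c ≠ 1 → 1 < c) c hc h1c) hfc

/-- When all four projections are required, a harmful insertion puts all four blocks into the image
of the factor, which is impossible as soon as the factor lacks one letter. -/
theorem Sys.CD_true_iff (hA : P.Sys A) (hM : P.Rep (M1 ++ M2))
    (hf : some (0, P.f) ∉ M1 ++ M2) (φ : Ix → List Ix) (p s : List Ix) :
    P.CD (fun _ => True) A (p ++ ((P.Uw E1 (M1 ++ M2) E2).flatMap φ ++ s)) ↔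
    P.CD (fun _ => True) A (p ++ ((P.Uw E1 (M1 ++ none :: M2) E2).flatMap φ ++ s)) := by
  refine hA.CD_iff hM ?_ φ p s
  intro φ p s h c hc k hk h1 h2
  obtain ⟨hctx, hmid, hends⟩ := hA.mid_of_crossing hM h hc hk (by
    obtain ⟨a, ha, hax⟩ := h1
    refine ⟨a, ?_, hax⟩
    rw [List.flatMap_append, List.flatMap_append]
    exact List.mem_append_left _ ha)
  exact hctx.false_of_all' (hA.mid_all hctx.evt (fun d => hends d trivial) hmid) hA.good.f_mem hf

end Step

end Pat


/-! ### Closure of the languages and conclusion -/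

namespace Pat

variable {P : Pat} {A : List Letter → Prop}

theorem Rep.append {M M' : List Ix} (h : P.Rep M) (h' : P.Rep M') : P.Rep (M ++ M') := by
  intro b hb
  rcases List.mem_append.1 hb with hb | hb
  · obtain ⟨c, k, e, hk⟩ := h b hb
    refine ⟨c, k, e, hk.imp_right fun hk => hk.imp_right fun hk => ?_⟩
    rw [List.count_append]
    omega
  · obtain ⟨c, k, e, hk⟩ := h' b hb
    refine ⟨c, k, e, hk.imp_right fun hk => hk.imp_right fun hk => ?_⟩
    rw [List.count_append]
    omega

theorem rep_singleton {c : Fin 4} {k : Letter} (hk : k ∈ P.S ++ P.F) : P.Rep [some (c, k)] := by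
  intro b hb
  obtain rfl := List.mem_singleton.1 hb
  refine ⟨c, k, rfl, ?_⟩
  rcases List.mem_append.1 hk with hk | hk
  · exact Or.inl hk
  · exact Or.inr (Or.inl hk)

theorem Good.rep_up (hP : P.Good) (c : Fin 4) {u : List Letter} (hu : ∀ k ∈ u, k ∈ P.blk) :
    P.Rep (up c (bl u)) := by
  intro b hb
  obtain ⟨k, hk, rfl⟩ := List.mem_map.1 hb
  rw [mem_bl] at hk
  refine ⟨c, k, rfl, ?_⟩
  rcases hP.blk_mem k (hu k hk) with h | h
  · rcases List.mem_append.1 h with h | h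
    · exact Or.inl h
    · exact Or.inr (Or.inl h)
  · refine Or.inr (Or.inr ((two_le_count_bl h hk).trans_eq ?_))
    rw [up]
    exact (List.count_map_of_injective _ (fun k => some (c, k))
      (fun a b h => by simpa using h) _).symm

theorem Good.rep_mdw (hP : P.Good) : P.Rep P.mdw := by
  have e : P.mdw = up 0 (bl P.mid) ++ ([some (3, P.f)] ++ (up 2 (bl P.blk) ++
      (up 1 (bl P.blk) ++ ([some (0, P.l)] ++ up 3 (bl P.mid))))) := by
    simp [mdw]
  have hm : ∀ k ∈ P.mid, k ∈ P.blk := fun k hk => by rw [blk]; simp [hk]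
  rw [e]
  exact (hP.rep_up 0 hm).append ((rep_singleton hP.f_mem).append
    ((hP.rep_up 2 fun _ h => h).append ((hP.rep_up 1 fun _ h => h).append
    ((rep_singleton hP.l_mem).append (hP.rep_up 3 hm)))))

theorem Good.first_notMem (hP : P.Good) : some (0, P.f) ∉ P.mdw ++ [some (3, P.l)] := by
  have := hP.blk_nodup
  rw [blk, List.nodup_cons, List.mem_append, List.mem_singleton, not_or] at this
  simp only [mdw, List.mem_append, List.mem_cons, mem_up, mem_bl]
  simp [this.1.1, this.1.2]

theorem Sys.CX_iff_first (hA : P.Sys A) (φ : Ix → List Ix) (p s : List Ix) :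
    P.CX A (p ++ ((P.W [] []).flatMap φ ++ s)) ↔
    P.CX A (p ++ ((P.W [none] []).flatMap φ ++ s)) := by
  have hP := hA.good
  have h := hA.CX_iff (M2 := P.mdw ++ [some (3, P.l)]) (E1 := []) (E2 := [])
    ((rep_singleton hP.f_mem).append (hP.rep_mdw.append (rep_singleton hP.l_mem))) φ p s
  have e1 : P.Uw [] ([some (0, P.f)] ++ (P.mdw ++ [some (3, P.l)])) [] = P.W [] [] := by
    simp [Uw, W]
  have e2 : P.Uw [] ([some (0, P.f)] ++ none :: (P.mdw ++ [some (3, P.l)])) [] =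
      P.W [none] [] := by
    simp [Uw, W]
  rwa [e1, e2] at h

/-- The `none` inserted before the last letter serves as the right boundary; the surrounded factor
still begins with `some (0, P.f)`. -/
theorem Sys.CX_iff_second (hA : P.Sys A) (φ : Ix → List Ix) (p s : List Ix) :
    P.CX A (p ++ ((P.W [] [none]).flatMap φ ++ s)) ↔
    P.CX A (p ++ ((P.W [none] [none]).flatMap φ ++ s)) := by
  have hP := hA.good
  have h := hA.CX_iff (M2 := P.mdw) (E1 := []) (E2 := [some (3, P.l), none])
    ((rep_singleton hP.f_mem).append hP.rep_mdw) φ p s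
  have e1 : P.Uw [] ([some (0, P.f)] ++ P.mdw) [some (3, P.l), none] = P.W [] [none] := by
    simp [Uw, W]
  have e2 : P.Uw [] ([some (0, P.f)] ++ none :: P.mdw) [some (3, P.l), none] =
      P.W [none] [none] := by
    simp [Uw, W]
  rwa [e1, e2] at h

theorem Sys.CY_iff_first (hA : P.Sys A) (φ : Ix → List Ix) (p s : List Ix) :
    P.CY A (p ++ ((P.W [] []).flatMap φ ++ s)) ↔
    P.CY A (p ++ ((P.W [] [none]).flatMap φ ++ s)) := by
  have h := hA.rev.CX_iff_first (fun i => Rr (φ (rl i))) (Rr s) (Rr p)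
  have e : ∀ w : List Ix, Rr (p ++ (w.flatMap φ ++ s)) =
      Rr s ++ ((Rr w).flatMap (fun i => Rr (φ (rl i))) ++ Rr p) := by
    intro w
    rw [Rr_append, Rr_append, Rr_flatMap, List.append_assoc]
  rw [CY_iff, CY_iff, e, e, Rr_W, Rr_W]
  exact h

/-- The `none` after the first letter is the left boundary here, so the surrounded factor lacks
`some (0, P.f)` and `Sys.CD_true_iff` applies. -/
theorem Sys.CX_and_CY_iff (hA : P.Sys A) (φ : Ix → List Ix) (p s : List Ix) :
    (P.CX A (p ++ ((P.W [none] []).flatMap φ ++ s)) ∧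
      P.CY A (p ++ ((P.W [none] []).flatMap φ ++ s))) ↔
    (P.CX A (p ++ ((P.W [none] [none]).flatMap φ ++ s)) ∧
      P.CY A (p ++ ((P.W [none] [none]).flatMap φ ++ s))) := by
  have hP := hA.good
  have h := hA.CD_true_iff (M1 := P.mdw) (M2 := [some (3, P.l)]) (E1 := [none, some (0, P.f)])
    (E2 := []) (hP.rep_mdw.append (rep_singleton hP.l_mem)) hP.first_notMem φ p s
  have e1 : P.Uw [none, some (0, P.f)] (P.mdw ++ [some (3, P.l)]) [] = P.W [none] [] := by
    simp [Uw, W]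
  have e2 : P.Uw [none, some (0, P.f)] (P.mdw ++ none :: [some (3, P.l)]) [] =
      P.W [none] [none] := by
    simp [Uw, W]
  rw [e1, e2, CD_true, CD_true] at h
  exact h

theorem closed_CD {u v : Word} (h : ∀ (φ : Letter → List Letter) (p q : List Letter),
      A (p ++ (u.toList.flatMap φ ++ q)) ↔ A (p ++ (v.toList.flatMap φ ++ q)))
    (D : Fin 4 → Prop) : Closed (P.CD D A) u v := by
  intro φ p s
  have e : ∀ (u : List Letter) (g : Ix → List Letter) (p0 q0 : List Letter),
      p0 ++ ((p ++ (u.flatMap φ ++ s)).flatMap g ++ q0) = (p0 ++ p.flatMap g) ++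
        (u.flatMap (fun i => (φ i).flatMap g) ++ (s.flatMap g ++ q0)) := by
    intro u g p0 q0
    simp [List.flatMap_append, List.flatMap_assoc]
  have key : ∀ (g : Ix → List Letter) (p0 q0 : List Letter),
      A (p0 ++ ((p ++ (u.toList.flatMap φ ++ s)).flatMap g ++ q0)) ↔
      A (p0 ++ ((p ++ (v.toList.flatMap φ ++ s)).flatMap g ++ q0)) := by
    intro g p0 q0
    rw [e, e]
    exact h _ _ _
  have key' : ∀ g : Ix → List Letter, A ((p ++ (u.toList.flatMap φ ++ s)).flatMap g) ↔
      A ((p ++ (v.toList.flatMap φ ++ s)).flatMap g) := fun g => by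
    simpa using key g [] []
  refine and_congr (forall_congr' fun p0 => forall_congr' fun g => forall_congr' fun q0 =>
    imp_congr_right fun _ => ?_) (forall_congr' fun c => imp_congr_right fun _ => key' _)
  rw [key]

theorem Good.not_isDistributive (hP : P.Good) {w : Word} (hw : w.toList = P.word) :
    ¬ (varietyMGammaPrime w).IsDistributive := by
  -- The identities have to be written in the original alphabet; any injective coding of the four
  -- copies will do.
  obtain ⟨n, hn⟩ := exists_injective_nat Ix
  let e : Ix → Letter := fun i => .y (n i)
  have he : Function.Injective e := fun i j h => hn (Letter.y.inj h)
  let V : List Ix → List Ix → Word := fun e1 e2 => FreeMonoid.ofList ((P.W e1 e2).map e)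
  have hA := hP.sys
  have toV : ∀ (e1 e2 : List Ix) (φ : Letter → List Ix), (V e1 e2).toList.flatMap φ =
      (P.W e1 e2).flatMap fun i => φ (e i) := by
    intro e1 e2 φ
    exact List.flatMap_map _ _ _
  refine not_isDistributive_of_closed (W0 := V [] []) (Wi := V [none] []) (Wj := V [] [none])
    (Wij := V [none] [none]) (CX := P.CX P.cls) (CY := P.CY P.cls)
    (fun u v h => closed_CD (cls_of_fic hw h) fun c => c ≠ 0)
    (fun u v h => closed_CD (cls_of_fic hw h) fun c => c ≠ 3) ?_ ?_ ?_ ?_ ?_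
  · intro φ p s
    rw [toV, toV]
    exact hA.CX_iff_first _ p s
  · intro φ p s
    rw [toV, toV]
    exact hA.CX_iff_second _ p s
  · intro φ p s
    rw [toV, toV]
    exact hA.CY_iff_first _ p s
  · intro φ p s
    rw [toV, toV]
    exact hA.CX_and_CY_iff _ p s
  · intro h
    -- Decoding the letters gives back the words `W`, so `W [] []` and `W [] [none]` would have to
    -- lie in the same languages.
    have h1 := h (fun a => [Function.invFun e a]) [] []
    have h2 : ∀ e1 e2 : List Ix,
        [] ++ ((V e1 e2).toList.flatMap (fun a => [Function.invFun e a]) ++ []) = P.W e1 e2 := by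
      intro e1 e2
      rw [toV]
      simp [Function.leftInverse_invFun he _]
    rw [h2, h2] at h1
    exact hP.Wj_not_CX hA (h1.1 ⟨hP.W_CX hA, hP.W_CY hA⟩).1

end Pat

end MonVar

theorem mainTheorem6 (k k' p : ℕ) (hk : |(k : ℤ) - (k' : ℤ)| ≤ 1)
    (hp : p = 1 ∨ p = 2 ∨ p = 3 ∨ p = 4)
    (hnd : 2 ≤ k + k' ∨ (p = 1 ∧ k = 0 ∧ k' = 1) ∨ (p = 2 ∧ k = 1 ∧ k' = 0))
    (π : Equiv.Perm (Fin (k + k'))) (hπ : MonVar.IsNMPerm k k' π) :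
    ¬ (MonVar.varietyMGammaPrime (MonVar.aWord p k k' π)).IsDistributive := by
  obtain ⟨P, hP, hw⟩ := MonVar.exists_good k k' p hp hnd π hπ
  exact hP.not_isDistributive hw
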